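/- Let $G$ be a compact connected Lie group with Lie algebra $\mathfrak g$. Fix an inner product on $\mathfrak g$ with norm $|\cdot|$, let $d_G$ be the distance of the associated left-invariant Riemannian metric, and fix a maximal abelian subalgebra $\mathfrak t\subset\mathfrak g$ and a Weyl chamber (a choice of positive roots). For an irreducible (hence finite-dimensional) unitary representation $\pi$ of $G$ on $H_\pi$, let $\lambda_\pi$ be its highest weight, a real linear form on $\mathfrak t$ after division by $i$, and $|\lambda_\pi|$ its norm. Put $m_G=(\dim G-\dim\mathfrak t)/2$. A subset $\Gamma\subset G$ is Diophantine if there are $C,\delta>0$ such that for all nontrivial irreducible $\pi$ and all $v\in H_\pi$ there is $g\in\Gamma$ with $\|v-\pi(g)v\|\ge \delta|\lambda_\pi|^{-C}\|v\|$. Let $A$ be an aperiodic $N\times N$ matrix of zeros and ones, $X$ and $X^+$ the two-sided and one-sided subshifts of finite type of $A$, with shift $\sigma$ and coordinate projection $\Pi_+:X\to X^+$, let $\lambda\in(0,1)$, and give $X^+$ the metric $d_\lambda(x,y)=\lambda^{\min\{i:\,x_i\ne y_i\}}$. Let $\varphi:X^+\to\mathbb R$, $r:X^+\to(0,\infty)$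 and $\Theta:X^+\to(G,d_G)$ be Lipschitz, with $\sum_{\sigma y=x}e^{\varphi(y)}=1$ for every $x\in X^+$. Write $r_n=\sum_{i<n}r\circ\sigma^i$ and $\Theta_n=(\Theta\circ\sigma^{n-1})\cdots(\Theta\circ\sigma)\,\Theta$, and regard $r,\Theta,r_n,\Theta_n$ also as functions on $X$ through $\Pi_+$. A stable leg of size $n_0$ from $x\in X$ to $y\in X$ requires $y_i=x_i$ for all $i\ge n_0$; it has displacement $\Delta^s(x,y)=\lim_n (r_n(y)-r_n(x))$ and twist $\Theta^s(x,y)=\lim_n\Theta_n(y)^{-1}\Theta_n(x)$. An unstable leg of size $n_0$ requires $y_i=x_i$ for all $i\le -n_0$; it has displacement $\Delta^u(x,y)=\lim_n (r_n(\sigma^{-n}x)-r_n(\sigma^{-n}y))$ and twist $\Theta^u(x,y)=\lim_n\Theta_n(\sigma^{-n}y)\Theta_n(\sigma^{-n}x)^{-1}$. Let $\Gamma(w,n_0,p_0)\subset G$ be the set of products $g_{p-1}\cdots g_0$ of the successive twists of the closed chains at $w$ that consist of $p\le p_0$ legs of size $n_0$ and have total displacement $0$. Assume that $\Gamma(w,n_0,p_0)$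 is Diophantine for some $w\in X$, $n_0\in\mathbb N$, $p_0\ge1$. For $b\in\mathbb R$ and an irreducible unitary representation $\pi$ let $$\mathcal L_{ib,\pi}h(x)=\sum_{\sigma y=x}e^{\varphi(y)-ib\,r(y)}\,\pi(\Theta(y))h(y),\qquad h:X^+\to H_\pi,$$ and, for constants $C_{15}>0$ and $C_{18}\ge1$, put $b_\pi=|b|+C_{15}|\lambda_\pi|^{1+m_G/2}$ and $\|h\|_{b_\pi}=\max\{\|h\|_\infty,\ |h|_{\mathrm{Lip}}/(C_{18}b_\pi)\}$, where $|h|_{\mathrm{Lip}}$ is the Lipschitz constant for $d_\lambda$. Then for every sufficiently large $C_{15}$ and, given $C_{15}$, every sufficiently large $C_{18}$, there are $C_{23},C_{25}>0$ such that for every nontrivial irreducible unitary representation $\pi$ of $G$ and every $b\in\mathbb R$ one has $b_\pi>1$ and, for every Lipschitz $h:X^+\to H_\pi$, the function $\mathcal L_{ib,\pi}^{n}h$ with $n=\lceil C_{25}\log b_\pi\rceil$ is Lipschitz and $$\|\mathcal L_{ib,\pi}^{n}h\|_{b_\pi}\le\bigl(1-b_\pi^{-C_{23}}\bigr)\|h\|_{b_\pi}.$$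 -/

import Mathlib

open scoped Manifold ContDiff Topology
open Filter

/-! ### Subshifts of finite type -/

/-- Every entry of `A` is `0` or `1`. -/
def IsZeroOne {N : ℕ} (A : Matrix (Fin N) (Fin N) ℕ) : Prop :=
  ∀ i j, A i j = 0 ∨ A i j = 1

/-- Some power `A ^ n`, `n ≥ 1`, has only positive entries. -/
def IsAperiodic {N : ℕ} (A : Matrix (Fin N) (Fin N) ℕ) : Prop :=
  ∃ n : ℕ, 1 ≤ n ∧ ∀ i j, 0 < (A ^ n) i j

/-- The two-sided shift space `X` of the transition matrix `A`. -/
def TwoSided {N : ℕ} (A : Matrix (Fin N) (Fin N) ℕ) : Type :=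
  {x : ℤ → Fin N // ∀ i, A (x i) (x (i + 1)) = 1}

/-- The one-sided shift space `X⁺` of the transition matrix `A`. -/
def OneSided {N : ℕ} (A : Matrix (Fin N) (Fin N) ℕ) : Type :=
  {x : ℕ → Fin N // ∀ i, A (x i) (x (i + 1)) = 1}

section Shift

variable {N : ℕ} {A : Matrix (Fin N) (Fin N) ℕ}

/-- The shift `σ : X⁺ → X⁺`. -/
def OneSided.shift (x : OneSided A) : OneSided A :=
  ⟨fun i => x.1 (i + 1), fun i => x.2 (i + 1)⟩

/-- The power `σ⁻ⁿ : X → X` of the inverse of the two-sided shift. -/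
def TwoSided.shiftBack (n : ℕ) (x : TwoSided A) : TwoSided A :=
  ⟨fun i => x.1 (i - n), fun i => by
    have h := x.2 (i - n)
    rwa [show i - (n : ℤ) + 1 = i + 1 - n by ring] at h⟩

/-- The coordinate projection `Π₊ : X → X⁺`. -/
def TwoSided.future (x : TwoSided A) : OneSided A :=
  ⟨fun i => x.1 (i : ℤ), fun i => by
    have h := x.2 (i : ℤ)
    simpa using h⟩

open Classical in
/-- The metric `d_λ(x, y) = λ ^ min {i | x_i ≠ y_i}` on `X⁺`, with `d_λ(x, x) = 0`. -/
noncomputable def OneSided.dist (lam : ℝ) (x y : OneSided A) : ℝ :=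
  if x = y then 0 else lam ^ sInf {i : ℕ | x.1 i ≠ y.1 i}

/-- `F_λ(X⁺, V)`: the functions `X⁺ → V` that are Lipschitz for `d_λ`. -/
def MemLip {V : Type*} [NormedAddCommGroup V] (lam : ℝ) (h : OneSided A → V) : Prop :=
  ∃ K : ℝ, ∀ x y, ‖h x - h y‖ ≤ K * OneSided.dist lam x y

/-- The supremum norm. -/
noncomputable def supNorm {V : Type*} [NormedAddCommGroup V] (h : OneSided A → V) : ℝ :=
  ⨆ x, ‖h x‖

/-- The Lipschitz seminorm for `d_λ`. (Pairs with `x = y` contribute `0 / 0 = 0`.) -/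
noncomputable def lipNorm {V : Type*} [NormedAddCommGroup V] (lam : ℝ) (h : OneSided A → V) : ℝ :=
  ⨆ p : OneSided A × OneSided A, ‖h p.1 - h p.2‖ / OneSided.dist lam p.1 p.2

/-- The norm `max {‖h‖_∞, |h|_Lip / (K β)}`. -/
noncomputable def scaledNorm {V : Type*} [NormedAddCommGroup V] (lam K β : ℝ)
    (h : OneSided A → V) : ℝ :=
  max (supNorm h) (lipNorm lam h / (K * β))

/-- `∑_{σ y = x} e^{φ y} = 1` for every `x`, i.e. the transfer operator of `φ` fixes the constant
function `1`. -/
def IsNormalizedPotential (φ : OneSided A → ℝ) : Prop :=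
  ∀ x : OneSided A, ∑ᶠ (y : OneSided A) (_ : y.shift = x), Real.exp (φ y) = 1

/-- The Birkhoff sum `r_n = r + r ∘ σ + ⋯ + r ∘ σ^{n-1}`. -/
noncomputable def roofSum (r : OneSided A → ℝ) (n : ℕ) (x : OneSided A) : ℝ :=
  birkhoffSum OneSided.shift r n x

/-- The cocycle `Θ_n(x) = Θ(σ^{n-1} x) ⋯ Θ(σ x) Θ(x)`. -/
def cocycle {G : Type*} [Group G] (Θ : OneSided A → G) : ℕ → OneSided A → G
  | 0, _ => 1
  | n + 1, x => Θ (OneSided.shift^[n] x) * cocycle Θ n x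

/-- A leg of size `n₀` from `x` to `y`, with time displacement `t` and twist `g`. Either
`y ∈ W^s_{n₀}(x)` and `t = Δ^s(x, y)`, `g = Θ^s(x, y)`, or `y ∈ W^u_{n₀}(x)` and
`t = Δ^u(x, y)`, `g = Θ^u(x, y)`; the four quantities are the indicated limits. -/
def IsLeg {G : Type*} [Group G] [TopologicalSpace G] (r : OneSided A → ℝ) (Θ : OneSided A → G)
    (n₀ : ℕ) (x y : TwoSided A) (t : ℝ) (g : G) : Prop :=
  ((∀ i : ℤ, (n₀ : ℤ) ≤ i → y.1 i = x.1 i) ∧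
    Tendsto (fun n => roofSum r n y.future - roofSum r n x.future) atTop (𝓝 t) ∧
    Tendsto (fun n => (cocycle Θ n y.future)⁻¹ * cocycle Θ n x.future) atTop (𝓝 g)) ∨
  ((∀ i : ℤ, i ≤ -(n₀ : ℤ) → y.1 i = x.1 i) ∧
    Tendsto (fun n => roofSum r n (x.shiftBack n).future - roofSum r n (y.shiftBack n).future)
      atTop (𝓝 t) ∧
    Tendsto (fun n => cocycle Θ n (y.shiftBack n).future * (cocycle Θ n (x.shiftBack n).future)⁻¹)
      atTop (𝓝 g))

/-- The set `Γ(w, n₀, p₀)` of the twists `g_{p-1} ⋯ g_1 g_0` of the closed chains at `w` with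
`p ≤ p₀` legs of size `n₀` and with total time displacement zero. -/
def chainTwists {G : Type*} [Group G] [TopologicalSpace G] (r : OneSided A → ℝ)
    (Θ : OneSided A → G) (w : TwoSided A) (n₀ p₀ : ℕ) : Set G :=
  {a | ∃ (p : ℕ) (c : ℕ → TwoSided A) (t : ℕ → ℝ) (g : ℕ → G),
    p ≤ p₀ ∧ c 0 = w ∧ c p = w ∧ (∀ i < p, IsLeg r Θ n₀ (c i) (c (i + 1)) (t i) (g i)) ∧
    ∑ i ∈ Finset.range p, t i = 0 ∧ a = ((List.range p).reverse.map g).prod}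

end Shift

/-! ### Irreducible unitary representations and the twisted transfer operators -/

/-- An irreducible unitary representation of `G`, in coordinates: a strongly continuous
homomorphism into the unitary operators of `ℂ^d`, `d ≥ 1`, without nontrivial invariant subspace. -/
structure UnitaryIrrep (G : Type*) [Group G] [TopologicalSpace G] where
  /-- the dimension -/
  dim : ℕ
  dim_pos : 0 < dim
  /-- the homomorphism -/
  toHom : G →* unitary (EuclideanSpace ℂ (Fin dim) →L[ℂ] EuclideanSpace ℂ (Fin dim))
  continuous_apply : ∀ v : EuclideanSpace ℂ (Fin dim),
    Continuous fun g => (toHom g : EuclideanSpace ℂ (Fin dim) →L[ℂ] EuclideanSpace ℂ (Fin dim)) v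
  irreducible : ∀ W : Submodule ℂ (EuclideanSpace ℂ (Fin dim)),
    (∀ g, ∀ v ∈ W,
      (toHom g : EuclideanSpace ℂ (Fin dim) →L[ℂ] EuclideanSpace ℂ (Fin dim)) v ∈ W) →
    W = ⊥ ∨ W = ⊤

namespace UnitaryIrrep

variable {G : Type*} [Group G] [TopologicalSpace G]

/-- The representation space `H_π`. -/
abbrev Space (π : UnitaryIrrep G) : Type := EuclideanSpace ℂ (Fin π.dim)

/-- The operator `π(g)` on `H_π`. -/
noncomputable def op (π : UnitaryIrrep G) (g : G) : π.Space →L[ℂ] π.Space := (π.toHom g).1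

/-- `π ≠ 1`. -/
def Nontrivial (π : UnitaryIrrep G) : Prop := ∃ g, π.op g ≠ 1

/-- The twisted transfer operator
`(𝓛_{s,π} h)(x) = ∑_{σ y = x} e^{φ(y) - s r(y)} π(Θ(y)) h(y)`. -/
noncomputable def transfer {N : ℕ} {A : Matrix (Fin N) (Fin N) ℕ} (π : UnitaryIrrep G)
    (φ r : OneSided A → ℝ) (Θ : OneSided A → G) (s : ℂ) (h : OneSided A → π.Space) :
    OneSided A → π.Space :=
  fun x => ∑ᶠ (y : OneSided A) (_ : y.shift = x),
    Complex.exp ((φ y : ℂ) - s * (r y : ℂ)) • π.op (Θ y) (h y)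

end UnitaryIrrep

/-! ### Compact Lie groups: invariant distance, roots, highest weights -/

section LieGroup

variable {E : Type*} [NormedAddCommGroup E] [NormedSpace ℝ E]
  {G : Type*} [TopologicalSpace G] [ChartedSpace E G] [Group G]

/-- `B` is an inner product on the Lie algebra of `G`. -/
def IsInnerProduct (B : LinearMap.BilinForm ℝ (GroupLieAlgebra 𝓘(ℝ, E) G)) : Prop :=
  (∀ X Y, B X Y = B Y X) ∧ ∀ X, X ≠ 0 → 0 < B X X

/-- The velocity of the curve `γ` at time `t`, moved to the Lie algebra by left translation. -/
noncomputable def leftVelocity (γ : ℝ → G) (t : ℝ) : GroupLieAlgebra 𝓘(ℝ, E) G :=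
  (mfderiv 𝓘(ℝ, ℝ) 𝓘(ℝ, E) (fun s => (γ t)⁻¹ * γ s) t (1 : ℝ) : E)

/-- The distance `d_G` of the left-invariant Riemannian metric given by the inner product `B`: the
infimum of `∫₀¹ |γ(t)⁻¹ γ'(t)| dt` over the `C¹` curves `γ` from `g` to `g'`. -/
noncomputable def lieDist (B : LinearMap.BilinForm ℝ (GroupLieAlgebra 𝓘(ℝ, E) G)) (g g' : G) :
    ENNReal :=
  ⨅ (γ : ℝ → G) (_ : ContMDiff 𝓘(ℝ, ℝ) 𝓘(ℝ, E) 1 γ) (_ : γ 0 = g) (_ : γ 1 = g'),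
    ∫⁻ t in Set.Icc (0 : ℝ) 1,
      ENNReal.ofReal (Real.sqrt (B (leftVelocity γ t) (leftVelocity γ t)))

/-- `F_λ(X⁺, G)`: the maps `X⁺ → G` that are Lipschitz for `d_λ` and `d_G`. -/
def MemLipGroup {N : ℕ} {A : Matrix (Fin N) (Fin N) ℕ}
    (B : LinearMap.BilinForm ℝ (GroupLieAlgebra 𝓘(ℝ, E) G)) (lam : ℝ) (Θ : OneSided A → G) :
    Prop :=
  ∃ K : ℝ, ∀ x y, lieDist B (Θ x) (Θ y) ≤ ENNReal.ofReal (K * OneSided.dist lam x y)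

/-- `𝔱` is a maximal abelian subalgebra (the Lie algebra of a maximal torus). -/
def IsMaximalAbelian (𝔱 : Submodule ℝ (GroupLieAlgebra 𝓘(ℝ, E) G)) : Prop :=
  (∀ X ∈ 𝔱, ∀ Y ∈ 𝔱, ⁅X, Y⁆ = 0) ∧ ∀ Z, (∀ X ∈ 𝔱, ⁅X, Z⁆ = 0) → Z ∈ 𝔱

/-- `α` is a (real) root: `α ≠ 0` and there is `Z = X + iY ≠ 0` in the complexified Lie algebra
with `⁅H, Z⁆ = i α(H) Z` for every `H ∈ 𝔱`, written out in real and imaginary parts. -/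
def IsRoot (𝔱 : Submodule ℝ (GroupLieAlgebra 𝓘(ℝ, E) G)) (α : Module.Dual ℝ 𝔱) : Prop :=
  α ≠ 0 ∧ ∃ X Y : GroupLieAlgebra 𝓘(ℝ, E) G, (X ≠ 0 ∨ Y ≠ 0) ∧
    ∀ H : 𝔱, ⁅(H : GroupLieAlgebra 𝓘(ℝ, E) G), X⁆ = -(α H • Y) ∧
      ⁅(H : GroupLieAlgebra 𝓘(ℝ, E) G), Y⁆ = α H • X

/-- `H₀ ∈ 𝔱` is regular: no root vanishes on it. Such an element fixes a Weyl chamber, and the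
positive roots are those with `0 < α H₀`. -/
def IsRegularElement (𝔱 : Submodule ℝ (GroupLieAlgebra 𝓘(ℝ, E) G)) (H₀ : 𝔱) : Prop :=
  ∀ α, IsRoot 𝔱 α → α H₀ ≠ 0

/-- The derived representation `dπ(X)` (a continuous finite-dimensional representation of a Lie
group is smooth). -/
noncomputable def UnitaryIrrep.deriv (π : UnitaryIrrep G) (X : GroupLieAlgebra 𝓘(ℝ, E) G) :
    π.Space →L[ℂ] π.Space :=
  mfderiv 𝓘(ℝ, E) 𝓘(ℝ, π.Space →L[ℂ] π.Space) π.op (1 : G) X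

/-- `μ` is a (real) weight of `π`: there is `v ≠ 0` with `dπ(X) v = i μ(X) v` for all `X ∈ 𝔱`. -/
def IsWeight (𝔱 : Submodule ℝ (GroupLieAlgebra 𝓘(ℝ, E) G)) (π : UnitaryIrrep G)
    (μ : Module.Dual ℝ 𝔱) : Prop :=
  ∃ v : π.Space, v ≠ 0 ∧
    ∀ X : 𝔱, π.deriv (X : GroupLieAlgebra 𝓘(ℝ, E) G) v = (Complex.I * (μ X : ℂ)) • v

/-- `ℓ` is the highest weight of `π` for the positive system of `H₀`: it is a weight, and every
weight is obtained from it by subtracting a sum of positive roots. -/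
def IsHighestWeight (𝔱 : Submodule ℝ (GroupLieAlgebra 𝓘(ℝ, E) G)) (H₀ : 𝔱)
    (π : UnitaryIrrep G) (ℓ : Module.Dual ℝ 𝔱) : Prop :=
  IsWeight 𝔱 π ℓ ∧ ∀ μ, IsWeight 𝔱 π μ →
    ℓ - μ ∈ AddSubmonoid.closure {α : Module.Dual ℝ 𝔱 | IsRoot 𝔱 α ∧ 0 < α H₀}

/-- The norm of a linear form on `𝔱` induced by the inner product `B`; it is the norm of the
element of `𝔱` that represents the form. -/
noncomputable def weightNorm (B : LinearMap.BilinForm ℝ (GroupLieAlgebra 𝓘(ℝ, E) G))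
    (𝔱 : Submodule ℝ (GroupLieAlgebra 𝓘(ℝ, E) G)) (μ : Module.Dual ℝ 𝔱) : ℝ :=
  sSup {c : ℝ | ∃ X : 𝔱, B X X ≤ 1 ∧ c = |μ X|}

/-- `m_G = (dim G - rank G) / 2`, the rank being the dimension of `𝔱`. -/
noncomputable def halfRootNumber (𝔱 : Submodule ℝ (GroupLieAlgebra 𝓘(ℝ, E) G)) : ℝ :=
  ((Module.finrank ℝ (GroupLieAlgebra 𝓘(ℝ, E) G) : ℝ) - (Module.finrank ℝ 𝔱 : ℝ)) / 2

/-- `Γ ⊆ G` is Diophantine: for some `C, δ > 0`, for every irreducible `π ≠ 1` with highest weight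
`ℓ` and every `v ∈ H_π` there is `g ∈ Γ` with `‖v - π(g) v‖ ≥ ‖v‖ δ / |ℓ|^C`. -/
def IsDiophantine (B : LinearMap.BilinForm ℝ (GroupLieAlgebra 𝓘(ℝ, E) G))
    (𝔱 : Submodule ℝ (GroupLieAlgebra 𝓘(ℝ, E) G)) (H₀ : 𝔱) (Γ : Set G) : Prop :=
  ∃ C > (0 : ℝ), ∃ δ > (0 : ℝ), ∀ π : UnitaryIrrep G, π.Nontrivial →
    ∀ ℓ, IsHighestWeight 𝔱 H₀ π ℓ → ∀ v : π.Space, ∃ g ∈ Γ,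
      ‖v‖ * (δ / weightNorm B 𝔱 ℓ ^ C) ≤ ‖v - π.op g v‖

/-- The frequency `b_π = |b| + C |ℓ|^{1 + m_G / 2}` for the highest weight `ℓ` of `π`. -/
noncomputable def frequency (B : LinearMap.BilinForm ℝ (GroupLieAlgebra 𝓘(ℝ, E) G))
    (𝔱 : Submodule ℝ (GroupLieAlgebra 𝓘(ℝ, E) G)) (C : ℝ) (ℓ : Module.Dual ℝ 𝔱) (b : ℝ) : ℝ :=
  |b| + C * weightNorm B 𝔱 ℓ ^ (1 + halfRootNumber 𝔱 / 2)

end LieGroup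

/-! ### Symbolic dynamics -/

section Symbolic

variable {N : ℕ} {A : Matrix (Fin N) (Fin N) ℕ}

namespace OneSided

/-! Put `p = e^φ` and `U = e^{-ibr} π(Θ)`. Then `𝓛^n h (x)` is a convex combination of the vectors
`U_n(y) h(y)` over the points with `σ^n y = x`. A Lasota–Yorke inequality contracts the Lipschitz
part of the norm, so the issue is the supremum.

Suppose that `‖h‖ ≤ 1` and that `‖𝓛^n h (x)‖` exceeds `1 - ε`, with `n = 2q + M`. Strict convexity
of the ball forces all the vectors `U_n(y) h(y)` to be close to one unit vector `e`, up to `√(2 c^n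
ε)`, where `1/c` bounds the weights from below. By aperiodicity every two-sided `z` has a companion
`y(z)` that follows `z` on `[-q, q]` and ends at `x` (`exists_glue`). Let `f(z)` be `e` transported
back along `y(z)` to time zero. On a stable leg `f` is multiplied by the twist up to `O(b_π λ^q)`,
since the two companions merge. On an unstable leg the same holds up to the errors above, since
`f(z)` is close to `U_q(y(z)) h(y(z))` and the two companions share a long initial word. Hence
`f(w)` is almost fixed by the twist of every closed chain at `w` (`exists_unit_almost_fixed`). For
zero displacement the phases cancel and the twists are `π(a)` with `a ∈ Γ`. With `q` a multiple of
`log b_π` and `ε` a negative power of `b_π` (`exists_iterate_constants`), this contradicts the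
Diophantine condition.

Two uniform facts about representations are needed. One is `‖dπ‖ = O(|λ_π|)`, which makes the
Lipschitz constant of `U` of order `b_π`: the Casimir operator is a scalar, and it can be bounded at
a highest weight vector, which positive root vectors annihilate (`exists_norm_derivCLM_le`). The
other is that `|λ_π|` stays away from zero for `π ≠ 1`: a small `dπ` would keep `π(G)` in a small
ball around the identity, and a group of operators in such a ball is trivial
(`exists_le_norm_derivCLM`). Differentiability of `π` itself is obtained from continuity by
convolution with a bump function. -/

lemma dist_nonneg {lam : ℝ} (h0 : 0 ≤ lam) (x y : OneSided A) : 0 ≤ dist lam x y := by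
  unfold dist
  split_ifs <;> positivity

@[simp] lemma dist_self (lam : ℝ) (x : OneSided A) : dist lam x x = 0 := by simp [dist]

lemma dist_le_pow {lam : ℝ} (h0 : 0 ≤ lam) (h1 : lam ≤ 1) {x y : OneSided A} {k : ℕ}
    (h : ∀ i < k, x.1 i = y.1 i) : dist lam x y ≤ lam ^ k := by
  unfold dist
  split_ifs with hxy
  · positivity
  · refine pow_le_pow_of_le_one h0 h1 ?_
    have hne : {i : ℕ | x.1 i ≠ y.1 i}.Nonempty := by
      by_contra hcon
      apply hxy
      apply Subtype.ext
      funext i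
      by_contra hi
      exact hcon ⟨i, hi⟩
    by_contra hlt
    exact Nat.sInf_mem hne (h _ (not_le.1 hlt))

lemma dist_le_one {lam : ℝ} (h0 : 0 ≤ lam) (h1 : lam ≤ 1) (x y : OneSided A) :
    dist lam x y ≤ 1 := by
  simpa using dist_le_pow h0 h1 (x := x) (y := y) (k := 0) (by simp)

lemma dist_eq_one (lam : ℝ) {x y : OneSided A} (h : x.1 0 ≠ y.1 0) : dist lam x y = 1 := by
  have hxy : x ≠ y := fun e => h (by rw [e])
  have : sInf {i : ℕ | x.1 i ≠ y.1 i} = 0 := Nat.sInf_eq_zero.2 (Or.inl h)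
  simp [dist, hxy, this]

lemma dist_le_mul_dist_shift {lam : ℝ} (h0 : 0 ≤ lam) (h1 : lam ≤ 1) {x y : OneSided A}
    (h : x.1 0 = y.1 0) : dist lam x y ≤ lam * dist lam x.shift y.shift := by
  by_cases hs : x.shift = y.shift
  · have : x = y := by
      apply Subtype.ext
      funext i
      cases i with
      | zero => exact h
      | succ j => exact congrFun (congrArg Subtype.val hs) j
    rw [this, dist_self, dist_self, mul_zero]
  · have : dist lam x.shift y.shift = lam ^ sInf {i : ℕ | x.shift.1 i ≠ y.shift.1 i} := by
      simp [dist, hs]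
    rw [this, ← pow_succ']
    refine dist_le_pow h0 h1 fun i hi => ?_
    cases i with
    | zero => exact h
    | succ j =>
      by_contra hj
      have := Nat.sInf_le (show j ∈ {i : ℕ | x.shift.1 i ≠ y.shift.1 i} from hj)
      omega

@[simp] lemma shift_apply (x : OneSided A) (i : ℕ) : x.shift.1 i = x.1 (i + 1) := rfl

lemma iterate_shift_apply (x : OneSided A) (n i : ℕ) : (shift^[n] x).1 i = x.1 (i + n) := by
  induction n generalizing x with
  | zero => rfl
  | succ n ih => rw [Function.iterate_succ_apply, ih, shift_apply, add_assoc]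

open Classical in
/-- The sequence `i x₀ x₁ …` if it is admissible, and `x` otherwise. -/
noncomputable def cons (i : Fin N) (x : OneSided A) : OneSided A :=
  if h : A i (x.1 0) = 1 then
    ⟨fun k => Nat.casesOn k i x.1, fun k => by
      cases k with
      | zero => exact h
      | succ k => exact x.2 k⟩
  else x

lemma cons_zero {i : Fin N} {x : OneSided A} (h : A i (x.1 0) = 1) : (cons i x).1 0 = i := by
  simp [cons, h]

lemma shift_cons {i : Fin N} {x : OneSided A} (h : A i (x.1 0) = 1) : (cons i x).shift = x := by
  apply Subtype.ext
  funext k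
  simp [cons, h, shift]

lemma cons_shift (y : OneSided A) : cons (y.1 0) y.shift = y := by
  have h : A (y.1 0) (y.shift.1 0) = 1 := y.2 0
  apply Subtype.ext
  funext k
  cases k with
  | zero => exact cons_zero h
  | succ k => exact congrFun (congrArg Subtype.val (shift_cons h)) k

open Classical in
/-- The letters that may precede `x`. -/
noncomputable def letters (x : OneSided A) : Finset (Fin N) :=
  Finset.univ.filter fun i => A i (x.1 0) = 1

lemma mem_letters {x : OneSided A} {i : Fin N} : i ∈ letters x ↔ A i (x.1 0) = 1 := by
  simp [letters]

lemma letters_congr {x y : OneSided A} (h : x.1 0 = y.1 0) : letters x = letters y := by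
  ext i; rw [mem_letters, mem_letters, h]

/-- The letters allowed before `x` depend on `x₀` alone, so two points with the same first
coordinate have preimages paired by their first letter. Every estimate on the operator uses this
pairing. -/
lemma finsum_preimages {M : Type*} [AddCommMonoid M] (f : OneSided A → M) (x : OneSided A) :
    ∑ᶠ (y : OneSided A) (_ : y.shift = x), f y = ∑ i ∈ letters x, f (cons i x) := by
  classical
  have hinj : Set.InjOn (fun i => cons i x) (letters x : Set (Fin N)) := by
    intro i hi j hj hij
    have := congrArg (fun z : OneSided A => z.1 0) hij
    simpa [cons_zero (mem_letters.1 hi), cons_zero (mem_letters.1 hj)] using this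
  have hset : {y : OneSided A | y.shift = x} = ↑((letters x).image fun i => cons i x) := by
    ext y
    simp only [Set.mem_ofPred_eq, Finset.coe_image, Set.mem_image, Finset.mem_coe]
    constructor
    · rintro rfl
      exact ⟨y.1 0, mem_letters.2 (y.2 0), cons_shift y⟩
    · rintro ⟨i, hi, rfl⟩
      exact shift_cons (mem_letters.1 hi)
  rw [← Finset.sum_image (f := f) hinj, ← finsum_mem_coe_finset, ← hset]
  rfl

lemma letters_nonempty_of_shift (y : OneSided A) : y.1 0 ∈ letters y.shift :=
  mem_letters.2 (y.2 0)

lemma dist_cons_le {lam : ℝ} (h0 : 0 ≤ lam) (h1 : lam ≤ 1) {x y : OneSided A}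
    (h : x.1 0 = y.1 0) {i : Fin N} (hi : i ∈ letters x) :
    dist lam (cons i x) (cons i y) ≤ lam * dist lam x y := by
  have hx := mem_letters.1 hi
  have hy : A i (y.1 0) = 1 := h ▸ hx
  have := dist_le_mul_dist_shift h0 h1 (x := cons i x) (y := cons i y)
    (by rw [cons_zero hx, cons_zero hy])
  rwa [shift_cons hx, shift_cons hy] at this

end OneSided

lemma cocycle_succ_shift {G : Type*} [Group G] (Θ : OneSided A → G) (n : ℕ) (x : OneSided A) :
    cocycle Θ (n + 1) x = cocycle Θ n x.shift * Θ x := by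
  induction n with
  | zero => simp [cocycle]
  | succ n ih =>
    rw [cocycle, ih, cocycle, ← mul_assoc, Function.iterate_succ_apply]

lemma cocycle_add {G : Type*} [Group G] (Θ : OneSided A → G) (m n : ℕ) (x : OneSided A) :
    cocycle Θ (m + n) x = cocycle Θ m (OneSided.shift^[n] x) * cocycle Θ n x := by
  induction m with
  | zero => simp [cocycle]
  | succ m ih =>
    rw [show m + 1 + n = (m + n) + 1 by ring, cocycle, ih, cocycle, ← mul_assoc,
      Function.iterate_add_apply]

end Symbolic

/-! ### Transfer operators twisted by a unitary cocycle -/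

section UnitaryTransfer

variable {N : ℕ} {A : Matrix (Fin N) (Fin N) ℕ}
variable {V : Type*} [NormedAddCommGroup V] [InnerProductSpace ℂ V] [CompleteSpace V]

/-- Unitary factors have no effect on the norm, so errors in long products add up instead of
multiplying. -/
lemma norm_unitary_mul_sub_mul_le (a b a' b' : unitary (V →L[ℂ] V)) :
    ‖((a * b : unitary (V →L[ℂ] V)) : V →L[ℂ] V) - (a' * b' : unitary (V →L[ℂ] V))‖ ≤
      ‖(a : V →L[ℂ] V) - a'‖ + ‖(b : V →L[ℂ] V) - b'‖ := by
  have h : ((a * b : unitary (V →L[ℂ] V)) : V →L[ℂ] V) - (a' * b' : unitary (V →L[ℂ] V)) =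
      ((a : V →L[ℂ] V) - a') * b + a' * ((b : V →L[ℂ] V) - b') := by
    push_cast
    rw [sub_mul, mul_sub]
    abel
  rw [h]
  refine (norm_add_le _ _).trans (le_of_eq ?_)
  rw [CStarRing.norm_mul_coe_unitary, CStarRing.norm_coe_unitary_mul]

lemma norm_unitary_inv_sub_inv (a b : unitary (V →L[ℂ] V)) :
    ‖((a⁻¹ : unitary (V →L[ℂ] V)) : V →L[ℂ] V) - (b⁻¹ : unitary (V →L[ℂ] V))‖ =
      ‖(a : V →L[ℂ] V) - b‖ := by
  have h : ((a⁻¹ : unitary (V →L[ℂ] V)) : V →L[ℂ] V) - (b⁻¹ : unitary (V →L[ℂ] V)) =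
      star ((a : V →L[ℂ] V) - b) := by
    rw [star_sub]; rfl
  rw [h, norm_star]

lemma unitary_mul_apply (a b : unitary (V →L[ℂ] V)) (v : V) :
    ((a * b : unitary (V →L[ℂ] V)) : V →L[ℂ] V) v = (a : V →L[ℂ] V) ((b : V →L[ℂ] V) v) := rfl

lemma unitary_inv_apply_apply (a : unitary (V →L[ℂ] V)) (v : V) :
    ((a⁻¹ : unitary (V →L[ℂ] V)) : V →L[ℂ] V) ((a : V →L[ℂ] V) v) = v := by
  rw [← unitary_mul_apply, inv_mul_cancel]; rfl

lemma unitary_apply_inv_apply (a : unitary (V →L[ℂ] V)) (v : V) :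
    (a : V →L[ℂ] V) (((a⁻¹ : unitary (V →L[ℂ] V)) : V →L[ℂ] V) v) = v := by
  rw [← unitary_mul_apply, mul_inv_cancel]; rfl

lemma inner_unitary_inv_left (a : unitary (V →L[ℂ] V)) (v w : V) :
    inner ℂ (((a⁻¹ : unitary (V →L[ℂ] V)) : V →L[ℂ] V) v) w = inner ℂ v ((a : V →L[ℂ] V) w) := by
  rw [← Unitary.inner_map_map a, unitary_apply_inv_apply]

/-- The operator `h ↦ ∑_{σ y = x} p(y) U(y) h(y)`. -/
noncomputable def unitaryTransfer (p : OneSided A → ℝ) (U : OneSided A → unitary (V →L[ℂ] V))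
    (h : OneSided A → V) : OneSided A → V :=
  fun x => ∑ᶠ (y : OneSided A) (_ : y.shift = x), (p y : ℂ) • (U y : V →L[ℂ] V) (h y)

lemma unitaryTransfer_apply (p : OneSided A → ℝ) (U : OneSided A → unitary (V →L[ℂ] V))
    (h : OneSided A → V) (x : OneSided A) :
    unitaryTransfer p U h x = ∑ i ∈ OneSided.letters x,
      (p (OneSided.cons i x) : ℂ) • (U (OneSided.cons i x) : V →L[ℂ] V) (h (OneSided.cons i x)) :=
  OneSided.finsum_preimages _ x

lemma unitaryTransfer_smul (p : OneSided A → ℝ) (U : OneSided A → unitary (V →L[ℂ] V)) (c : ℂ)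
    (h : OneSided A → V) : unitaryTransfer p U (c • h) = c • unitaryTransfer p U h := by
  funext x
  simp only [unitaryTransfer_apply, Pi.smul_apply, Finset.smul_sum, map_smul]
  exact Finset.sum_congr rfl fun i _ => smul_comm _ _ _

lemma unitaryTransfer_iterate_smul (p : OneSided A → ℝ) (U : OneSided A → unitary (V →L[ℂ] V))
    (c : ℂ) (n : ℕ) (h : OneSided A → V) :
    (unitaryTransfer p U)^[n] (c • h) = c • (unitaryTransfer p U)^[n] h := by
  induction n with
  | zero => rfl
  | succ n ih => rw [Function.iterate_succ_apply', Function.iterate_succ_apply', ih,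
      unitaryTransfer_smul]

/-- The weights `p` are positive and sum to one over the preimages of each point. -/
def IsNormalizedWeight (p : OneSided A → ℝ) : Prop :=
  (∀ y, 0 < p y) ∧ ∀ x, ∑ i ∈ OneSided.letters x, p (OneSided.cons i x) = 1

variable {p : OneSided A → ℝ} {U : OneSided A → unitary (V →L[ℂ] V)}

lemma norm_unitaryTransfer_le (hp : IsNormalizedWeight p) {h : OneSided A → V} {R : ℝ}
    (hR : ∀ x, ‖h x‖ ≤ R) (x : OneSided A) : ‖unitaryTransfer p U h x‖ ≤ R := by
  rw [unitaryTransfer_apply]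
  refine (norm_sum_le _ _).trans ?_
  calc _ ≤ ∑ i ∈ OneSided.letters x, p (OneSided.cons i x) * R := by
        refine Finset.sum_le_sum fun i _ => ?_
        rw [norm_smul, Unitary.norm_map, Complex.norm_real, Real.norm_eq_abs,
          abs_of_pos (hp.1 _)]
        exact mul_le_mul_of_nonneg_left (hR _) (hp.1 _).le
    _ = R := by rw [← Finset.sum_mul, hp.2, one_mul]

lemma norm_iterate_unitaryTransfer_le (hp : IsNormalizedWeight p) {h : OneSided A → V} {R : ℝ}
    (hR : ∀ x, ‖h x‖ ≤ R) (n : ℕ) (x : OneSided A) : ‖(unitaryTransfer p U)^[n] h x‖ ≤ R := by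
  induction n generalizing x with
  | zero => exact hR x
  | succ n ih =>
    rw [Function.iterate_succ_apply']
    exact norm_unitaryTransfer_le hp ih x

/-- One step of the Lasota–Yorke inequality. -/
lemma norm_unitaryTransfer_sub_le {lam : ℝ} (h0 : 0 ≤ lam) (h1 : lam ≤ 1)
    (hp : IsNormalizedWeight p) {Kp K R L : ℝ} (hKp : 0 ≤ Kp) (hK : 0 ≤ K) (hR0 : 0 ≤ R)
    (hpL : ∀ x y, |p x - p y| ≤ Kp * OneSided.dist lam x y)
    (hU : ∀ x y, ‖(U x : V →L[ℂ] V) - U y‖ ≤ K * OneSided.dist lam x y)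
    {h : OneSided A → V} (hR : ∀ x, ‖h x‖ ≤ R) (hL0 : 0 ≤ L)
    (hL : ∀ x y, ‖h x - h y‖ ≤ L * OneSided.dist lam x y) (x y : OneSided A) :
    ‖unitaryTransfer p U h x - unitaryTransfer p U h y‖ ≤
      ((N * Kp + K + 2) * R + lam * L) * OneSided.dist lam x y := by
  have hd0 := OneSided.dist_nonneg h0 x y
  by_cases hxy : x.1 0 = y.1 0
  · set d := OneSided.dist lam x y with hd
    rw [unitaryTransfer_apply, unitaryTransfer_apply, ← OneSided.letters_congr hxy,
      ← Finset.sum_sub_distrib]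
    have hterm : ∀ i ∈ OneSided.letters x,
        ‖(p (OneSided.cons i x) : ℂ) • (U (OneSided.cons i x) : V →L[ℂ] V) (h (OneSided.cons i x))
          - (p (OneSided.cons i y) : ℂ) •
            (U (OneSided.cons i y) : V →L[ℂ] V) (h (OneSided.cons i y))‖ ≤
          Kp * R * d + p (OneSided.cons i x) * ((K * R + lam * L) * d) := by
      intro i hi
      set x' := OneSided.cons i x
      set y' := OneSided.cons i y
      have hd' : OneSided.dist lam x' y' ≤ lam * d := OneSided.dist_cons_le h0 h1 hxy hi
      have hd'' : OneSided.dist lam x' y' ≤ d := hd'.trans (mul_le_of_le_one_left hd0 h1)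
      -- The difference of weights is isolated, so that the remaining terms carry the weights `p
      -- x'`, which sum to one.
      have hsplit : (p x' : ℂ) • (U x' : V →L[ℂ] V) (h x') - (p y' : ℂ) • (U y' : V →L[ℂ] V) (h y')
          = ((p x' - p y' : ℝ) : ℂ) • (U y' : V →L[ℂ] V) (h y') +
            (p x' : ℂ) • (((U x' : V →L[ℂ] V) - U y') (h y') +
              (U x' : V →L[ℂ] V) (h x' - h y')) := by
        rw [sub_apply, map_sub, Complex.ofReal_sub]
        module
      rw [hsplit]
      refine (norm_add_le _ _).trans (add_le_add ?_ ?_)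
      · rw [norm_smul, Unitary.norm_map, Complex.norm_real, Real.norm_eq_abs]
        calc |p x' - p y'| * ‖h y'‖ ≤ (Kp * d) * R :=
              mul_le_mul ((hpL _ _).trans (mul_le_mul_of_nonneg_left hd'' hKp)) (hR _)
                (norm_nonneg _) (by positivity)
          _ = _ := by ring
      · rw [norm_smul, Complex.norm_real, Real.norm_eq_abs, abs_of_pos (hp.1 _)]
        refine mul_le_mul_of_nonneg_left ((norm_add_le _ _).trans ?_) (hp.1 _).le
        rw [Unitary.norm_map, add_mul]
        refine add_le_add ?_ ?_
        · calc _ ≤ ‖(U x' : V →L[ℂ] V) - U y'‖ * ‖h y'‖ := ContinuousLinearMap.le_opNorm _ _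
            _ ≤ (K * d) * R := mul_le_mul ((hU _ _).trans (mul_le_mul_of_nonneg_left hd'' hK))
                (hR _) (norm_nonneg _) (by positivity)
            _ = _ := by ring
        · calc _ ≤ L * OneSided.dist lam x' y' := hL _ _
            _ ≤ L * (lam * d) := mul_le_mul_of_nonneg_left hd' hL0
            _ = _ := by ring
    refine (norm_sum_le _ _).trans ((Finset.sum_le_sum hterm).trans ?_)
    rw [Finset.sum_add_distrib, ← Finset.sum_mul (f := fun i => p (OneSided.cons i x)), hp.2,
      Finset.sum_const, nsmul_eq_mul]
    -- Differences of weights are not averaged; they are summed crudely over at most `N` letters.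
    have hcard : ((OneSided.letters x).card : ℝ) ≤ N := by
      exact_mod_cast (Finset.card_le_univ _).trans (by simp)
    have : ((OneSided.letters x).card : ℝ) * (Kp * R * d) ≤ N * (Kp * R * d) :=
      mul_le_mul_of_nonneg_right hcard (by positivity)
    nlinarith [mul_nonneg hR0 hd0]
  · rw [OneSided.dist_eq_one lam hxy, mul_one]
    -- Here the points are at distance one and the preimages do not pair up; the two supremum bounds
    -- account for the summand `2`.
    refine (norm_sub_le _ _).trans ?_
    have e1 := norm_unitaryTransfer_le (U := U) hp hR x
    have e2 := norm_unitaryTransfer_le (U := U) hp hR y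
    have e3 : 0 ≤ N * Kp * R := by positivity
    have e4 : 0 ≤ K * R := by positivity
    have e5 : 0 ≤ lam * L := by positivity
    nlinarith

/-- The Lasota–Yorke inequality. -/
lemma norm_iterate_unitaryTransfer_sub_le {lam : ℝ} (h0 : 0 ≤ lam) (h1 : lam < 1)
    (hp : IsNormalizedWeight p) {Kp K R L : ℝ} (hKp : 0 ≤ Kp) (hK : 0 ≤ K) (hR0 : 0 ≤ R)
    (hpL : ∀ x y, |p x - p y| ≤ Kp * OneSided.dist lam x y)
    (hU : ∀ x y, ‖(U x : V →L[ℂ] V) - U y‖ ≤ K * OneSided.dist lam x y)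
    {h : OneSided A → V} (hR : ∀ x, ‖h x‖ ≤ R) (hL0 : 0 ≤ L)
    (hL : ∀ x y, ‖h x - h y‖ ≤ L * OneSided.dist lam x y) (n : ℕ) (x y : OneSided A) :
    ‖(unitaryTransfer p U)^[n] h x - (unitaryTransfer p U)^[n] h y‖ ≤
      ((N * Kp + K + 2) * R / (1 - lam) + lam ^ n * L) * OneSided.dist lam x y := by
  have h1' : 0 < 1 - lam := by linarith
  induction n generalizing x y with
  | zero =>
    refine (hL x y).trans (mul_le_mul_of_nonneg_right ?_ (OneSided.dist_nonneg h0 _ _))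
    rw [pow_zero, one_mul]
    have : 0 ≤ (N * Kp + K + 2) * R / (1 - lam) := by positivity
    linarith
  | succ n ih =>
    rw [Function.iterate_succ_apply']
    have hnn : 0 ≤ (N * Kp + K + 2) * R / (1 - lam) + lam ^ n * L := by positivity
    refine (norm_unitaryTransfer_sub_le h0 h1.le hp hKp hK hR0 hpL hU
      -- The first term of the bound is the fixed point of `t ↦ (N * Kp + K + 2) * R + lam * t`, and
      -- only the second is multiplied by `lam`.
      (norm_iterate_unitaryTransfer_le hp hR n) hnn ih x y).trans (le_of_eq ?_)
    congr 1
    field_simp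
    ring

/-- If a convex combination of unit-ball vectors nearly reaches norm one, each of them is nearly
equal to it. -/
lemma le_re_inner_of_le_re_inner_unitaryTransfer (hp : IsNormalizedWeight p) {c : ℝ}
    (hc : ∀ y, 1 ≤ c * p y) {h : OneSided A → V} (hh : ∀ x, ‖h x‖ ≤ 1) {e : V} (he : ‖e‖ = 1)
    {ε : ℝ} (y : OneSided A)
    (hε : 1 - ε ≤ (inner ℂ e (unitaryTransfer p U h y.shift)).re) :
    1 - c * ε ≤ (inner ℂ e ((U y : V →L[ℂ] V) (h y))).re := by
  rw [unitaryTransfer_apply, inner_sum, Complex.re_sum] at hε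
  simp only [inner_smul_right, Complex.re_ofReal_mul] at hε
  set a : OneSided A → ℝ := fun z => (inner ℂ e ((U z : V →L[ℂ] V) (h z))).re with ha
  have ha1 : ∀ z, a z ≤ 1 := fun z => by
    refine (Complex.re_le_norm _).trans ((norm_inner_le_norm _ _).trans ?_)
    rw [he, one_mul, Unitary.norm_map]
    exact hh z
  -- The deficits `1 - a` are nonnegative with weighted sum at most `ε`, so the deficit at `y` is at
  -- most `ε / p y ≤ c * ε`.
  have hsum : ∑ i ∈ OneSided.letters y.shift, p (OneSided.cons i y.shift) *
      (1 - a (OneSided.cons i y.shift)) ≤ ε := by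
    simp only [mul_sub, mul_one, Finset.sum_sub_distrib, hp.2]
    linarith
  have hy := (Finset.single_le_sum (fun i _ => mul_nonneg (hp.1 (OneSided.cons i y.shift)).le
    (sub_nonneg.2 (ha1 _))) (OneSided.letters_nonempty_of_shift y)).trans hsum
  rw [OneSided.cons_shift] at hy
  change 1 - c * ε ≤ a y
  have hc0 : 0 < c := by
    by_contra hneg
    have := hc y
    nlinarith [hp.1 y]
  nlinarith [hc y, ha1 y, mul_le_mul_of_nonneg_left hy hc0.le]

/-- Each step moves one unitary factor to the other side of the inner product, which replaces `e` by
another unit vector and costs a factor `c`. -/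
lemma le_re_inner_cocycle (hp : IsNormalizedWeight p) {c : ℝ} (hc : ∀ y, 1 ≤ c * p y)
    {h : OneSided A → V} (hh : ∀ x, ‖h x‖ ≤ 1) (n : ℕ) {e : V} (he : ‖e‖ = 1) {ε : ℝ}
    (y : OneSided A)
    (hε : 1 - ε ≤ (inner ℂ e ((unitaryTransfer p U)^[n] h (OneSided.shift^[n] y))).re) :
    1 - c ^ n * ε ≤ (inner ℂ e ((cocycle U n y).1 (h y))).re := by
  induction n generalizing e ε with
  | zero => simpa [cocycle] using hε
  | succ n ih =>
    rw [Function.iterate_succ_apply', Function.iterate_succ_apply'] at hε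
    have step := le_re_inner_of_le_re_inner_unitaryTransfer hp hc
      (norm_iterate_unitaryTransfer_le hp hh n) he _ hε
    rw [← inner_unitary_inv_left] at step
    have := ih (by rw [Unitary.norm_map, he]) step
    rw [inner_unitary_inv_left, ← unitary_mul_apply] at this
    rw [cocycle, pow_succ, mul_assoc]
    exact this

/-- In the unit ball, `‖u - e‖² ≤ 2 - 2 Re ⟨e, u⟩`: a real part close to one forces closeness in
norm, with a square-root loss. -/
lemma norm_cocycle_apply_sub_le (hp : IsNormalizedWeight p) {c : ℝ} (hc : ∀ y, 1 ≤ c * p y)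
    {h : OneSided A → V} (hh : ∀ x, ‖h x‖ ≤ 1) (n : ℕ) {e : V} (he : ‖e‖ = 1) {ε : ℝ}
    (y : OneSided A)
    (hε : 1 - ε ≤ (inner ℂ e ((unitaryTransfer p U)^[n] h (OneSided.shift^[n] y))).re) :
    ‖(cocycle U n y).1 (h y) - e‖ ≤ Real.sqrt (2 * (c ^ n * ε)) := by
  have key := le_re_inner_cocycle hp hc hh n he y hε
  apply Real.le_sqrt_of_sq_le
  rw [← norm_neg, neg_sub, @norm_sub_sq ℂ, he, Unitary.norm_map]
  have := hh y
  have h2 : ‖h y‖ ^ 2 ≤ 1 := pow_le_one₀ (norm_nonneg _) this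
  simp only [RCLike.re_to_complex]
  linarith

end UnitaryTransfer

/-! ### Approximate eigenvectors along closed chains -/

section Chains

variable {N : ℕ} {A : Matrix (Fin N) (Fin N) ℕ}

lemma exists_oneSided_of_pow_pos (hA01 : IsZeroOne A) (M : ℕ) (i : Fin N) (x : OneSided A)
    (h : 0 < (A ^ M) i (x.1 0)) : ∃ y : OneSided A, y.1 0 = i ∧ OneSided.shift^[M] y = x := by
  induction M generalizing i with
  | zero =>
    refine ⟨x, ?_, rfl⟩
    by_contra hne
    simp [Matrix.one_apply_ne' hne] at h
  | succ M ih =>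
    rw [pow_succ', Matrix.mul_apply] at h
    obtain ⟨k, -, hk⟩ := Finset.exists_ne_zero_of_sum_ne_zero h.ne'
    obtain ⟨y, hy, hyx⟩ := ih k (Nat.pos_of_ne_zero (right_ne_zero_of_mul hk))
    have h1 : A i (y.1 0) = 1 := by
      rw [hy]
      exact (hA01 i k).resolve_left (left_ne_zero_of_mul hk)
    refine ⟨OneSided.cons i y, OneSided.cons_zero h1, ?_⟩
    rw [Function.iterate_succ_apply, OneSided.shift_cons h1, hyx]

/-- The companion `y z` reads `z` on the window `[-q, q]`, moved to start at `0`, and then continues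
along `T`. As `T (z q)` itself starts with the letter `z q`, the agreement includes the index `2 *
q`. In the application all the points `T i` arrive at the same `x`, whatever the window. -/
lemma exists_glue (q : ℕ) (T : Fin N → OneSided A) (hT : ∀ i, (T i).1 0 = i) :
    ∃ y : TwoSided A → OneSided A,
      (∀ z, ∀ j : ℕ, j ≤ 2 * q → (y z).1 j = z.1 ((j : ℤ) - q)) ∧
      ∀ z, OneSided.shift^[2 * q] (y z) = T (z.1 q) := by
  refine ⟨fun z => ⟨fun j => if j < 2 * q then z.1 ((j : ℤ) - q) else
    (T (z.1 q)).1 (j - 2 * q), fun j => ?_⟩, fun z j hj => ?_, fun z => ?_⟩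
  · change A (if j < 2 * q then z.1 ((j : ℤ) - q) else (T (z.1 q)).1 (j - 2 * q))
      (if j + 1 < 2 * q then z.1 (((j + 1 : ℕ) : ℤ) - q) else (T (z.1 q)).1 (j + 1 - 2 * q)) = 1
    rcases lt_trichotomy (j + 1) (2 * q) with hlt | heq | hgt
    · rw [if_pos hlt, if_pos (by omega)]
      have := z.2 ((j : ℤ) - q)
      rwa [show (j : ℤ) - q + 1 = ((j + 1 : ℕ) : ℤ) - q by push_cast; ring] at this
    · rw [if_pos (show j < 2 * q by omega), if_neg (show ¬ j + 1 < 2 * q by omega), heq,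
        Nat.sub_self, hT]
      have := z.2 ((j : ℤ) - q)
      rwa [show (j : ℤ) - q + 1 = q by omega] at this
    · rw [if_neg (show ¬ j < 2 * q by omega), if_neg (show ¬ j + 1 < 2 * q by omega), show j + 1 - 2 * q = j - 2 * q + 1 by omega]
      exact (T (z.1 q)).2 _
  · rcases hj.lt_or_eq with hlt | heq
    · exact if_pos hlt
    · change (if j < 2 * q then z.1 ((j : ℤ) - q) else (T (z.1 q)).1 (j - 2 * q)) = _
      rw [if_neg (by omega), heq, Nat.sub_self, hT]
      exact congrArg z.1 (by push_cast; ring)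
  · apply Subtype.ext
    funext j
    refine (OneSided.iterate_shift_apply _ (2 * q) j).trans ?_
    change (if j + 2 * q < 2 * q then z.1 (((j + 2 * q : ℕ) : ℤ) - q) else
      (T (z.1 q)).1 (j + 2 * q - 2 * q)) = _
    rw [if_neg (by omega), Nat.add_sub_cancel]

variable {V : Type*} [NormedAddCommGroup V] [InnerProductSpace ℂ V] [CompleteSpace V]
variable {U : OneSided A → unitary (V →L[ℂ] V)}

/-- The factor number `i` differs by at most `K * lam ^ (n + k - i)`; the geometric series is
dominated by its last terms, so the bound does not depend on `n`. -/
lemma norm_cocycle_sub_le {lam : ℝ} (h0 : 0 ≤ lam) (h1 : lam < 1) {K : ℝ} (hK : 0 ≤ K)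
    (hU : ∀ x y, ‖(U x : V →L[ℂ] V) - U y‖ ≤ K * OneSided.dist lam x y) (k n : ℕ)
    {x y : OneSided A} (hxy : ∀ i < n + k, x.1 i = y.1 i) :
    ‖(cocycle U n x).1 - (cocycle U n y).1‖ ≤ K * lam ^ k / (1 - lam) := by
  have h1' : 0 < 1 - lam := by linarith
  have main : ‖(cocycle U n x).1 - (cocycle U n y).1‖ ≤
      K * lam ^ k * ((1 - lam ^ n) / (1 - lam)) := by
    induction n generalizing x y with
    | zero => simp [cocycle]
    | succ n ih =>
      rw [cocycle_succ_shift, cocycle_succ_shift]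
      refine (norm_unitary_mul_sub_mul_le _ _ _ _).trans ?_
      have e1 := ih (x := x.shift) (y := y.shift) (fun i hi => hxy (i + 1) (by omega))
      have e2 : ‖(U x : V →L[ℂ] V) - U y‖ ≤ K * lam ^ k * lam ^ n := by
        refine (hU x y).trans ?_
        rw [mul_assoc, ← pow_add]
        refine mul_le_mul_of_nonneg_left ?_ hK
        exact OneSided.dist_le_pow h0 h1.le fun i hi => hxy i (by omega)
      refine (add_le_add e1 e2).trans (le_of_eq ?_)
      field_simp
      ring
  refine main.trans ?_
  rw [mul_div_assoc']
  refine div_le_div_of_nonneg_right ?_ h1'.le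
  exact mul_le_of_le_one_right (by positivity) (by linarith [pow_nonneg h0 n])

lemma TwoSided.future_apply (z : TwoSided A) (i : ℕ) : z.future.1 i = z.1 (i : ℤ) := rfl

lemma TwoSided.future_shiftBack_apply (z : TwoSided A) (n i : ℕ) :
    (z.shiftBack n).future.1 i = z.1 ((i : ℤ) - n) := rfl

lemma TwoSided.shift_future_shiftBack_succ (z : TwoSided A) (n : ℕ) :
    (z.shiftBack (n + 1)).future.shift = (z.shiftBack n).future := by
  apply Subtype.ext
  funext i
  rw [OneSided.shift_apply, TwoSided.future_shiftBack_apply, TwoSided.future_shiftBack_apply]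
  exact congrArg z.1 (by push_cast; ring)

/-- The twist of a stable leg is already attained after `n₀` steps. -/
lemma stable_twist_eq {n₀ : ℕ} {z z' : TwoSided A}
    (hz : ∀ i : ℤ, (n₀ : ℤ) ≤ i → z'.1 i = z.1 i) {g : unitary (V →L[ℂ] V)}
    (hg : Tendsto (fun n => (cocycle U n z'.future)⁻¹ * cocycle U n z.future) atTop (𝓝 g)) :
    g = (cocycle U n₀ z'.future)⁻¹ * cocycle U n₀ z.future := by
  refine tendsto_nhds_unique hg (tendsto_const_nhds.congr' ?_)
  filter_upwards [eventually_ge_atTop n₀] with n hn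
  obtain ⟨m, rfl⟩ := Nat.exists_eq_add_of_le' hn
  have hs : OneSided.shift^[n₀] z'.future = OneSided.shift^[n₀] z.future := by
    apply Subtype.ext
    funext i
    rw [OneSided.iterate_shift_apply, OneSided.iterate_shift_apply, TwoSided.future_apply,
      TwoSided.future_apply]
    exact hz _ (by push_cast; omega)
  rw [cocycle_add, cocycle_add, hs]
  group

/-- The twist of an unstable leg is approximated at exponential speed. -/
lemma norm_unstable_twist_sub_le {lam : ℝ} (h0 : 0 ≤ lam) (h1 : lam < 1) {K : ℝ} (hK : 0 ≤ K)
    (hU : ∀ x y, ‖(U x : V →L[ℂ] V) - U y‖ ≤ K * OneSided.dist lam x y) {n₀ q : ℕ} (hq : n₀ ≤ q)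
    {z z' : TwoSided A} (hz : ∀ i : ℤ, i ≤ -(n₀ : ℤ) → z'.1 i = z.1 i)
    {g : unitary (V →L[ℂ] V)}
    (hg : Tendsto (fun n => cocycle U n (z'.shiftBack n).future *
      (cocycle U n (z.shiftBack n).future)⁻¹) atTop (𝓝 g)) :
    ‖((cocycle U q (z'.shiftBack q).future * (cocycle U q (z.shiftBack q).future)⁻¹ :
      unitary (V →L[ℂ] V)) : V →L[ℂ] V) - g‖ ≤ K * lam ^ (q - n₀) / (1 - lam) := by
  set Q : ℕ → unitary (V →L[ℂ] V) := fun n => cocycle U n (z'.shiftBack n).future *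
      (cocycle U n (z.shiftBack n).future)⁻¹ with hQ
  -- Going one step further into the past inserts a single factor `U a' * (U a)⁻¹` in the middle of
  -- the product, and `a`, `a'` agree on a long initial word.
  have hstep : ∀ n, dist (Q (n + q)) (Q (n + 1 + q)) ≤ K * lam ^ (q - n₀) * lam ^ n := by
    intro n
    rw [Subtype.dist_eq, dist_eq_norm, show n + 1 + q = (n + q) + 1 by ring]
    set k := n + q with hk
    set a := (z.shiftBack (k + 1)).future
    set a' := (z'.shiftBack (k + 1)).future
    have e1 : Q k = cocycle U k (z'.shiftBack k).future * (U a * (U a)⁻¹) *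
        (cocycle U k (z.shiftBack k).future)⁻¹ := by simp [hQ]
    have e2 : Q (k + 1) = cocycle U k (z'.shiftBack k).future * (U a' * (U a)⁻¹) *
        (cocycle U k (z.shiftBack k).future)⁻¹ := by
      simp only [hQ]
      rw [cocycle_succ_shift, cocycle_succ_shift, TwoSided.shift_future_shiftBack_succ,
        TwoSided.shift_future_shiftBack_succ, mul_inv_rev]
      simp only [mul_assoc, a, a']
    rw [e1, e2]
    refine (norm_unitary_mul_sub_mul_le _ _ _ _).trans ?_
    rw [sub_self, norm_zero, add_zero]
    refine (norm_unitary_mul_sub_mul_le _ _ _ _).trans ?_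
    rw [sub_self, norm_zero, zero_add]
    refine (norm_unitary_mul_sub_mul_le _ _ _ _).trans ?_
    rw [sub_self, norm_zero, add_zero]
    refine (hU _ _).trans ?_
    rw [mul_assoc, ← pow_add]
    refine mul_le_mul_of_nonneg_left (OneSided.dist_le_pow h0 h1.le fun i hi => ?_) hK
    rw [TwoSided.future_shiftBack_apply, TwoSided.future_shiftBack_apply]
    exact (hz _ (by push_cast; omega)).symm
  have hlim : Tendsto (fun n => Q (n + q)) atTop (𝓝 g) := (tendsto_add_atTop_iff_nat q).2 hg
  have := dist_le_of_le_geometric_of_tendsto₀ lam _ h1 hstep hlim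
  rwa [Subtype.dist_eq, dist_eq_norm, zero_add] at this

variable {lam : ℝ} {K L η : ℝ} {n₀ q M : ℕ} {x : OneSided A} {h : OneSided A → V} {e : V}
  {y : TwoSided A → OneSided A} {T : Fin N → OneSided A}

/-- After `n₀` steps from time zero the two companions coincide, so the two transported vectors
differ by a ratio of products of length `n₀`. The twist is the same ratio taken along `z` and `z'`,
which the companions follow up to time `q`; neither `h` nor near-maximality enters. -/
lemma norm_stable_leg_le (h0 : 0 ≤ lam) (h1 : lam < 1) (hK : 0 ≤ K)
    (hU : ∀ x y, ‖(U x : V →L[ℂ] V) - U y‖ ≤ K * OneSided.dist lam x y) (hq : n₀ ≤ q)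
    (he : ‖e‖ = 1)
    (hy : ∀ z, ∀ j : ℕ, j ≤ 2 * q → (y z).1 j = z.1 ((j : ℤ) - q))
    (hyT : ∀ z, OneSided.shift^[2 * q] (y z) = T (z.1 q))
    {z z' : TwoSided A} (hz : ∀ i : ℤ, (n₀ : ℤ) ≤ i → z'.1 i = z.1 i) {g : unitary (V →L[ℂ] V)}
    (hg : Tendsto (fun n => (cocycle U n z'.future)⁻¹ * cocycle U n z.future) atTop (𝓝 g)) :
    ‖(cocycle U (q + M) (OneSided.shift^[q] (y z')))⁻¹.1 e -
      g.1 ((cocycle U (q + M) (OneSided.shift^[q] (y z)))⁻¹.1 e)‖ ≤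
      2 * (K * lam ^ (q - n₀) / (1 - lam)) := by
  set Y := OneSided.shift^[q] (y z) with hY
  set Y' := OneSided.shift^[q] (y z') with hY'
  have hYz : ∀ w : TwoSided A, ∀ i < n₀ + (q - n₀),
      (OneSided.shift^[q] (y w)).1 i = w.future.1 i := by
    intro w i hi
    rw [OneSided.iterate_shift_apply, hy w _ (by omega), TwoSided.future_apply]
    exact congrArg w.1 (by push_cast; ring)
  have hW : OneSided.shift^[n₀] Y' = OneSided.shift^[n₀] Y := by
    apply Subtype.ext
    funext j
    change (OneSided.shift^[n₀] (OneSided.shift^[q] (y z'))).1 j =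
      (OneSided.shift^[n₀] (OneSided.shift^[q] (y z))).1 j
    rw [OneSided.iterate_shift_apply, OneSided.iterate_shift_apply,
      OneSided.iterate_shift_apply, OneSided.iterate_shift_apply]
    -- Inside the window the coordinates agree by the leg condition; beyond it both sequences
    -- continue along the same `T`, because `z q = z' q` once `n₀ ≤ q`.
    by_cases hj : j + n₀ + q ≤ 2 * q
    · rw [hy _ _ hj, hy _ _ hj]
      exact hz _ (by push_cast; omega)
    · obtain ⟨l, hl⟩ := Nat.exists_eq_add_of_le' (not_le.1 hj).le
      rw [hl, ← OneSided.iterate_shift_apply, ← OneSided.iterate_shift_apply, hyT, hyT,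
        hz q (by exact_mod_cast hq)]
  have hsplit : q + M = (q + M - n₀) + n₀ := by omega
  rw [stable_twist_eq hz hg, hsplit, cocycle_add, cocycle_add, hW, mul_inv_rev, mul_inv_rev,
    unitary_mul_apply (cocycle U n₀ Y')⁻¹, unitary_mul_apply (cocycle U n₀ Y)⁻¹]
  set a := (cocycle U (q + M - n₀) (OneSided.shift^[n₀] Y))⁻¹.1 e with ha
  have hna : ‖a‖ = 1 := by rw [ha, Unitary.norm_map, he]
  rw [← unitary_mul_apply _ (cocycle U n₀ Y)⁻¹, ← sub_apply]
  refine (ContinuousLinearMap.le_opNorm _ _).trans ?_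
  rw [hna, mul_one]
  have e1 : (cocycle U n₀ Y')⁻¹ =
      (cocycle U n₀ Y')⁻¹ * cocycle U n₀ Y * (cocycle U n₀ Y)⁻¹ := by group
  rw [e1]
  refine (norm_unitary_mul_sub_mul_le _ _ _ _).trans ?_
  rw [sub_self, norm_zero, add_zero]
  refine (norm_unitary_mul_sub_mul_le _ _ _ _).trans ?_
  rw [norm_unitary_inv_sub_inv, two_mul]
  exact add_le_add (norm_cocycle_sub_le h0 h1 hK hU _ _ (hYz z'))
    (norm_cocycle_sub_le h0 h1 hK hU _ _ (hYz z))

/-- This is where near-maximality is used: `hη` lets the vector transported back from `x` be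
replaced by the one transported forward from `h (y z)`. The companions of `z` and `z'` share their
first letters, so the values of `h` are close, and the ratio of the two forward products
approximates the twist. -/
lemma norm_unstable_leg_le (h0 : 0 ≤ lam) (h1 : lam < 1) (hK : 0 ≤ K)
    (hU : ∀ x y, ‖(U x : V →L[ℂ] V) - U y‖ ≤ K * OneSided.dist lam x y) (hq : n₀ ≤ q)
    (he : ‖e‖ = 1) (hL0 : 0 ≤ L) (hL : ∀ x y, ‖h x - h y‖ ≤ L * OneSided.dist lam x y)
    (hη : ∀ z, ‖(cocycle U (q + M + q) (y z)).1 (h (y z)) - e‖ ≤ η)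
    (hy : ∀ z, ∀ j : ℕ, j ≤ 2 * q → (y z).1 j = z.1 ((j : ℤ) - q))
    {z z' : TwoSided A} (hz : ∀ i : ℤ, i ≤ -(n₀ : ℤ) → z'.1 i = z.1 i)
    {g : unitary (V →L[ℂ] V)}
    (hg : Tendsto (fun n => cocycle U n (z'.shiftBack n).future *
      (cocycle U n (z.shiftBack n).future)⁻¹) atTop (𝓝 g)) :
    ‖(cocycle U (q + M) (OneSided.shift^[q] (y z')))⁻¹.1 e -
      g.1 ((cocycle U (q + M) (OneSided.shift^[q] (y z)))⁻¹.1 e)‖ ≤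
      2 * η + (L + 3 * (K / (1 - lam))) * lam ^ (q - n₀) := by
  have h1' : 0 < 1 - lam := by linarith
  set f : TwoSided A → V := fun z =>
    (cocycle U (q + M) (OneSided.shift^[q] (y z)))⁻¹.1 e with hf
  change ‖f z' - g.1 (f z)‖ ≤ _
  have hfe : ∀ w, ‖f w - (cocycle U q (y w)).1 (h (y w))‖ ≤ η := by
    intro w
    have e1 : (cocycle U (q + M) (OneSided.shift^[q] (y w)))⁻¹ =
        cocycle U q (y w) * (cocycle U (q + M + q) (y w))⁻¹ := by
      rw [cocycle_add U (q + M) q]; group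
    simp only [hf]
    rw [e1, unitary_mul_apply, ← map_sub, Unitary.norm_map,
      ← Unitary.norm_map (cocycle U (q + M + q) (y w)), map_sub, unitary_apply_inv_apply,
      norm_sub_rev]
    exact hη w
  have hfn : ‖f z‖ = 1 := by simp only [hf]; rw [Unitary.norm_map, he]
  set u := cocycle U q (y z) with hu
  set u' := cocycle U q (y z') with hu'
  have hsplit : f z' - g.1 (f z) = (f z' - u'.1 (h (y z'))) + u'.1 (h (y z') - h (y z)) -
      (u' * u⁻¹).1 (f z - u.1 (h (y z))) + ((u' * u⁻¹).1 - g.1) (f z) := by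
    rw [map_sub, map_sub, sub_apply, unitary_mul_apply u' u⁻¹ (u.1 _), unitary_inv_apply_apply]
    abel
  have b1 := hfe z'
  have b2 : ‖u'.1 (h (y z') - h (y z))‖ ≤ L * lam ^ (q - n₀) := by
    rw [Unitary.norm_map]
    refine (hL _ _).trans (mul_le_mul_of_nonneg_left ?_ hL0)
    refine OneSided.dist_le_pow h0 h1.le fun i hi => ?_
    rw [hy _ _ (by omega), hy _ _ (by omega)]
    exact hz _ (by omega)
  have b3 : ‖(u' * u⁻¹).1 (f z - u.1 (h (y z)))‖ ≤ η := by
    rw [Unitary.norm_map]; exact hfe z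
  have hyz : ∀ w : TwoSided A, ∀ i < q + (q - n₀), (y w).1 i = (w.shiftBack q).future.1 i := by
    intro w i hi
    rw [hy w i (by omega), TwoSided.future_shiftBack_apply]
  have b4 : ‖((u' * u⁻¹).1 - g.1) (f z)‖ ≤ 3 * (K * lam ^ (q - n₀) / (1 - lam)) := by
    refine (ContinuousLinearMap.le_opNorm _ _).trans ?_
    rw [hfn, mul_one]
    refine (norm_sub_le_norm_sub_add_norm_sub _
      (cocycle U q (z'.shiftBack q).future * (cocycle U q (z.shiftBack q).future)⁻¹ :
        unitary (V →L[ℂ] V)).1 _).trans ?_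
    have c1 := norm_unstable_twist_sub_le h0 h1 hK hU hq hz hg
    have c2 := norm_unitary_mul_sub_mul_le u' u⁻¹ (cocycle U q (z'.shiftBack q).future)
      (cocycle U q (z.shiftBack q).future)⁻¹
    rw [norm_unitary_inv_sub_inv] at c2
    have c3 := norm_cocycle_sub_le h0 h1 hK hU _ _ (hyz z')
    have c4 := norm_cocycle_sub_le h0 h1 hK hU _ _ (hyz z)
    linarith
  rw [hsplit]
  have t1 := norm_add_le ((f z' - u'.1 (h (y z'))) + u'.1 (h (y z') - h (y z)) -
      (u' * u⁻¹).1 (f z - u.1 (h (y z)))) (((u' * u⁻¹).1 - g.1) (f z))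
  have t2 := norm_sub_le ((f z' - u'.1 (h (y z'))) + u'.1 (h (y z') - h (y z)))
      ((u' * u⁻¹).1 (f z - u.1 (h (y z))))
  have t3 := norm_add_le (f z' - u'.1 (h (y z'))) (u'.1 (h (y z') - h (y z)))
  have : 3 * (K * lam ^ (q - n₀) / (1 - lam)) = 3 * (K / (1 - lam)) * lam ^ (q - n₀) := by ring
  linarith

/-- If `𝓛^n h` nearly attains the supremum norm of `h`, some unit vector is nearly fixed by all
twists of closed chains. -/
theorem exists_unit_almost_fixed {p : OneSided A → ℝ} (hA01 : IsZeroOne A)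
    (hM : ∀ i j, 0 < (A ^ M) i j) (h0 : 0 ≤ lam) (h1 : lam < 1) (hp : IsNormalizedWeight p)
    {c : ℝ} (hc : ∀ y, 1 ≤ c * p y) (hK : 0 ≤ K)
    (hU : ∀ x y, ‖(U x : V →L[ℂ] V) - U y‖ ≤ K * OneSided.dist lam x y)
    (hh : ∀ x, ‖h x‖ ≤ 1) (hL0 : 0 ≤ L) (hL : ∀ x y, ‖h x - h y‖ ≤ L * OneSided.dist lam x y)
    (hq : n₀ ≤ q) {ε : ℝ} (hε1 : ε < 1)
    (hx : 1 - ε ≤ ‖(unitaryTransfer p U)^[q + M + q] h x‖) (w : TwoSided A) (p₀ : ℕ) :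
    ∃ v : V, ‖v‖ = 1 ∧ ∀ a ∈ chainTwists (fun _ => (0 : ℝ)) U w n₀ p₀,
      ‖v - a.1 v‖ ≤ p₀ * (2 * Real.sqrt (2 * (c ^ (q + M + q) * ε)) +
        (L + 3 * (K / (1 - lam))) * lam ^ (q - n₀)) := by
  have h1' : 0 < 1 - lam := by linarith
  -- Aperiodicity enters here: `T i` starts with the letter `i` and reaches `x` in exactly `M`
  -- steps, so `2 * q + M` steps lead from each companion to `x`.
  choose T hT0 hTx using fun i => exists_oneSided_of_pow_pos hA01 M i x (hM i (x.1 0))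
  obtain ⟨y, hy, hyT⟩ := exists_glue q T hT0
  set F := (unitaryTransfer p U)^[q + M + q] h x with hF
  have hFpos : 0 < ‖F‖ := by linarith
  set e : V := ((‖F‖⁻¹ : ℝ) : ℂ) • F with he_def
  have he : ‖e‖ = 1 := by
    rw [he_def, norm_smul, Complex.norm_real, norm_inv, norm_norm, inv_mul_cancel₀ hFpos.ne']
  have hre : (inner ℂ e F).re = ‖F‖ := by
    rw [he_def, inner_smul_left, Complex.conj_ofReal, inner_self_eq_norm_sq_to_K,
      Complex.re_ofReal_mul]
    rw [RCLike.ofReal_eq_complex_ofReal, ← Complex.ofReal_pow, Complex.ofReal_re]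
    field_simp
  have hyx : ∀ z, OneSided.shift^[q + M + q] (y z) = x := fun z => by
    rw [show q + M + q = M + 2 * q by ring, Function.iterate_add_apply, hyT, hTx]
  have hη : ∀ z, ‖(cocycle U (q + M + q) (y z)).1 (h (y z)) - e‖ ≤
      Real.sqrt (2 * (c ^ (q + M + q) * ε)) := fun z => by
    refine norm_cocycle_apply_sub_le hp hc hh _ he _ ?_
    rw [hyx, hre]
    exact hx
  set err := 2 * Real.sqrt (2 * (c ^ (q + M + q) * ε)) +
        (L + 3 * (K / (1 - lam))) * lam ^ (q - n₀) with herr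
  have herr0 : 0 ≤ err := by positivity
  -- The point `shift^[q] (y z)` sits at coordinate `0` of `z`, so `f z` is `e` pulled back from `x`
  -- to that time.
  set f : TwoSided A → V := fun z =>
    (cocycle U (q + M) (OneSided.shift^[q] (y z)))⁻¹.1 e with hf
  have hleg : ∀ z z' t g, IsLeg (fun _ => (0 : ℝ)) U n₀ z z' t g → ‖f z' - g.1 (f z)‖ ≤ err := by
    rintro z z' t g (⟨hz, -, hg⟩ | ⟨hz, -, hg⟩)
    · refine (norm_stable_leg_le h0 h1 hK hU hq he hy hyT hz hg).trans ?_
      have a1 : 0 ≤ Real.sqrt (2 * (c ^ (q + M + q) * ε)) := Real.sqrt_nonneg _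
      have a2 : 0 ≤ L * lam ^ (q - n₀) := by positivity
      have a3 : 0 ≤ K * lam ^ (q - n₀) / (1 - lam) := by positivity
      have a4 : (L + 3 * (K / (1 - lam))) * lam ^ (q - n₀) =
        L * lam ^ (q - n₀) + 3 * (K * lam ^ (q - n₀) / (1 - lam)) := by ring
      linarith
    · exact norm_unstable_leg_le h0 h1 hK hU hq he hL0 hL hη hy hz hg
  refine ⟨f w, by simp only [hf]; rw [Unitary.norm_map, he], ?_⟩
  rintro a ⟨m, C, t, g, hm, hC0, hCm, hlegs, -, rfl⟩
  have hind : ∀ i ≤ m, ‖f (C i) - (((List.range i).reverse.map g).prod).1 (f w)‖ ≤ i * err := by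
    intro i
    induction i with
    | zero => intro _; simp [hC0]
    | succ i ih =>
      intro hi
      have e1 := ih (by omega)
      have e2 := hleg _ _ _ _ (hlegs i (by omega))
      rw [List.range_succ, List.reverse_append, List.reverse_singleton, List.singleton_append,
        List.map_cons, List.prod_cons, unitary_mul_apply]
      refine (norm_sub_le_norm_sub_add_norm_sub _ ((g i).1 (f (C i))) _).trans ?_
      rw [← map_sub, Unitary.norm_map]
      rw [Nat.cast_succ]
      linarith
  have := hind m le_rfl
  rw [hCm] at this
  refine this.trans (mul_le_mul_of_nonneg_right ?_ herr0)
  exact_mod_cast hm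

end Chains

/-! ### The choice of the number of iterates -/

/-- Three demands compete. The window must satisfy `lam ^ q ≪ β ^ (-1 - D)`, so `q` is a multiple of
`log β`. The number of iterates must exceed `2 * q + M`, so it too is a multiple of `log β`, and the
weights then cost only a power of `β`. The gain `β ^ (-C)` has to beat that power, so `C` is chosen
last. -/
lemma exists_iterate_constants {lam c P κ D : ℝ} (h0 : 0 < lam) (h1 : lam < 1) (hc : 1 ≤ c)
    (hP : 0 ≤ P) (hκ : 0 < κ) (hD : 0 < D) (n₀ M p₀ : ℕ) :
    ∃ C ≥ (2 : ℝ), ∃ C' > (0 : ℝ), ∀ β ≥ (2 : ℝ),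
      lam ^ ⌈C' * Real.log β⌉₊ ≤ 1 / 4 ∧ ∃ q ≥ n₀, q + M + q ≤ ⌈C' * Real.log β⌉₊ ∧
        p₀ * (2 * Real.sqrt (2 * (c ^ (q + M + q) * β ^ (-C))) + P * β * lam ^ (q - n₀)) <
          κ * β ^ (-D) := by
  set Λ := -Real.log lam with hΛ
  have hΛ0 : 0 < Λ := neg_pos.2 (Real.log_neg h0 h1)
  have hl2 : 0 < Real.log 2 := Real.log_pos one_lt_two
  have hlc : 0 ≤ Real.log c := Real.log_nonneg hc
  have hc0 : 0 < c := by linarith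
  -- An extra factor `β ^ (-s) ≤ 2 ^ (-s)` absorbs all multiplicative constants.
  obtain ⟨s, hs⟩ := exists_pow_lt_of_lt_one (show 0 < κ / (p₀ * (4 + P) + 1) by positivity)
    (show (1 / 2 : ℝ) < 1 by norm_num)
  rw [lt_div_iff₀ (by positivity)] at hs
  set E := (1 + D + s) / Λ with hE
  have hE0 : 0 < E := by positivity
  have hEΛ : E * Λ = 1 + D + s := by rw [hE]; field_simp
  -- The summands pay for the two half-windows, for `n₀`, `M` and the rounding (using `β ≥ 2`), and
  -- for `lam ^ n ≤ 1 / 4`.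
  set C' := 2 * E + (2 * n₀ + M + 2) / Real.log 2 + 2 / Λ with hC'
  have hC'0 : 0 < C' := by positivity
  -- The term `C' * log c` cancels the growth of `c ^ n`; `D` and `s` are doubled because of the
  -- square root.
  refine ⟨2 + C' * Real.log c + 2 * D + 2 * s, ?_, C', hC'0, fun β hβ => ?_⟩
  · have : 0 ≤ C' * Real.log c := by positivity
    have : (0 : ℝ) ≤ s := Nat.cast_nonneg s
    linarith
  have hβ0 : 0 < β := by linarith
  have hlβ : Real.log 2 ≤ Real.log β := Real.log_le_log two_pos hβ
  have hlβ0 : 0 < Real.log β := hl2.trans_le hlβ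
  have hpow : ∀ (k : ℕ), lam ^ k = Real.exp (-(Λ * k)) := fun k => by
    rw [hΛ, neg_mul, neg_neg, mul_comm, Real.exp_nat_mul, Real.exp_log h0]
  have hβpow : ∀ t : ℝ, β ^ t = Real.exp (Real.log β * t) := fun t => Real.rpow_def_of_pos hβ0 t
  have hn : C' * Real.log β ≤ (⌈C' * Real.log β⌉₊ : ℝ) := Nat.le_ceil _
  have hβs : β ^ (-(s : ℝ)) ≤ (1 / 2) ^ s := by
    rw [Real.rpow_neg hβ0.le, Real.rpow_natCast, one_div, inv_pow]
    exact inv_anti₀ (by positivity) (pow_le_pow_left₀ two_pos.le hβ s)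
  constructor
  · have h4 : (1 / 4 : ℝ) = Real.exp (-(2 * Real.log 2)) := by
      rw [Real.exp_neg, show 2 * Real.log 2 = Real.log 2 + Real.log 2 by ring, Real.exp_add,
        Real.exp_log two_pos]
      norm_num
    rw [hpow, h4, Real.exp_le_exp, neg_le_neg_iff]
    have e1 : 2 / Λ * Real.log 2 ≤ C' * Real.log β := by
      refine mul_le_mul ?_ hlβ hl2.le hC'0.le
      have : 0 ≤ 2 * E + (2 * n₀ + M + 2) / Real.log 2 := by positivity
      rw [hC']
      linarith
    calc 2 * Real.log 2 = Λ * (2 / Λ * Real.log 2) := by field_simp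
      _ ≤ Λ * _ := mul_le_mul_of_nonneg_left (e1.trans hn) hΛ0.le
  set k := ⌈E * Real.log β⌉₊ with hk
  have hk1 : E * Real.log β ≤ (k : ℝ) := Nat.le_ceil _
  have hk2 : (k : ℝ) < E * Real.log β + 1 := Nat.ceil_lt_add_one (by positivity)
  have hq : ((n₀ + k + M + (n₀ + k) : ℕ) : ℝ) ≤ C' * Real.log β := by
    have e1 : (2 * n₀ + M + 2 : ℝ) ≤ (2 * n₀ + M + 2) / Real.log 2 * Real.log β := by
      rw [div_mul_eq_mul_div, le_div_iff₀ hl2]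
      exact mul_le_mul_of_nonneg_left hlβ (by positivity)
    have e2 : 0 ≤ 2 / Λ * Real.log β := by positivity
    rw [hC', add_mul, add_mul]
    push_cast
    linarith
  refine ⟨n₀ + k, Nat.le_add_right _ _, ?_, ?_⟩
  · exact_mod_cast hq.trans hn
  have t1 : lam ^ (n₀ + k - n₀) ≤ β ^ (-(1 : ℝ)) * β ^ (-D) * β ^ (-(s : ℝ)) := by
    rw [Nat.add_sub_cancel_left, hpow, hβpow, hβpow, hβpow, ← Real.exp_add, ← Real.exp_add,
      Real.exp_le_exp]
    have := mul_le_mul_of_nonneg_left hk1 hΛ0.le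
    have e : Λ * (E * Real.log β) = (1 + D + s) * Real.log β := by rw [← hEΛ]; ring
    linarith
  have t2 : c ^ (n₀ + k + M + (n₀ + k)) ≤ β ^ (C' * Real.log c) := by
    rw [← Real.rpow_natCast, Real.rpow_def_of_pos hc0, hβpow, Real.exp_le_exp]
    calc Real.log c * _ ≤ Real.log c * (C' * Real.log β) := mul_le_mul_of_nonneg_left hq hlc
      _ = _ := by ring
  have t3 : Real.sqrt (2 * (c ^ (n₀ + k + M + (n₀ + k)) *
      β ^ (-(2 + C' * Real.log c + 2 * D + 2 * s)))) ≤ 2 * (β ^ (-D) * β ^ (-(s : ℝ))) := by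
    rw [Real.sqrt_le_left (by positivity)]
    have e1 : c ^ (n₀ + k + M + (n₀ + k)) * β ^ (-(2 + C' * Real.log c + 2 * D + 2 * s)) ≤
        β ^ (C' * Real.log c) * β ^ (-(2 + C' * Real.log c + 2 * D + 2 * s)) :=
      mul_le_mul_of_nonneg_right t2 (by positivity)
    have e2 : β ^ (C' * Real.log c) * β ^ (-(2 + C' * Real.log c + 2 * D + 2 * s)) ≤
        (β ^ (-D) * β ^ (-(s : ℝ))) ^ 2 := by
      rw [hβpow, hβpow, hβpow, hβpow, ← Real.exp_add, ← Real.exp_add, ← Real.exp_nat_mul,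
        Real.exp_le_exp]
      push_cast
      linarith
    have e3 : 0 ≤ (β ^ (-D) * β ^ (-(s : ℝ))) ^ 2 := by positivity
    linarith [mul_pow 2 (β ^ (-D) * β ^ (-(s : ℝ))) 2]
  have t4 : P * β * lam ^ (n₀ + k - n₀) ≤ P * (β ^ (-D) * β ^ (-(s : ℝ))) := by
    rw [mul_assoc]
    refine mul_le_mul_of_nonneg_left ?_ hP
    calc β * lam ^ (n₀ + k - n₀) ≤ β * (β ^ (-(1 : ℝ)) * β ^ (-D) * β ^ (-(s : ℝ))) :=
          mul_le_mul_of_nonneg_left t1 hβ0.le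
      _ = _ := by rw [Real.rpow_neg_one]; field_simp
  have hDpos : 0 < β ^ (-D) := by positivity
  calc _ ≤ (p₀ : ℝ) * (2 * (2 * (β ^ (-D) * β ^ (-(s : ℝ)))) +
        P * (β ^ (-D) * β ^ (-(s : ℝ)))) := by gcongr
    _ = p₀ * (4 + P) * β ^ (-(s : ℝ)) * β ^ (-D) := by ring
    _ ≤ p₀ * (4 + P) * (1 / 2) ^ s * β ^ (-D) := by gcongr
    _ < κ * β ^ (-D) := by
      refine mul_lt_mul_of_pos_right ?_ hDpos
      have : (0 : ℝ) < (1 / 2) ^ s := by positivity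
      linarith

/-! ### The unitary cocycle of a representation -/

section Twist

/-- Multiplication by `e^{it}`. -/
noncomputable def phase (V : Type*) [NormedAddCommGroup V] [InnerProductSpace ℂ V]
    [CompleteSpace V] (t : ℝ) : unitary (V →L[ℂ] V) :=
  ⟨Complex.exp (Complex.I * t) • (1 : V →L[ℂ] V), by
    have h : (starRingEnd ℂ) (Complex.exp (Complex.I * t)) * Complex.exp (Complex.I * t) = 1 := by
      rw [← Complex.exp_conj, ← Complex.exp_add]; simp
    rw [Unitary.mem_iff]
    simp only [star_smul, star_one, smul_mul_smul_comm, mul_one, RCLike.star_def]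
    rw [h, mul_comm, h, one_smul]
    exact ⟨rfl, rfl⟩⟩

variable {V : Type*} [NormedAddCommGroup V] [InnerProductSpace ℂ V] [CompleteSpace V]

lemma coe_phase (t : ℝ) : (phase V t : V →L[ℂ] V) = Complex.exp (Complex.I * t) • 1 := rfl

lemma phase_add (s t : ℝ) : phase V (s + t) = phase V s * phase V t := by
  apply Subtype.ext
  rw [Submonoid.coe_mul, coe_phase, coe_phase, coe_phase, smul_mul_smul_comm, ← Complex.exp_add,
    mul_one, Complex.ofReal_add, mul_add]

@[simp] lemma phase_zero : phase V 0 = 1 := by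
  apply Subtype.ext
  simp [coe_phase]

lemma phase_inv (t : ℝ) : (phase V t)⁻¹ = phase V (-t) := by
  rw [inv_eq_iff_mul_eq_one, ← phase_add, add_neg_cancel, phase_zero]

lemma phase_comm (t : ℝ) (u : unitary (V →L[ℂ] V)) : phase V t * u = u * phase V t := by
  apply Subtype.ext
  rw [Submonoid.coe_mul, Submonoid.coe_mul, coe_phase, smul_mul_assoc, one_mul, mul_smul_comm,
    mul_one]

lemma continuous_phase : Continuous (phase V) := by
  refine Continuous.subtype_mk (f := fun t : ℝ =>
    Complex.exp (Complex.I * t) • (1 : V →L[ℂ] V)) ?_ _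
  fun_prop

lemma norm_phase_sub_le (s t : ℝ) : ‖(phase V s : V →L[ℂ] V) - phase V t‖ ≤ |s - t| := by
  have h : (phase V s : V →L[ℂ] V) - phase V t =
      (phase V t : V →L[ℂ] V) * ((Complex.exp (Complex.I * (s - t : ℝ)) - 1) • 1) := by
    rw [coe_phase, coe_phase, smul_mul_smul_comm, mul_sub, ← Complex.exp_add, ← sub_smul, mul_one,
      mul_one]
    congr 3
    push_cast
    ring_nf
  rw [h, CStarRing.norm_coe_unitary_mul, norm_smul]
  refine (mul_le_of_le_one_right (norm_nonneg _) ContinuousLinearMap.norm_id_le).trans ?_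
  exact Real.norm_exp_I_mul_ofReal_sub_one_le

variable {N : ℕ} {A : Matrix (Fin N) (Fin N) ℕ} {G : Type*} [Group G]

/-- The unitary function `e^{-ibr} π(Θ)`. -/
noncomputable def twistedUnitary (ρ : G →* unitary (V →L[ℂ] V)) (r : OneSided A → ℝ)
    (Θ : OneSided A → G) (b : ℝ) (y : OneSided A) : unitary (V →L[ℂ] V) :=
  phase V (-(b * r y)) * ρ (Θ y)

lemma cocycle_twistedUnitary (ρ : G →* unitary (V →L[ℂ] V)) (r : OneSided A → ℝ)
    (Θ : OneSided A → G) (b : ℝ) (n : ℕ) (y : OneSided A) :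
    cocycle (twistedUnitary ρ r Θ b) n y = phase V (-(b * roofSum r n y)) * ρ (cocycle Θ n y) := by
  induction n with
  | zero => simp [cocycle, roofSum]
  | succ n ih =>
    have hr : roofSum r (n + 1) y = roofSum r n y + r (OneSided.shift^[n] y) :=
      birkhoffSum_succ _ _ _ _
    rw [cocycle, ih, cocycle, twistedUnitary, hr, map_mul, mul_add, neg_add_rev, phase_add,
      mul_assoc, mul_assoc, ← mul_assoc (ρ _) (phase V _), ← phase_comm, mul_assoc]

variable [TopologicalSpace G]

/-- Phases are central, so the displacement of a leg can be absorbed into its twist as the scalar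
`e^{ibt}`. The conventions for stable and unstable legs give the same sign. -/
lemma IsLeg.twistedUnitary {ρ : G →* unitary (V →L[ℂ] V)} (hρ : Continuous ρ)
    {r : OneSided A → ℝ} {Θ : OneSided A → G} (b : ℝ) {n₀ : ℕ} {x y : TwoSided A} {t : ℝ} {g : G}
    (h : IsLeg r Θ n₀ x y t g) :
    IsLeg (fun _ => (0 : ℝ)) (twistedUnitary ρ r Θ b) n₀ x y 0 (phase V (b * t) * ρ g) := by
  rcases h with ⟨hxy, ht, hg⟩ | ⟨hxy, ht, hg⟩
  · refine Or.inl ⟨hxy, by simp [roofSum, birkhoffSum], ?_⟩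
    have : Tendsto (fun n => phase V (b * (roofSum r n y.future - roofSum r n x.future)) *
        ρ ((cocycle Θ n y.future)⁻¹ * cocycle Θ n x.future)) atTop
        (𝓝 (phase V (b * t) * ρ g)) :=
      ((continuous_phase.tendsto _).comp (ht.const_mul b)).mul ((hρ.tendsto _).comp hg)
    refine this.congr fun n => ?_
    rw [cocycle_twistedUnitary, cocycle_twistedUnitary, mul_inv_rev, phase_inv, neg_neg, map_mul,
      map_inv, ← phase_comm, mul_assoc, ← mul_assoc _ (phase V _), ← phase_comm, mul_assoc,
      ← mul_assoc (phase V _) (phase V _), ← phase_add]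
    congr 2
    ring
  · refine Or.inr ⟨hxy, by simp [roofSum, birkhoffSum], ?_⟩
    have : Tendsto (fun n => phase V (b * (roofSum r n (x.shiftBack n).future -
        roofSum r n (y.shiftBack n).future)) *
        ρ (cocycle Θ n (y.shiftBack n).future * (cocycle Θ n (x.shiftBack n).future)⁻¹)) atTop
        (𝓝 (phase V (b * t) * ρ g)) :=
      ((continuous_phase.tendsto _).comp (ht.const_mul b)).mul ((hρ.tendsto _).comp hg)
    refine this.congr fun n => ?_
    rw [cocycle_twistedUnitary, cocycle_twistedUnitary, mul_inv_rev, phase_inv, neg_neg, map_mul,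
      map_inv, ← phase_comm, mul_assoc, ← mul_assoc _ (phase V _), ← phase_comm, mul_assoc,
      ← mul_assoc (phase V _) (phase V _), ← phase_add]
    congr 2
    ring

/-- The scalars collected along the chain multiply to `e^{ib · 0} = 1`; this is the purpose of
requiring zero total displacement, and it makes the twists independent of `b`. -/
lemma mem_chainTwists_twistedUnitary {ρ : G →* unitary (V →L[ℂ] V)} (hρ : Continuous ρ)
    {r : OneSided A → ℝ} {Θ : OneSided A → G} (b : ℝ) {w : TwoSided A} {n₀ p₀ : ℕ} {a : G}
    (ha : a ∈ chainTwists r Θ w n₀ p₀) :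
    ρ a ∈ chainTwists (fun _ => (0 : ℝ)) (twistedUnitary ρ r Θ b) w n₀ p₀ := by
  obtain ⟨m, C, t, g, hm, hC0, hCm, hlegs, ht, rfl⟩ := ha
  refine ⟨m, C, fun _ => 0, fun i => phase V (b * t i) * ρ (g i), hm, hC0, hCm,
    fun i hi => (hlegs i hi).twistedUnitary hρ b, by simp, ?_⟩
  have hprod : ∀ k, ((List.range k).reverse.map fun i => phase V (b * t i) * ρ (g i)).prod =
      phase V (b * ∑ i ∈ Finset.range k, t i) * ρ ((List.range k).reverse.map g).prod := by
    intro k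
    induction k with
    | zero => simp
    | succ k ih =>
      rw [List.range_succ, List.reverse_append, List.reverse_singleton, List.singleton_append,
        List.map_cons, List.prod_cons, ih, List.map_cons, List.prod_cons, map_mul,
        Finset.sum_range_succ, mul_add, add_comm, phase_add, mul_assoc, mul_assoc,
        ← mul_assoc (ρ _) (phase V _), ← phase_comm, mul_assoc]
  rw [hprod, ht, mul_zero, phase_zero, one_mul]

end Twist

namespace UnitaryIrrep

variable {G : Type*} [Group G] [TopologicalSpace G]

lemma continuous_op (π : UnitaryIrrep G) : Continuous π.op :=
  continuous_clm_apply.2 π.continuous_apply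

lemma continuous_toHom (π : UnitaryIrrep G) : Continuous π.toHom :=
  Continuous.subtype_mk π.continuous_op fun g => (π.toHom g).2

lemma op_mul (π : UnitaryIrrep G) (g h : G) : π.op (g * h) = π.op g * π.op h := by
  unfold op
  rw [map_mul]
  rfl

lemma op_one (π : UnitaryIrrep G) : π.op 1 = 1 := by
  unfold op
  rw [map_one]
  rfl

lemma transfer_eq_unitaryTransfer {N : ℕ} {A : Matrix (Fin N) (Fin N) ℕ} (π : UnitaryIrrep G)
    (φ r : OneSided A → ℝ) (Θ : OneSided A → G) (b : ℝ) :
    π.transfer φ r Θ (Complex.I * b) =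
      unitaryTransfer (fun y => Real.exp (φ y)) (twistedUnitary π.toHom r Θ b) := by
  funext h x
  unfold transfer unitaryTransfer
  refine finsum_congr fun y => finsum_congr fun _ => ?_
  rw [twistedUnitary, unitary_mul_apply, coe_phase, smul_apply, smul_smul]
  change _ = _ • π.op (Θ y) (h y)
  congr 1
  rw [Complex.ofReal_exp, ← Complex.exp_add]
  congr 1
  push_cast
  ring

end UnitaryIrrep

/-! ### Contraction in the scaled norm -/

section Norms

variable {N : ℕ} {A : Matrix (Fin N) (Fin N) ℕ} {V : Type*} [NormedAddCommGroup V] {lam : ℝ}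
  {h : OneSided A → V}

lemma MemLip.exists_nonneg (h0 : 0 ≤ lam) (hh : MemLip lam h) :
    ∃ K : ℝ, 0 ≤ K ∧ ∀ x y, ‖h x - h y‖ ≤ K * OneSided.dist lam x y := by
  obtain ⟨K, hK⟩ := hh
  exact ⟨max K 0, le_max_right _ _, fun x y => (hK x y).trans
    (mul_le_mul_of_nonneg_right (le_max_left _ _) (OneSided.dist_nonneg h0 x y))⟩

/-- A real supremum is meaningful only over a bounded set; the bound comes from the Lipschitz
condition and the diameter being at most one. -/
lemma MemLip.norm_le_supNorm (h0 : 0 ≤ lam) (h1 : lam ≤ 1) (hh : MemLip lam h) (x : OneSided A) :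
    ‖h x‖ ≤ supNorm h := by
  obtain ⟨K, hK0, hK⟩ := hh.exists_nonneg h0
  refine le_ciSup (f := fun x => ‖h x‖) ⟨‖h x‖ + K, ?_⟩ x
  rintro _ ⟨y, rfl⟩
  have e1 : ‖h y‖ ≤ ‖h x‖ + ‖h y - h x‖ := norm_le_norm_add_norm_sub' _ _
  have e2 := (hK y x).trans (mul_le_of_le_one_right hK0 (OneSided.dist_le_one h0 h1 y x))
  simp only
  linarith

lemma OneSided.eq_of_dist_eq_zero (h0 : 0 < lam) {x y : OneSided A}
    (h : OneSided.dist lam x y = 0) : x = y := by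
  by_contra hne
  unfold OneSided.dist at h
  rw [if_neg hne] at h
  exact (pow_pos h0 _).ne' h

lemma MemLip.norm_sub_le_lipNorm (h0 : 0 < lam) (hh : MemLip lam h) (x y : OneSided A) :
    ‖h x - h y‖ ≤ lipNorm lam h * OneSided.dist lam x y := by
  obtain ⟨K, hK0, hK⟩ := hh.exists_nonneg h0.le
  rcases (OneSided.dist_nonneg h0.le x y).eq_or_lt with hd | hd
  · rw [OneSided.eq_of_dist_eq_zero h0 hd.symm]
    simp
  · rw [← div_le_iff₀ hd]
    refine le_ciSup (f := fun p : OneSided A × OneSided A =>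
      ‖h p.1 - h p.2‖ / OneSided.dist lam p.1 p.2) ⟨K, ?_⟩ (x, y)
    rintro _ ⟨p, rfl⟩
    exact div_le_of_le_mul₀ (OneSided.dist_nonneg h0.le _ _) hK0 (hK _ _)

lemma supNorm_le {R : ℝ} (hR : 0 ≤ R) (hh : ∀ x, ‖h x‖ ≤ R) : supNorm h ≤ R :=
  Real.iSup_le hh hR

lemma lipNorm_le (h0 : 0 ≤ lam) {L : ℝ} (hL : 0 ≤ L)
    (hh : ∀ x y, ‖h x - h y‖ ≤ L * OneSided.dist lam x y) : lipNorm lam h ≤ L :=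
  Real.iSup_le (fun _ => div_le_of_le_mul₀ (OneSided.dist_nonneg h0 _ _) hL (hh _ _)) hL

end Norms

/-! ### Contraction for a general unitary cocycle -/

section Contraction

variable {N : ℕ} {A : Matrix (Fin N) (Fin N) ℕ}
variable {V : Type*} [NormedAddCommGroup V] [InnerProductSpace ℂ V] [CompleteSpace V]
variable {U : OneSided A → unitary (V →L[ℂ] V)} {p : OneSided A → ℝ}

/-- The Lipschitz part contracts by the Lasota–Yorke inequality. If the supremum did not contract,
`exists_unit_almost_fixed` would produce a unit vector almost fixed by all chain twists, against
`hdio`. -/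
lemma scaledNorm_iterate_unitaryTransfer_le {lam : ℝ} (h0 : 0 < lam) (h1 : lam < 1)
    (hA01 : IsZeroOne A) {M : ℕ} (hM : ∀ i j, 0 < (A ^ M) i j) (hp : IsNormalizedWeight p)
    {c Kp K₁ β C₁₈ ε κ : ℝ} (hc : ∀ y, 1 ≤ c * p y) (hKp : 0 ≤ Kp) (hK₁ : 0 ≤ K₁)
    (hpL : ∀ x y, |p x - p y| ≤ Kp * OneSided.dist lam x y)
    (hU : ∀ x y, ‖(U x : V →L[ℂ] V) - U y‖ ≤ K₁ * β * OneSided.dist lam x y)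
    (hβ : 1 ≤ β) (hC₁₈ : 1 ≤ C₁₈) (hC₁₈' : 2 * ((N * Kp + K₁ + 2) / (1 - lam)) ≤ C₁₈)
    (hε : ε ≤ 1 / 4) {n n₀ q p₀ : ℕ} (w : TwoSided A) (hn : lam ^ n ≤ 1 / 4) (hq : n₀ ≤ q)
    (hqn : q + M + q ≤ n)
    (hlt : p₀ * (2 * Real.sqrt (2 * (c ^ (q + M + q) * ε)) +
      (2 * C₁₈ + 3 * (K₁ / (1 - lam))) * β * lam ^ (q - n₀)) < κ)
    (hdio : ∀ v : V, ∃ a ∈ chainTwists (fun _ => (0 : ℝ)) U w n₀ p₀, ‖v‖ * κ ≤ ‖v - a.1 v‖)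
    {h : OneSided A → V} (hh : MemLip lam h) :
    MemLip lam ((unitaryTransfer p U)^[n] h) ∧
      scaledNorm lam C₁₈ β ((unitaryTransfer p U)^[n] h) ≤ (1 - ε) * scaledNorm lam C₁₈ β h := by
  have h1' : 0 < 1 - lam := by linarith
  have hβ0 : 0 < β := by linarith
  set R := scaledNorm lam C₁₈ β h with hRdef
  have hCβ : 0 < C₁₈ * β := by positivity
  have hRsup : ∀ x, ‖h x‖ ≤ R := fun x =>
    (hh.norm_le_supNorm h0.le h1.le x).trans (le_max_left _ _)
  have hR0 : 0 ≤ R := (norm_nonneg _).trans (hRsup w.future)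
  have hRlip : ∀ x y, ‖h x - h y‖ ≤ C₁₈ * β * R * OneSided.dist lam x y := fun x y => by
    refine (hh.norm_sub_le_lipNorm h0 x y).trans
      (mul_le_mul_of_nonneg_right ?_ (OneSided.dist_nonneg h0.le x y))
    rw [mul_comm, ← div_le_iff₀ hCβ]
    exact le_max_right _ _
  -- The lower bound on `C₁₈` makes the constant term of the Lasota–Yorke inequality at most half of
  -- `C₁₈ * β * R`.
  have hLY : ∀ k x y, ‖(unitaryTransfer p U)^[k] h x - (unitaryTransfer p U)^[k] h y‖ ≤
      (1 / 2 + lam ^ k) * (C₁₈ * β * R) * OneSided.dist lam x y := by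
    intro k x y
    refine (norm_iterate_unitaryTransfer_sub_le h0.le h1 hp hKp (by positivity) hR0 hpL hU hRsup
      (by positivity) hRlip k x y).trans
      (mul_le_mul_of_nonneg_right ?_ (OneSided.dist_nonneg h0.le x y))
    rw [add_mul (1 / 2 : ℝ)]
    refine add_le_add ?_ (le_refl (lam ^ k * (C₁₈ * β * R)))
    have e1 : N * Kp + K₁ * β + 2 ≤ (N * Kp + K₁ + 2) * β := by
      have : 0 ≤ N * Kp := by positivity
      nlinarith
    calc (N * Kp + K₁ * β + 2) * R / (1 - lam)
        ≤ (N * Kp + K₁ + 2) * β * R / (1 - lam) := by gcongr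
      _ = (N * Kp + K₁ + 2) / (1 - lam) * (β * R) := by ring
      _ ≤ C₁₈ / 2 * (β * R) := by
          refine mul_le_mul_of_nonneg_right (by linarith) (by positivity)
      _ = _ := by ring
  refine ⟨⟨_, hLY n⟩, max_le (supNorm_le (mul_nonneg (by linarith) hR0) fun x => ?_) ?_⟩
  · rcases hR0.eq_or_lt with hR | hR
    · have := norm_iterate_unitaryTransfer_le (U := U) hp hRsup n x
      rw [← hR] at this ⊢
      simpa using this
    · by_contra hcon
      push Not at hcon
      -- The surplus `k` iterates only preserve the norms; near-maximality is exploited over the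
      -- remaining `q + M + q`.
      obtain ⟨k, rfl⟩ := Nat.exists_eq_add_of_le hqn
      set h' : OneSided A → V := ((R⁻¹ : ℝ) : ℂ) • (unitaryTransfer p U)^[k] h with hh'
      have hnorm : ‖((R⁻¹ : ℝ) : ℂ)‖ = R⁻¹ := by
        rw [Complex.norm_real, Real.norm_eq_abs, abs_of_pos (inv_pos.2 hR)]
      have hsup' : ∀ y, ‖h' y‖ ≤ 1 := fun y => by
        rw [hh', Pi.smul_apply, norm_smul, hnorm, inv_mul_le_iff₀ hR, mul_one]
        exact norm_iterate_unitaryTransfer_le hp hRsup k y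
      have hlip' : ∀ y z, ‖h' y - h' z‖ ≤ 2 * C₁₈ * β * OneSided.dist lam y z := fun y z => by
        rw [hh', Pi.smul_apply, Pi.smul_apply, ← smul_sub, norm_smul, hnorm, inv_mul_le_iff₀ hR]
        refine (hLY k y z).trans ?_
        rw [← mul_assoc R]
        refine mul_le_mul_of_nonneg_right ?_ (OneSided.dist_nonneg h0.le y z)
        have : lam ^ k ≤ 1 := pow_le_one₀ h0.le h1.le
        have e : 0 ≤ C₁₈ * β * R := by positivity
        nlinarith
      have hx : 1 - ε ≤ ‖(unitaryTransfer p U)^[q + M + q] h' x‖ := by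
        rw [hh', unitaryTransfer_iterate_smul, Pi.smul_apply, norm_smul, hnorm,
          ← Function.iterate_add_apply, le_inv_mul_iff₀ hR, mul_comm]
        exact hcon.le
      obtain ⟨v, hv, hva⟩ := exists_unit_almost_fixed hA01 hM h0.le h1 hp hc (by positivity) hU
        hsup' (by positivity) hlip' hq (by linarith) hx w p₀
      obtain ⟨a, ha, hav⟩ := hdio v
      have := hva a ha
      rw [hv, one_mul] at hav
      have e : (2 * C₁₈ * β + 3 * (K₁ * β / (1 - lam))) * lam ^ (q - n₀) =
        (2 * C₁₈ + 3 * (K₁ / (1 - lam))) * β * lam ^ (q - n₀) := by ring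
      rw [e] at this
      linarith
  · rw [div_le_iff₀ hCβ]
    refine lipNorm_le h0.le (by
      have : 0 ≤ 1 - ε := by linarith
      positivity) fun x y => (hLY n x y).trans ?_
    refine mul_le_mul_of_nonneg_right ?_ (OneSided.dist_nonneg h0.le x y)
    have e : 0 ≤ C₁₈ * β * R := by positivity
    -- Here `1 / 2 + lam ^ n ≤ 3 / 4 ≤ 1 - ε`.
    nlinarith

end Contraction

/-! ### From bounds on highest weights to the contraction estimate -/

section Reduction

variable {E : Type*} [NormedAddCommGroup E] [NormedSpace ℝ E]
  {G : Type*} [TopologicalSpace G] [ChartedSpace E G] [Group G]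

lemma abs_exp_sub_exp_le_of_nonpos {a b : ℝ} (ha : a ≤ 0) (hb : b ≤ 0) :
    |Real.exp a - Real.exp b| ≤ |a - b| := by
  wlog hab : b ≤ a generalizing a b
  · rw [abs_sub_comm, abs_sub_comm a]
    exact this hb ha (le_of_not_ge hab)
  rw [abs_of_nonneg (sub_nonneg.2 (Real.exp_le_exp.2 hab)), abs_of_nonneg (sub_nonneg.2 hab)]
  have e1 : Real.exp b = Real.exp a * Real.exp (b - a) := by rw [← Real.exp_add]; ring_nf
  have e2 := Real.add_one_le_exp (b - a)
  have e3 : Real.exp a ≤ 1 := Real.exp_le_one_iff.2 ha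
  have e4 := Real.exp_pos a
  rw [e1]
  nlinarith

/-- The contraction estimate, given that the maps `π ∘ Θ` are uniformly Lipschitz relative to the
highest weight and that nontrivial highest weights are bounded away from zero. -/
theorem contraction_of_highestWeight_bounds [FiniteDimensional ℝ E]
    (B : LinearMap.BilinForm ℝ (GroupLieAlgebra 𝓘(ℝ, E) G))
    (𝔱 : Submodule ℝ (GroupLieAlgebra 𝓘(ℝ, E) G)) (H₀ : 𝔱)
    {N : ℕ} (A : Matrix (Fin N) (Fin N) ℕ) (hA01 : IsZeroOne A) (hA : IsAperiodic A)
    (lam : ℝ) (hlam0 : 0 < lam) (hlam1 : lam < 1)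
    (φ : OneSided A → ℝ) (hφ : MemLip lam φ) (hφ1 : IsNormalizedPotential φ)
    (r : OneSided A → ℝ) (hr : MemLip lam r) (Θ : OneSided A → G)
    {C c₀ : ℝ} (hC : 0 ≤ C) (hc₀ : 0 < c₀)
    (hLip : ∀ π : UnitaryIrrep G, π.Nontrivial → ∀ ℓ, IsHighestWeight 𝔱 H₀ π ℓ →
      ∀ x y, ‖π.op (Θ x) - π.op (Θ y)‖ ≤ C * weightNorm B 𝔱 ℓ * OneSided.dist lam x y)
    (hlow : ∀ π : UnitaryIrrep G, π.Nontrivial → ∀ ℓ, IsHighestWeight 𝔱 H₀ π ℓ →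
      c₀ ≤ weightNorm B 𝔱 ℓ)
    (hD : ∃ (w : TwoSided A) (n₀ p₀ : ℕ), 1 ≤ p₀ ∧
      IsDiophantine B 𝔱 H₀ (chainTwists r Θ w n₀ p₀)) :
    ∃ C₀ > (0 : ℝ), ∀ C₁₅ ≥ C₀, ∃ K₀ ≥ (1 : ℝ), ∀ C₁₈ ≥ K₀,
      ∃ C₂₃ > (0 : ℝ), ∃ C₂₅ > (0 : ℝ),
        ∀ π : UnitaryIrrep G, π.Nontrivial → ∀ ℓ, IsHighestWeight 𝔱 H₀ π ℓ → ∀ b : ℝ,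
          1 < frequency B 𝔱 C₁₅ ℓ b ∧
          ∀ h : OneSided A → π.Space, MemLip lam h →
            MemLip lam ((π.transfer φ r Θ (Complex.I * b))^[
              ⌈C₂₅ * Real.log (frequency B 𝔱 C₁₅ ℓ b)⌉₊] h) ∧
            scaledNorm lam C₁₈ (frequency B 𝔱 C₁₅ ℓ b)
                ((π.transfer φ r Θ (Complex.I * b))^[
                  ⌈C₂₅ * Real.log (frequency B 𝔱 C₁₅ ℓ b)⌉₊] h) ≤
              (1 - frequency B 𝔱 C₁₅ ℓ b ^ (-C₂₃)) *
                scaledNorm lam C₁₈ (frequency B 𝔱 C₁₅ ℓ b) h := by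
  obtain ⟨w, n₀, p₀, -, D, hD0, δ, hδ0, hdio⟩ := hD
  obtain ⟨M, -, hM⟩ := hA
  obtain ⟨Kφ, hKφ0, hKφ⟩ := hφ.exists_nonneg hlam0.le
  obtain ⟨Kr, hKr0, hKr⟩ := hr.exists_nonneg hlam0.le
  have h1' : 0 < 1 - lam := by linarith
  have hsum : ∀ x, ∑ i ∈ OneSided.letters x, Real.exp (φ (OneSided.cons i x)) = 1 := fun x => by
    rw [← OneSided.finsum_preimages (fun y => Real.exp (φ y))]
    exact hφ1 x
  have hp : IsNormalizedWeight fun y => Real.exp (φ y) := ⟨fun y => Real.exp_pos _, hsum⟩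
  -- Each weight is one summand of a sum of positive terms equal to one.
  have hφ0 : ∀ y, φ y ≤ 0 := fun y => by
    rw [← Real.exp_le_one_iff, ← hsum y.shift]
    have := Finset.single_le_sum (f := fun i => Real.exp (φ (OneSided.cons i y.shift)))
      (fun i _ => (Real.exp_pos _).le) (OneSided.letters_nonempty_of_shift y)
    simpa only [OneSided.cons_shift] using this
  have hpL : ∀ x y, |Real.exp (φ x) - Real.exp (φ y)| ≤ Kφ * OneSided.dist lam x y := fun x y =>
    (abs_exp_sub_exp_le_of_nonpos (hφ0 x) (hφ0 y)).trans (hKφ x y)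
  -- As the diameter is at most one, `φ` exceeds `φ w.future - Kφ` everywhere, which bounds the
  -- weights below by `1 / c`.
  set c := Real.exp (Kφ - φ w.future) with hcdef
  have hc1 : 1 ≤ c := Real.one_le_exp (by linarith [hφ0 w.future])
  have hc : ∀ y, 1 ≤ c * Real.exp (φ y) := fun y => by
    rw [hcdef, ← Real.exp_add]
    refine Real.one_le_exp ?_
    have e1 := (hKφ w.future y).trans
      (mul_le_of_le_one_right hKφ0 (OneSided.dist_le_one hlam0.le hlam1.le _ _))
    have e2 := le_abs_self (φ w.future - φ y)
    rw [Real.norm_eq_abs] at e1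
    linarith
  set m := halfRootNumber 𝔱 / 2 with hm
  have hm0 : 0 ≤ m := by
    have : Module.finrank ℝ 𝔱 ≤ Module.finrank ℝ (GroupLieAlgebra 𝓘(ℝ, E) G) := by
      have : FiniteDimensional ℝ (GroupLieAlgebra 𝓘(ℝ, E) G) :=
        inferInstanceAs (FiniteDimensional ℝ E)
      exact Submodule.finrank_le 𝔱
    have : (Module.finrank ℝ 𝔱 : ℝ) ≤ Module.finrank ℝ (GroupLieAlgebra 𝓘(ℝ, E) G) := by
      exact_mod_cast this
    rw [hm, halfRootNumber]
    linarith
  -- With `W ≥ c₀` this gives `κ₁ * W ≤ W ^ (1 + m) ≤ β`, including when `W < 1`. Of the exponent `1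
  -- + m`, only `m ≥ 0` matters.
  set κ₁ := c₀ ^ m with hκ₁
  have hκ₁0 : 0 < κ₁ := Real.rpow_pos_of_pos hc₀ m
  set K₁ := Kr + C / κ₁ with hK₁
  have hK₁0 : 0 ≤ K₁ := by positivity
  -- The bound on `C₁₅` forces `β ≥ 2`; the one on `C₁₈` is the Lasota–Yorke requirement.
  refine ⟨max 1 (2 / (κ₁ * c₀)), by positivity, fun C₁₅ hC₁₅ =>
    ⟨max 1 (2 * ((N * Kφ + K₁ + 2) / (1 - lam))), le_max_left _ _, fun C₁₈ hC₁₈ => ?_⟩⟩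
  have hC₁₅1 : 1 ≤ C₁₅ := (le_max_left _ _).trans hC₁₅
  have hC₁₈1 : 1 ≤ C₁₈ := (le_max_left _ _).trans hC₁₈
  -- The factor `κ₁ ^ D` converts the Diophantine bound from powers of `W` to powers of `β`: `κ₁ * W
  -- ≤ β` gives `δ * κ₁ ^ D * β ^ (-D) ≤ δ / W ^ D`.
  obtain ⟨C₂₃, hC₂₃, C₂₅, hC₂₅, hconst⟩ := exists_iterate_constants hlam0 hlam1 hc1
    (P := 2 * C₁₈ + 3 * (K₁ / (1 - lam))) (κ := δ * κ₁ ^ D) (by positivity) (by positivity) hD0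
    n₀ M p₀
  refine ⟨C₂₃, by linarith, C₂₅, hC₂₅, fun π hπ ℓ hℓ b => ?_⟩
  set β := frequency B 𝔱 C₁₅ ℓ b with hβdef
  set W := weightNorm B 𝔱 ℓ with hW
  have hWc : c₀ ≤ W := hlow π hπ ℓ hℓ
  have hW0 : 0 < W := hc₀.trans_le hWc
  have hpowW : κ₁ * W ≤ W ^ (1 + m) := by
    rw [add_comm, Real.rpow_add hW0, Real.rpow_one]
    exact mul_le_mul_of_nonneg_right (Real.rpow_le_rpow hc₀.le hWc hm0) hW0.le
  have hβ_eq : β = |b| + C₁₅ * W ^ (1 + m) := rfl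
  have hWm : 0 ≤ W ^ (1 + m) := by positivity
  have hbβ : |b| ≤ β := by
    rw [hβ_eq]
    have : 0 ≤ C₁₅ * W ^ (1 + m) := by positivity
    linarith
  have hWβ : κ₁ * W ≤ β := by
    rw [hβ_eq]
    have : W ^ (1 + m) ≤ C₁₅ * W ^ (1 + m) := le_mul_of_one_le_left hWm hC₁₅1
    have := abs_nonneg b
    linarith
  have hβ2 : 2 ≤ β := by
    have e1 : 2 / (κ₁ * c₀) ≤ C₁₅ := (le_max_right _ _).trans hC₁₅
    rw [div_le_iff₀ (by positivity)] at e1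
    have e2 : κ₁ * c₀ ≤ W ^ (1 + m) := (mul_le_mul_of_nonneg_left hWc hκ₁0.le).trans hpowW
    have e3 : C₁₅ * (κ₁ * c₀) ≤ C₁₅ * W ^ (1 + m) := by gcongr
    rw [hβ_eq]
    have := abs_nonneg b
    linarith
  have hβ0 : 0 < β := by linarith
  refine ⟨by linarith, fun h hh => ?_⟩
  obtain ⟨hn, q, hq, hqn, hlt⟩ := hconst β hβ2
  rw [π.transfer_eq_unitaryTransfer]
  have hU : ∀ x y, ‖(twistedUnitary π.toHom r Θ b x : π.Space →L[ℂ] π.Space) -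
      twistedUnitary π.toHom r Θ b y‖ ≤ K₁ * β * OneSided.dist lam x y := by
    intro x y
    have hd := OneSided.dist_nonneg hlam0.le x y
    refine (norm_unitary_mul_sub_mul_le _ _ _ _).trans ?_
    have e1 : ‖(phase π.Space (-(b * r x)) : π.Space →L[ℂ] π.Space) - phase π.Space (-(b * r y))‖ ≤
        β * Kr * OneSided.dist lam x y := by
      refine (norm_phase_sub_le _ _).trans ?_
      rw [show -(b * r x) - -(b * r y) = -(b * (r x - r y)) by ring, abs_neg, abs_mul, mul_assoc]
      exact mul_le_mul hbβ (hKr x y) (abs_nonneg _) hβ0.le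
    have e2 := hLip π hπ ℓ hℓ x y
    have e3 : C * W * OneSided.dist lam x y ≤ C / κ₁ * β * OneSided.dist lam x y := by
      refine mul_le_mul_of_nonneg_right ?_ hd
      rw [div_mul_eq_mul_div, le_div_iff₀ hκ₁0, mul_assoc, mul_comm W]
      exact mul_le_mul_of_nonneg_left hWβ hC
    have e4 : K₁ * β * OneSided.dist lam x y = β * Kr * OneSided.dist lam x y +
        C / κ₁ * β * OneSided.dist lam x y := by rw [hK₁]; ring
    rw [e4]
    exact add_le_add e1 (e2.trans e3)
  refine scaledNorm_iterate_unitaryTransfer_le hlam0 hlam1 hA01 hM hp hc hKφ0 hK₁0 hpL hU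
    (by linarith) hC₁₈1 ((le_max_right _ _).trans hC₁₈) ?_ w hn hq hqn hlt ?_ hh
  · calc β ^ (-C₂₃) ≤ β ^ (-(2 : ℝ)) :=
          Real.rpow_le_rpow_of_exponent_le (by linarith) (by linarith)
      _ = (β ^ 2)⁻¹ := by rw [Real.rpow_neg hβ0.le, Real.rpow_two]
      _ ≤ 1 / 4 := by
          rw [one_div]
          exact inv_anti₀ (by norm_num) (by nlinarith)
  · intro v
    obtain ⟨g, hg, hgv⟩ := hdio π hπ ℓ hℓ v
    refine ⟨π.toHom g, mem_chainTwists_twistedUnitary π.continuous_toHom b hg, ?_⟩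
    refine le_trans (mul_le_mul_of_nonneg_left ?_ (norm_nonneg _)) hgv
    rw [le_div_iff₀ (Real.rpow_pos_of_pos hW0 D), mul_assoc, mul_assoc]
    refine mul_le_of_le_one_right hδ0.le ?_
    rw [mul_left_comm, ← Real.mul_rpow hκ₁0.le hW0.le, Real.rpow_neg hβ0.le,
      inv_mul_le_iff₀ (by positivity), mul_one]
    exact Real.rpow_le_rpow (by positivity) hWβ hD0.le

end Reduction

/-! ### The chart at the identity of a Lie group -/

section IdChart

variable (E : Type*) [NormedAddCommGroup E] [NormedSpace ℝ E]
  (G : Type*) [TopologicalSpace G] [ChartedSpace E G] [Group G]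

/-- The preferred chart at the identity. -/
noncomputable abbrev idChart : PartialEquiv G E := extChartAt 𝓘(ℝ, E) (1 : G)

/-- The coordinates of the identity. -/
noncomputable abbrev idPoint : E := idChart E G 1

/-- The multiplication in the chart at the identity. -/
noncomputable def chartMul (p : E × E) : E :=
  idChart E G ((idChart E G).symm p.1 * (idChart E G).symm p.2)

/-- The conjugation `g h g⁻¹` in the chart at the identity. -/
noncomputable def chartConj (p : E × E) : E :=
  idChart E G ((idChart E G).symm p.1 * (idChart E G).symm p.2 * ((idChart E G).symm p.1)⁻¹)

/-- The adjoint action of a Lie group on its Lie algebra, in the chart at the identity. -/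
noncomputable def lieAd (g : G) : E →L[ℝ] E :=
  fderiv ℝ (fun v => idChart E G (g * (idChart E G).symm v * g⁻¹)) (idPoint E G)

variable {E G}

@[simp] lemma idChart_symm_idPoint : (idChart E G).symm (idPoint E G) = 1 :=
  extChartAt_to_inv 1

lemma idPoint_mem_target : idPoint E G ∈ (idChart E G).target := mem_extChartAt_target 1

lemma idChart_source_mem_nhds : (idChart E G).source ∈ 𝓝 (1 : G) :=
  extChartAt_source_mem_nhds 1

lemma continuousAt_idChart_symm :
    ContinuousAt (idChart E G).symm (idPoint E G) :=
  continuousAt_extChartAt_symm 1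

/-- The manifold derivative at the identity is the derivative in the chart. -/
lemma mfderiv_one_eq_fderiv {F : Type*} [NormedAddCommGroup F] [NormedSpace ℝ F] {f : G → F}
    (hf : MDifferentiableAt 𝓘(ℝ, E) 𝓘(ℝ, F) f 1) :
    (mfderiv 𝓘(ℝ, E) 𝓘(ℝ, F) f 1 : E →L[ℝ] F) =
      fderiv ℝ (fun u => f ((idChart E G).symm u)) (idPoint E G) := by
  rw [hf.mfderiv]
  simp only [modelWithCornersSelf_coe, Set.range_id, fderivWithin_univ]
  rfl

lemma idChart_target_mem_nhds : (idChart E G).target ∈ 𝓝 (idPoint E G) :=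
  (isOpen_extChartAt_target (1 : G)).mem_nhds idPoint_mem_target

lemma eventually_nhds_idPoint_left {P : E × E → Prop}
    (h : ∀ᶠ p in 𝓝 (idPoint E G, idPoint E G), P p) : ∀ᶠ u in 𝓝 (idPoint E G), P (u, idPoint E G) :=
  (Continuous.tendsto (f := fun u : E => (u, idPoint E G)) (by fun_prop) _).eventually h

lemma eventually_nhds_idPoint_right {P : E × E → Prop}
    (h : ∀ᶠ p in 𝓝 (idPoint E G, idPoint E G), P p) : ∀ᶠ u in 𝓝 (idPoint E G), P (idPoint E G, u) :=
  (Continuous.tendsto (f := fun u : E => (idPoint E G, u)) (by fun_prop) _).eventually h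

lemma fderiv_comp_prodMk_right {F : Type*} [NormedAddCommGroup F] [NormedSpace ℝ F]
    {f : E × E → F} {u v : E} (hf : DifferentiableAt ℝ f (u, v)) :
    HasFDerivAt (fun w => f (u, w)) (fderiv ℝ f (u, v) ∘L ContinuousLinearMap.inr ℝ E E) v :=
  hf.hasFDerivAt.comp v (hasFDerivAt_prodMk_right u v)

lemma fderiv_comp_prodMk_left {F : Type*} [NormedAddCommGroup F] [NormedSpace ℝ F]
    {f : E × E → F} {u v : E} (hf : DifferentiableAt ℝ f (u, v)) :
    HasFDerivAt (fun w => f (w, v)) (fderiv ℝ f (u, v) ∘L ContinuousLinearMap.inl ℝ E E) u :=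
  hf.hasFDerivAt.comp u (hasFDerivAt_prodMk_left u v)

lemma two_le_infty : (2 : WithTop ℕ∞) ≤ ∞ :=
  WithTop.coe_le_coe.2 (le_top : (2 : ℕ∞) ≤ ⊤)

lemma hasFDerivAt_fderiv_apply_comp {E₁ E₂ F : Type*} [NormedAddCommGroup E₁] [NormedSpace ℝ E₁]
    [NormedAddCommGroup E₂] [NormedSpace ℝ E₂] [NormedAddCommGroup F] [NormedSpace ℝ F]
    {f : E₁ → F} {s : E₂ → E₁} {s' : E₂ →L[ℝ] E₁} {x : E₂} (hf : ContDiffAt ℝ 2 f (s x))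
    (hs : HasFDerivAt s s' x) :
    HasFDerivAt (fun u => fderiv ℝ f (s u)) (fderiv ℝ (fderiv ℝ f) (s x) ∘L s') x := by
  have h1 : DifferentiableAt ℝ (fderiv ℝ f) (s x) :=
    (hf.fderiv_right (m := 1) (by norm_num)).differentiableAt (by norm_num)
  exact h1.hasFDerivAt.comp x hs

lemma lieAd_one : lieAd E G 1 = ContinuousLinearMap.id ℝ E := by
  refine HasFDerivAt.fderiv ((hasFDerivAt_id (idPoint E G)).congr_of_eventuallyEq ?_)
  filter_upwards [idChart_target_mem_nhds (E := E) (G := G)] with u hu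
  rw [one_mul, inv_one, mul_one]
  exact (idChart E G).right_inv hu

variable [LieGroup 𝓘(ℝ, E) ∞ G]

instance LieGroup.minSmoothness_of_infty :
    LieGroup 𝓘(ℝ, E) (minSmoothness ℝ 3) G :=
  LieGroup.of_le (n := ∞) (by
    rw [minSmoothness_of_isRCLikeNormedField]
    exact WithTop.coe_le_coe.2 (le_top : (3 : ℕ∞) ≤ ⊤))

lemma contMDiffAt_idChart {g : G} (hg : g ∈ (idChart E G).source) :
    ContMDiffAt 𝓘(ℝ, E) 𝓘(ℝ, E) ∞ (idChart E G) g :=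
  contMDiffAt_extChartAt' (by simpa using hg)

lemma contMDiffAt_idChart_symm {u : E} (hu : u ∈ (idChart E G).target) :
    ContMDiffAt 𝓘(ℝ, E) 𝓘(ℝ, E) ∞ (idChart E G).symm u :=
  (contMDiffOn_extChartAt_symm (1 : G)).contMDiffAt
    ((isOpen_extChartAt_target (1 : G)).mem_nhds hu)

lemma contDiffAt_chartMul : ContDiffAt ℝ ∞ (chartMul E G) (idPoint E G, idPoint E G) := by
  rw [← contMDiffAt_iff_contDiffAt]
  have h1 : ContMDiffAt 𝓘(ℝ, E × E) 𝓘(ℝ, E) ∞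
      (fun p : E × E => (idChart E G).symm p.1) (idPoint E G, idPoint E G) :=
    ContMDiffAt.comp (idPoint E G, idPoint E G) (g := (idChart E G).symm)
      (contMDiffAt_idChart_symm idPoint_mem_target) contDiff_fst.contMDiff.contMDiffAt
  have h2 : ContMDiffAt 𝓘(ℝ, E × E) 𝓘(ℝ, E) ∞
      (fun p : E × E => (idChart E G).symm p.2) (idPoint E G, idPoint E G) :=
    ContMDiffAt.comp (idPoint E G, idPoint E G) (g := (idChart E G).symm)
      (contMDiffAt_idChart_symm idPoint_mem_target) contDiff_snd.contMDiff.contMDiffAt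
  refine ContMDiffAt.comp (idPoint E G, idPoint E G) (g := idChart E G) ?_ (h1.mul h2)
  apply contMDiffAt_idChart
  change (idChart E G).symm (idPoint E G) * (idChart E G).symm (idPoint E G) ∈ _
  rw [idChart_symm_idPoint, mul_one]
  exact mem_extChartAt_source 1

lemma contDiffAt_chartConj : ContDiffAt ℝ ∞ (chartConj E G) (idPoint E G, idPoint E G) := by
  rw [← contMDiffAt_iff_contDiffAt]
  have h1 : ContMDiffAt 𝓘(ℝ, E × E) 𝓘(ℝ, E) ∞
      (fun p : E × E => (idChart E G).symm p.1) (idPoint E G, idPoint E G) :=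
    ContMDiffAt.comp (idPoint E G, idPoint E G) (g := (idChart E G).symm)
      (contMDiffAt_idChart_symm idPoint_mem_target) contDiff_fst.contMDiff.contMDiffAt
  have h2 : ContMDiffAt 𝓘(ℝ, E × E) 𝓘(ℝ, E) ∞
      (fun p : E × E => (idChart E G).symm p.2) (idPoint E G, idPoint E G) :=
    ContMDiffAt.comp (idPoint E G, idPoint E G) (g := (idChart E G).symm)
      (contMDiffAt_idChart_symm idPoint_mem_target) contDiff_snd.contMDiff.contMDiffAt
  refine ContMDiffAt.comp (idPoint E G, idPoint E G) (g := idChart E G) ?_ ((h1.mul h2).mul h1.inv)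
  apply contMDiffAt_idChart
  change (idChart E G).symm (idPoint E G) * (idChart E G).symm (idPoint E G) *
    ((idChart E G).symm (idPoint E G))⁻¹ ∈ _
  rw [idChart_symm_idPoint, mul_one, inv_one, mul_one]
  exact mem_extChartAt_source 1

lemma eventually_differentiableAt_chartMul :
    ∀ᶠ p in 𝓝 (idPoint E G, idPoint E G), DifferentiableAt ℝ (chartMul E G) p :=
  ((contDiffAt_chartMul.of_le two_le_infty).eventually (by decide)).mono fun _ h =>
    h.differentiableAt (by norm_num)

lemma eventually_differentiableAt_chartConj :
    ∀ᶠ p in 𝓝 (idPoint E G, idPoint E G), DifferentiableAt ℝ (chartConj E G) p :=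
  ((contDiffAt_chartConj.of_le two_le_infty).eventually (by decide)).mono fun _ h =>
    h.differentiableAt (by norm_num)

/-- Left-invariant vector fields in the chart at the identity. -/
lemma eventually_mpullbackWithin_mulInvariantVectorField (X : GroupLieAlgebra 𝓘(ℝ, E) G) :
    ∀ᶠ u in 𝓝 (idPoint E G),
      (VectorField.mpullbackWithin 𝓘(ℝ, E) 𝓘(ℝ, E) (idChart E G).symm
        (mulInvariantVectorField X) (Set.range 𝓘(ℝ, E)) u : E) =
      fderiv ℝ (chartMul E G) (u, idPoint E G) ((0 : E), (X : E)) := by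
  filter_upwards [idChart_target_mem_nhds (E := E) (G := G),
    eventually_nhds_idPoint_left eventually_differentiableAt_chartMul] with u hu hd
  rw [VectorField.mpullbackWithin_apply]
  have hinv := ContinuousLinearMap.inverse_eq
    (mfderivWithin_extChartAt_symm_comp_mfderiv_extChartAt (I := 𝓘(ℝ, E)) hu)
    (mfderiv_extChartAt_comp_mfderivWithin_extChartAt_symm (I := 𝓘(ℝ, E)) hu)
  rw [hinv]
  set g := (idChart E G).symm u with hg
  have hgs : g ∈ (idChart E G).source := (idChart E G).map_target hu
  have hcomp : MDifferentiableAt 𝓘(ℝ, E) 𝓘(ℝ, E) (fun h : G => idChart E G (g * h)) 1 :=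
    ContMDiffAt.mdifferentiableAt (n := ∞) (ContMDiffAt.comp (1 : G) (g := idChart E G)
      (contMDiffAt_idChart (by rwa [mul_one])) contMDiffAt_mul_left) (by simp)
  have h1 : (mfderiv 𝓘(ℝ, E) 𝓘(ℝ, E) (fun h : G => idChart E G (g * h)) 1 : E →L[ℝ] E) X =
      fderiv ℝ (chartMul E G) (u, idPoint E G) ((0 : E), (X : E)) := by
    rw [mfderiv_one_eq_fderiv hcomp]
    exact congrArg (fun L : E →L[ℝ] E => L X) (fderiv_comp_prodMk_right hd).fderiv
  rw [← h1]
  have h2 := mfderiv_comp_apply (I := 𝓘(ℝ, E)) (I' := 𝓘(ℝ, E)) (I'' := 𝓘(ℝ, E)) (1 : G)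
    (g := idChart E G) (f := fun h : G => g * h)
    ((contMDiffAt_idChart (by rwa [mul_one])).mdifferentiableAt (by simp))
    ((contMDiffAt_mul_left (n := ∞)).mdifferentiableAt (by simp)) X
  refine Eq.trans ?_ h2.symm
  rw [mul_one]
  rfl

lemma fderiv_chartMul_inr :
    fderiv ℝ (chartMul E G) (idPoint E G, idPoint E G) ∘L ContinuousLinearMap.inr ℝ E E =
      ContinuousLinearMap.id ℝ E := by
  have h := fderiv_comp_prodMk_right (eventually_differentiableAt_chartMul (E := E) (G := G)).self_of_nhds
  have h2 : HasFDerivAt (fun w => chartMul E G (idPoint E G, w)) (ContinuousLinearMap.id ℝ E)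
      (idPoint E G) := by
    refine (hasFDerivAt_id (idPoint E G)).congr_of_eventuallyEq ?_
    filter_upwards [idChart_target_mem_nhds (E := E) (G := G)] with u hu
    rw [chartMul, idChart_symm_idPoint, one_mul]
    exact (idChart E G).right_inv hu
  exact h.unique h2

lemma fderiv_chartMul_inl :
    fderiv ℝ (chartMul E G) (idPoint E G, idPoint E G) ∘L ContinuousLinearMap.inl ℝ E E =
      ContinuousLinearMap.id ℝ E := by
  have h := fderiv_comp_prodMk_left (eventually_differentiableAt_chartMul (E := E) (G := G)).self_of_nhds
  have h2 : HasFDerivAt (fun w => chartMul E G (w, idPoint E G)) (ContinuousLinearMap.id ℝ E)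
      (idPoint E G) := by
    refine (hasFDerivAt_id (idPoint E G)).congr_of_eventuallyEq ?_
    filter_upwards [idChart_target_mem_nhds (E := E) (G := G)] with u hu
    rw [chartMul, idChart_symm_idPoint, mul_one]
    exact (idChart E G).right_inv hu
  exact h.unique h2

/-- The second derivative of the multiplication at the identity. -/
noncomputable def chartMulSnd (E G : Type*) [NormedAddCommGroup E] [NormedSpace ℝ E]
    [TopologicalSpace G] [ChartedSpace E G] [Group G] : E × E →L[ℝ] E × E →L[ℝ] E :=
  fderiv ℝ (fderiv ℝ (chartMul E G)) (idPoint E G, idPoint E G)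

lemma chartMulSnd_symm (p q : E × E) : chartMulSnd E G p q = chartMulSnd E G q p :=
  contDiffAt_chartMul.isSymmSndFDerivAt (by
    rw [minSmoothness_of_isRCLikeNormedField]; exact two_le_infty) p q

/-- The Lie bracket in terms of the multiplication. -/
lemma bracket_eq_chartMulSnd (X Y : GroupLieAlgebra 𝓘(ℝ, E) G) :
    (⁅X, Y⁆ : GroupLieAlgebra 𝓘(ℝ, E) G) =
      (chartMulSnd E G ((X : E), (0 : E)) ((0 : E), (Y : E)) -
        chartMulSnd E G ((Y : E), (0 : E)) ((0 : E), (X : E)) : E) := by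
  let F : E → E → E := fun X => VectorField.mpullbackWithin 𝓘(ℝ, E) 𝓘(ℝ, E) (idChart E G).symm
    (mulInvariantVectorField (X : GroupLieAlgebra 𝓘(ℝ, E) G)) (Set.range 𝓘(ℝ, E))
  -- In the chart the left-invariant field of `X` is the partial derivative of the multiplication in
  -- its second variable, so derivatives of fields become second derivatives of the multiplication.
  have hF : ∀ X : E, F X =ᶠ[𝓝 (idPoint E G)] fun u =>
      fderiv ℝ (chartMul E G) (u, idPoint E G) ((0 : E), X) :=
    fun X => eventually_mpullbackWithin_mulInvariantVectorField (G := G) X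
  have hder : ∀ X Z : E, fderiv ℝ (F X) (idPoint E G) Z = chartMulSnd E G (Z, 0) (0, X) := by
    intro X Z
    rw [(hF X).fderiv_eq]
    have h := (hasFDerivAt_fderiv_apply_comp (f := chartMul E G)
      (s := fun u : E => (u, idPoint E G)) (contDiffAt_chartMul.of_le two_le_infty)
      (hasFDerivAt_prodMk_left (idPoint E G) (idPoint E G))).clm_apply
        (hasFDerivAt_const ((0 : E), X) (idPoint E G))
    rw [h.fderiv]
    simp [chartMulSnd]
  have hval : ∀ X : E, F X (idPoint E G) = X := by
    intro X
    rw [(hF X).self_of_nhds]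
    exact congrArg (fun L : E →L[ℝ] E => L X) fderiv_chartMul_inr
  rw [GroupLieAlgebra.bracket_def, ← VectorField.mlieBracketWithin_univ,
    VectorField.mlieBracketWithin_apply]
  have hself : (mfderiv 𝓘(ℝ, E) 𝓘(ℝ, E) (extChartAt 𝓘(ℝ, E) (1 : G)) 1).inverse =
      ContinuousLinearMap.id ℝ E := by
    rw [mfderiv_extChartAt_self]
    exact ContinuousLinearMap.inverse_id
  have hs : (extChartAt 𝓘(ℝ, E) (1 : G)).symm ⁻¹' Set.univ ∩ Set.range 𝓘(ℝ, E) = Set.univ := by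
    simp
  rw [hs]
  refine (congrArg (fun L : E →L[ℝ] E => L _) hself).trans ?_
  change VectorField.lieBracketWithin ℝ (F X) (F Y) Set.univ (idPoint E G) = _
  have main : ∀ X Y : E, VectorField.lieBracketWithin ℝ (F X) (F Y) Set.univ (idPoint E G) =
      chartMulSnd E G (X, 0) (0, Y) - chartMulSnd E G (Y, 0) (0, X) := fun X Y => by
    rw [VectorField.lieBracketWithin_univ, VectorField.lieBracket, hval, hval, hder, hder]
  exact main X Y

/-! ### The adjoint action -/

lemma eventually_lieAd_idChart_symm :
    ∀ᶠ u in 𝓝 (idPoint E G), lieAd E G ((idChart E G).symm u) =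
      fderiv ℝ (chartConj E G) (u, idPoint E G) ∘L ContinuousLinearMap.inr ℝ E E := by
  filter_upwards [eventually_nhds_idPoint_left eventually_differentiableAt_chartConj] with u hu
  exact (fderiv_comp_prodMk_right hu).fderiv

/-- Conjugation by `g` is differentiable in the chart. -/
lemma hasFDerivAt_conj (g : G) :
    HasFDerivAt (fun v => idChart E G (g * (idChart E G).symm v * g⁻¹)) (lieAd E G g)
      (idPoint E G) := by
  refine DifferentiableAt.hasFDerivAt ?_
  have h1 : ContMDiffAt 𝓘(ℝ, E) 𝓘(ℝ, E) ∞ (fun v : E => g * (idChart E G).symm v * g⁻¹)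
      (idPoint E G) :=
    (contMDiffAt_const.mul (contMDiffAt_idChart_symm idPoint_mem_target)).mul contMDiffAt_const
  have h2 : ContMDiffAt 𝓘(ℝ, E) 𝓘(ℝ, E) ∞
      (fun v => idChart E G (g * (idChart E G).symm v * g⁻¹)) (idPoint E G) := by
    refine ContMDiffAt.comp (idPoint E G) (g := idChart E G) (contMDiffAt_idChart ?_) h1
    rw [idChart_symm_idPoint, mul_one, mul_inv_cancel]
    exact mem_extChartAt_source 1
  exact (contMDiffAt_iff_contDiffAt.1 h2).differentiableAt (by simp)

lemma eventually_conj_mem_source (g : G) :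
    ∀ᶠ v in 𝓝 (idPoint E G), g * (idChart E G).symm v * g⁻¹ ∈ (idChart E G).source := by
  have h1 : ContMDiffAt 𝓘(ℝ, E) 𝓘(ℝ, E) ∞ (fun v : E => g * (idChart E G).symm v * g⁻¹)
      (idPoint E G) :=
    (contMDiffAt_const.mul (contMDiffAt_idChart_symm idPoint_mem_target)).mul contMDiffAt_const
  refine h1.continuousAt.eventually_mem ?_
  rw [idChart_symm_idPoint, mul_one, mul_inv_cancel]
  exact idChart_source_mem_nhds

lemma lieAd_mul (g h : G) : lieAd E G (g * h) = lieAd E G g ∘L lieAd E G h := by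
  refine HasFDerivAt.fderiv ?_
  have hpt : idChart E G (h * (idChart E G).symm (idPoint E G) * h⁻¹) = idPoint E G := by
    rw [idChart_symm_idPoint, mul_one, mul_inv_cancel]
  have hg := hasFDerivAt_conj (E := E) g
  rw [← hpt] at hg
  refine (hg.comp (idPoint E G) (hasFDerivAt_conj h)).congr_of_eventuallyEq ?_
  filter_upwards [eventually_conj_mem_source h] with v hv
  simp only [Function.comp]
  rw [(idChart E G).left_inv hv]
  congr 1
  group

lemma hasFDerivAt_lieAd_idChart_symm :
    HasFDerivAt (fun u => lieAd E G ((idChart E G).symm u))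
      (fderiv ℝ (fun u => lieAd E G ((idChart E G).symm u)) (idPoint E G)) (idPoint E G) := by
  refine DifferentiableAt.hasFDerivAt ?_
  have h := (hasFDerivAt_fderiv_apply_comp (f := chartConj E G)
      (s := fun u : E => (u, idPoint E G)) (contDiffAt_chartConj.of_le two_le_infty)
      (hasFDerivAt_prodMk_left (idPoint E G) (idPoint E G))).clm_comp
        (hasFDerivAt_const (ContinuousLinearMap.inr ℝ E E) (idPoint E G))
  exact (h.congr_of_eventuallyEq eventually_lieAd_idChart_symm).differentiableAt

/-- Differentiability in the chart gives continuity at the identity, and multiplicativity carries it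
to every other point. -/
lemma continuous_lieAd : Continuous (lieAd E G) := by
  have : IsTopologicalGroup G := topologicalGroup_of_lieGroup 𝓘(ℝ, E) ∞
  have h1 : ContinuousAt (lieAd E G) 1 := by
    have hc : ContinuousAt (fun g : G => lieAd E G ((idChart E G).symm (idChart E G g))) 1 :=
      ContinuousAt.comp (g := fun u => lieAd E G ((idChart E G).symm u))
        hasFDerivAt_lieAd_idChart_symm.continuousAt (continuousAt_extChartAt (1 : G))
    refine hc.congr ?_
    filter_upwards [idChart_source_mem_nhds (E := E) (G := G)] with g hg
    rw [(idChart E G).left_inv hg]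
  rw [continuous_iff_continuousAt]
  intro g
  have h2 : ContinuousAt (fun x => lieAd E G g ∘L lieAd E G (g⁻¹ * x)) g := by
    refine ContinuousAt.clm_comp continuousAt_const ?_
    refine ContinuousAt.comp (g := lieAd E G) (by rwa [inv_mul_cancel]) ?_
    fun_prop
  refine h2.congr (Eventually.of_forall fun x => ?_)
  change lieAd E G g ∘L lieAd E G (g⁻¹ * x) = lieAd E G x
  rw [← lieAd_mul, mul_inv_cancel_left]

/-- The identity `g h = (g h g⁻¹) g` is differentiated in `h` at the identity and then in `g`. The
right side yields the derivative of `Ad` plus a mixed second derivative of the multiplication, which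
symmetry turns into the subtracted term. -/
lemma fderiv_lieAd_apply_eq_chartMulSnd (X Y : E) :
    fderiv ℝ (fun u => lieAd E G ((idChart E G).symm u)) (idPoint E G) X Y =
      chartMulSnd E G (X, 0) (0, Y) - chartMulSnd E G (Y, 0) (0, X) := by
  have hev : ∀ᶠ p in 𝓝 (idPoint E G, idPoint E G),
      chartMul E G p = chartMul E G (chartConj E G p, p.1) := by
    have hcont : ContinuousAt (fun p : E × E => (idChart E G).symm p.1 * (idChart E G).symm p.2 *
        ((idChart E G).symm p.1)⁻¹) (idPoint E G, idPoint E G) := by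
      have : IsTopologicalGroup G := topologicalGroup_of_lieGroup 𝓘(ℝ, E) ∞
      have h1 : ContinuousAt (fun p : E × E => (idChart E G).symm p.1)
          (idPoint E G, idPoint E G) :=
        ContinuousAt.comp (g := (idChart E G).symm) continuousAt_idChart_symm continuousAt_fst
      have h2 : ContinuousAt (fun p : E × E => (idChart E G).symm p.2)
          (idPoint E G, idPoint E G) :=
        ContinuousAt.comp (g := (idChart E G).symm) continuousAt_idChart_symm continuousAt_snd
      exact (h1.mul h2).mul h1.inv
    have hmem : ∀ᶠ p in 𝓝 (idPoint E G, idPoint E G), (idChart E G).symm p.1 *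
        (idChart E G).symm p.2 * ((idChart E G).symm p.1)⁻¹ ∈ (idChart E G).source := by
      refine hcont.eventually_mem ?_
      simp only [idChart_symm_idPoint, mul_one, inv_one]
      exact idChart_source_mem_nhds
    filter_upwards [hmem] with p hp
    rw [chartMul, chartMul, chartConj, (idChart E G).left_inv hp, inv_mul_cancel_right]
  have hconj1 : ∀ u : E, chartConj E G (u, idPoint E G) = idPoint E G := fun u => by
    rw [chartConj, idChart_symm_idPoint, mul_one, mul_inv_cancel]
  have hrel : ∀ᶠ u in 𝓝 (idPoint E G),
      fderiv ℝ (chartMul E G) (u, idPoint E G) ((0 : E), (Y : E)) =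
        fderiv ℝ (chartMul E G) (idPoint E G, u) (lieAd E G ((idChart E G).symm u) Y, (0 : E)) := by
    filter_upwards [hev.curry_nhds, eventually_lieAd_idChart_symm (E := E) (G := G),
      eventually_nhds_idPoint_left (eventually_differentiableAt_chartMul (E := E) (G := G)),
      eventually_nhds_idPoint_right (eventually_differentiableAt_chartMul (E := E) (G := G)),
      eventually_nhds_idPoint_left (eventually_differentiableAt_chartConj (E := E) (G := G))]
      with u h1 h2 h3 h4 h5
    have e1 := fderiv_comp_prodMk_right h3
    have e2 := fderiv_comp_prodMk_right h5
    rw [← h2] at e2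
    have e3 : HasFDerivAt (fun w => chartMul E G (w, u))
        (fderiv ℝ (chartMul E G) (idPoint E G, u) ∘L ContinuousLinearMap.inl ℝ E E)
        (chartConj E G (u, idPoint E G)) := by
      rw [hconj1]
      exact fderiv_comp_prodMk_left h4
    have e4 := (HasFDerivAt.comp (g := fun w => chartMul E G (w, u)) (idPoint E G) e3 e2).congr_of_eventuallyEq
      (f₁ := fun w => chartMul E G (u, w)) h1
    have e5 := congrArg (fun L : E →L[ℝ] E => L Y) (e1.unique e4)
    simpa using e5
  have hL := (hasFDerivAt_fderiv_apply_comp (f := chartMul E G)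
      (s := fun u : E => (u, idPoint E G)) (contDiffAt_chartMul.of_le two_le_infty)
      (hasFDerivAt_prodMk_left (idPoint E G) (idPoint E G))).clm_apply
        (hasFDerivAt_const ((0 : E), (Y : E)) (idPoint E G))
  have hA := (hasFDerivAt_lieAd_idChart_symm (E := E) (G := G)).clm_apply
    (hasFDerivAt_const (Y : E) (idPoint E G))
  have hR := (hasFDerivAt_fderiv_apply_comp (f := chartMul E G)
      (s := fun u : E => (idPoint E G, u)) (contDiffAt_chartMul.of_le two_le_infty)
      (hasFDerivAt_prodMk_right (idPoint E G) (idPoint E G))).clm_apply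
        (hA.prodMk (hasFDerivAt_const (0 : E) (idPoint E G)))
  have key := congrArg (fun L : E →L[ℝ] E => L X) (hL.unique (hR.congr_of_eventuallyEq hrel))
  have hid : ∀ Z : E, fderiv ℝ (chartMul E G) (idPoint E G, idPoint E G) (Z, 0) = Z := fun Z =>
    congrArg (fun L : E →L[ℝ] E => L Z) fderiv_chartMul_inl
  rw [chartMulSnd_symm (Y, 0)]
  simp only [idChart_symm_idPoint, lieAd_one, ContinuousLinearMap.comp_zero, zero_add,
    ContinuousLinearMap.flip_apply, ContinuousLinearMap.comp_apply, ContinuousLinearMap.inl_apply,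
    ContinuousLinearMap.inr_apply, ContinuousLinearMap.id_apply, add_apply,
    ContinuousLinearMap.prod_apply, zero_apply, hid] at key
  rw [chartMulSnd, key, add_sub_cancel_right]

/-- The derivative of the adjoint action is the Lie bracket. -/
theorem fderiv_lieAd_apply (X Y : GroupLieAlgebra 𝓘(ℝ, E) G) :
    (fderiv ℝ (fun u => lieAd E G ((idChart E G).symm u)) (idPoint E G) (X : E) (Y : E) : E) =
      (⁅X, Y⁆ : GroupLieAlgebra 𝓘(ℝ, E) G) :=
  (fderiv_lieAd_apply_eq_chartMulSnd (E := E) (G := G) X Y).trans (bracket_eq_chartMulSnd X Y).symm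

end IdChart

/-! ### Continuous homomorphisms into a Banach algebra are differentiable -/

section Smoothness

variable {E : Type*} [NormedAddCommGroup E] [NormedSpace ℝ E]
  {G : Type*} [TopologicalSpace G] [ChartedSpace E G] [Group G] [LieGroup 𝓘(ℝ, E) ∞ G]

lemma contMDiffAt_comp_inv_mul {f : G → ℝ} (hf : ContMDiff 𝓘(ℝ, E) 𝓘(ℝ, ℝ) ∞ f) {u : E}
    (hu : u ∈ (idChart E G).target) (g : G) :
    ContMDiffAt (𝓘(ℝ, E).prod 𝓘(ℝ, E)) 𝓘(ℝ, ℝ) ∞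
      (fun p : G × E => f (((idChart E G).symm p.2)⁻¹ * p.1)) (g, u) := by
  have h1 : ContMDiffAt (𝓘(ℝ, E).prod 𝓘(ℝ, E)) 𝓘(ℝ, E) ∞
      (fun p : G × E => (idChart E G).symm p.2) (g, u) :=
    ContMDiffAt.comp (g, u) (g := (idChart E G).symm) (contMDiffAt_idChart_symm hu)
      contMDiffAt_snd
  exact ContMDiffAt.comp (g, u) (g := f) hf.contMDiffAt (h1.inv.mul contMDiffAt_fst)

/-- Joint continuity supplies, by compactness, the uniform bound needed to differentiate under the
integral sign. -/
lemma continuousAt_fderiv_comp_inv_mul {f : G → ℝ} (hf : ContMDiff 𝓘(ℝ, E) 𝓘(ℝ, ℝ) ∞ f) {u : E}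
    (hu : u ∈ (idChart E G).target) (g : G) :
    ContinuousAt (fun p : G × E => fderiv ℝ (fun v => f (((idChart E G).symm v)⁻¹ * p.1)) p.2)
      (g, u) := by
  have h0 : ContMDiffAt ((𝓘(ℝ, E).prod 𝓘(ℝ, E)).prod 𝓘(ℝ, E)) 𝓘(ℝ, ℝ) ∞
      (Function.uncurry fun (p : G × E) (v : E) => f (((idChart E G).symm v)⁻¹ * p.1))
      ((g, u), u) :=
    ContMDiffAt.comp ((g, u), u) (g := fun p : G × E => f (((idChart E G).symm p.2)⁻¹ * p.1))
      (f := fun q : (G × E) × E => (q.1.1, q.2))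
      (contMDiffAt_comp_inv_mul hf hu g) ((contMDiffAt_fst.comp _ contMDiffAt_fst).prodMk
        contMDiffAt_snd)
  have : IsManifold 𝓘(ℝ, E) 1 G := IsManifold.of_le (n := ∞) (by simp)
  have h1 := ContMDiffAt.mfderiv (m := 0) (x₀ := (g, u)) _ (fun p : G × E => p.2) h0
    contMDiffAt_snd (by simp)
  have h2 := h1.continuousAt
  simp only [mfderiv_eq_fderiv] at h2
  have e := inTangentCoordinates_model_space (I := 𝓘(ℝ, E)) (I' := 𝓘(ℝ, ℝ))
    (fun p : G × E => p.2) (fun p : G × E => f (((idChart E G).symm p.2)⁻¹ * p.1))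
    (fun p : G × E => fderiv ℝ (fun v => f (((idChart E G).symm v)⁻¹ * p.1)) p.2) (g, u)
  exact e ▸ h2

lemma differentiableAt_comp_inv_mul {f : G → ℝ} (hf : ContMDiff 𝓘(ℝ, E) 𝓘(ℝ, ℝ) ∞ f) {u : E}
    (hu : u ∈ (idChart E G).target) (g : G) :
    DifferentiableAt ℝ (fun v => f (((idChart E G).symm v)⁻¹ * g)) u := by
  have h := ContMDiffAt.comp u (g := fun p : G × E => f (((idChart E G).symm p.2)⁻¹ * p.1))
    (f := fun v : E => (g, v)) (contMDiffAt_comp_inv_mul hf hu g)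
    (contMDiffAt_const.prodMk contMDiffAt_id)
  exact (contMDiffAt_iff_contDiffAt.1 h).differentiableAt (by simp)

variable [FiniteDimensional ℝ E] [CompactSpace G]

/-- Convolution with a smooth function makes a continuous function differentiable. -/
lemma differentiableAt_integral_comp_inv_mul {F : Type*} [NormedAddCommGroup F] [NormedSpace ℝ F]
    [MeasurableSpace G] [BorelSpace G] (μ : MeasureTheory.Measure G)
    [MeasureTheory.IsFiniteMeasureOnCompacts μ] {f : G → ℝ} (hf : ContMDiff 𝓘(ℝ, E) 𝓘(ℝ, ℝ) ∞ f)
    {ρ : G → F} (hρ : Continuous ρ) :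
    DifferentiableAt ℝ (fun u => ∫ g, f (((idChart E G).symm u)⁻¹ * g) • ρ g ∂μ)
      (idPoint E G) := by
  have : IsTopologicalGroup G := topologicalGroup_of_lieGroup 𝓘(ℝ, E) ∞
  have hint : ∀ {k : G → F}, Continuous k → MeasureTheory.Integrable k μ := fun hk =>
    hk.integrable_of_hasCompactSupport (HasCompactSupport.of_compactSpace _)
  obtain ⟨ε, hε, hball⟩ := Metric.nhds_basis_closedBall.mem_iff.1
    (idChart_target_mem_nhds (E := E) (G := G))
  let D : G × E → E →L[ℝ] ℝ := fun p =>
    fderiv ℝ (fun v => f (((idChart E G).symm v)⁻¹ * p.1)) p.2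
  have hDc : ContinuousOn D (Set.univ ×ˢ Metric.closedBall (idPoint E G) ε) := fun p hp =>
    (continuousAt_fderiv_comp_inv_mul hf (hball hp.2) p.1).continuousWithinAt
  obtain ⟨K, hK⟩ := ((isCompact_univ (X := G)).prod
    (isCompact_closedBall (idPoint E G) ε)).exists_bound_of_continuousOn hDc
  have hD' : Continuous fun g => (D (g, idPoint E G)).smulRight (ρ g) := by
    have h1 : Continuous fun g => D (g, idPoint E G) :=
      continuous_iff_continuousAt.2 fun g =>
        ContinuousAt.comp (g := D) (f := fun g => (g, idPoint E G))
          (continuousAt_fderiv_comp_inv_mul hf idPoint_mem_target g) (by fun_prop)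
    exact ((ContinuousLinearMap.smulRightL ℝ E F).continuous.comp h1).clm_apply hρ
  have h := hasFDerivAt_integral_of_dominated_of_fderiv_le (μ := μ) (𝕜 := ℝ)
    (F := fun u g => f (((idChart E G).symm u)⁻¹ * g) • ρ g)
    (F' := fun u g => (D (g, u)).smulRight (ρ g)) (x₀ := idPoint E G)
    (bound := fun g => K * ‖ρ g‖) (s := Metric.closedBall (idPoint E G) ε)
    (Metric.closedBall_mem_nhds _ hε)
    (Eventually.of_forall fun u => (hint ((hf.continuous.comp
      (continuous_const.mul continuous_id)).smul hρ)).aestronglyMeasurable)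
    (hint ((hf.continuous.comp (continuous_const.mul continuous_id)).smul hρ))
    (hD'.integrable_of_hasCompactSupport
      (HasCompactSupport.of_compactSpace _)).aestronglyMeasurable
    (Eventually.of_forall fun g u hu => by
      rw [ContinuousLinearMap.norm_smulRight_apply]
      exact mul_le_mul_of_nonneg_right (hK (g, u) ⟨trivial, hu⟩) (norm_nonneg _))
    ((continuous_const.mul hρ.norm).integrable_of_hasCompactSupport
      (HasCompactSupport.of_compactSpace _))
    (Eventually.of_forall fun g u hu =>
      (differentiableAt_comp_inv_mul hf (hball hu) g).hasFDerivAt.smul_const (ρ g))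
  exact h.differentiableAt

/-- A continuous homomorphism from a compact Lie group into a Banach algebra is differentiable at
the identity. -/
theorem differentiableAt_comp_idChart_symm_of_continuous [T2Space G] {𝔸 : Type*} [NormedRing 𝔸]
    [NormedAlgebra ℝ 𝔸] [CompleteSpace 𝔸] {ρ : G → 𝔸} (hρ : Continuous ρ) (h1 : ρ 1 = 1)
    (hmul : ∀ g h, ρ (g * h) = ρ g * ρ h) :
    DifferentiableAt ℝ (fun u => ρ ((idChart E G).symm u)) (idPoint E G) := by
  have : IsTopologicalGroup G := topologicalGroup_of_lieGroup 𝓘(ℝ, E) ∞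
  let _ : MeasurableSpace G := borel G
  have : BorelSpace G := ⟨rfl⟩
  let μ : MeasureTheory.Measure G := MeasureTheory.Measure.haar
  have hs : {g : G | ‖ρ g - 1‖ < 1 / 2} ∈ 𝓝 (1 : G) := by
    refine ContinuousAt.eventually_lt (hρ.sub continuous_const).norm.continuousAt
      continuousAt_const ?_
    rw [h1]; norm_num
  -- The bump lives where `ρ` is within `1 / 2` of `1`, so the average `s⁻¹ • T` is within `1 / 2`
  -- of `1` and `T` is invertible.
  obtain ⟨f, hf1, hfs⟩ := (SmoothBumpFunction.nhds_basis_support (I := 𝓘(ℝ, E)) hs).mem_iff.1 hs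
  have hfd : ContMDiff 𝓘(ℝ, E) 𝓘(ℝ, ℝ) ∞ f := f.contMDiff
  have hint : ∀ {k : G → 𝔸}, Continuous k → MeasureTheory.Integrable k μ := fun hk =>
    hk.integrable_of_hasCompactSupport (HasCompactSupport.of_compactSpace _)
  have hintR : ∀ {k : G → ℝ}, Continuous k → MeasureTheory.Integrable k μ := fun hk =>
    hk.integrable_of_hasCompactSupport (HasCompactSupport.of_compactSpace _)
  have hpos : 0 < ∫ g, f g ∂μ :=
    hfd.continuous.integral_pos_of_hasCompactSupport_nonneg_nonzero (x := 1)
      (HasCompactSupport.of_compactSpace _) (fun g => f.nonneg) (by simp)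
  set s := ∫ g, f g ∂μ with hsdef
  set T := ∫ g, f g • ρ g ∂μ with hT
  have hTs : ‖T - s • (1 : 𝔸)‖ ≤ s * (1 / 2) := by
    have e1 : s • (1 : 𝔸) = ∫ g, f g • (1 : 𝔸) ∂μ := (integral_smul_const _ _).symm
    have e2 := MeasureTheory.integral_sub (f := fun g => f g • ρ g) (g := fun g => f g • (1 : 𝔸))
      (hint (hfd.continuous.smul hρ)) (hint (hfd.continuous.smul continuous_const))
    rw [e1, hT, ← e2, hsdef, ← MeasureTheory.integral_mul_const]
    refine MeasureTheory.norm_integral_le_of_norm_le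
      (hintR (hfd.continuous.mul continuous_const)) (Eventually.of_forall fun g => ?_)
    rw [← smul_sub, norm_smul, Real.norm_of_nonneg f.nonneg]
    by_cases hg : f g = 0
    · simp [hg]
    · exact mul_le_mul_of_nonneg_left (le_of_lt (hfs hg)) f.nonneg
  have hunit : IsUnit T := by
    have hlt : ‖1 - s⁻¹ • T‖ < 1 := by
      have e : 1 - s⁻¹ • T = -(s⁻¹ • (T - s • (1 : 𝔸))) := by
        rw [smul_sub, smul_smul, inv_mul_cancel₀ hpos.ne', one_smul]; abel
      rw [e, norm_neg, norm_smul, Real.norm_of_nonneg (inv_nonneg.2 hpos.le)]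
      calc s⁻¹ * ‖T - s • (1 : 𝔸)‖ ≤ s⁻¹ * (s * (1 / 2)) := by gcongr
        _ = 1 / 2 := by field_simp
        _ < 1 := by norm_num
    have hu : IsUnit (s⁻¹ • T) := by
      have := (Units.oneSub (1 - s⁻¹ • T) hlt).isUnit
      simpa using this
    exact (isUnit_smul_iff (Units.mk0 s⁻¹ (inv_ne_zero hpos.ne')) T).1 hu
  obtain ⟨S, hS⟩ := hunit.exists_right_inv
  -- Left invariance gives `ρ(h) T = ∫ f(h⁻¹ g) ρ(g)`: the dependence on `h` now sits in the smooth
  -- function `f`.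
  have hconv : ∀ h, ρ h = (∫ g, f (h⁻¹ * g) • ρ g ∂μ) * S := by
    intro h
    have e1 : ∫ g, f (h⁻¹ * g) • ρ g ∂μ = ρ h * T := by
      rw [← MeasureTheory.integral_mul_left_eq_self _ h, hT]
      refine Eq.trans ?_ (ContinuousLinearMap.integral_comp_comm
        (ContinuousLinearMap.mul ℝ 𝔸 (ρ h)) (hint (hfd.continuous.smul hρ)))
      refine MeasureTheory.integral_congr_ae (Eventually.of_forall fun g => ?_)
      simp [hmul]
    rw [e1, mul_assoc, hS, mul_one]
  have hfun : (fun u => ρ ((idChart E G).symm u)) =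
      fun u => (∫ g, f (((idChart E G).symm u)⁻¹ * g) • ρ g ∂μ) * S := funext fun u => hconv _
  rw [hfun]
  exact (differentiableAt_integral_comp_inv_mul μ hfd hρ).mul_const S

end Smoothness

/-! ### The derived representation -/

section DerivedRep

variable {E : Type*} [NormedAddCommGroup E] [NormedSpace ℝ E]
  {G : Type*} [TopologicalSpace G] [ChartedSpace E G] [Group G]

/-- The velocity of a curve through the identity, in the chart at the identity. -/
lemma hasDerivAt_idChart_comp {κ : ℝ → G} {t : ℝ} (h1 : κ t = 1)
    (hκ : MDifferentiableAt 𝓘(ℝ, ℝ) 𝓘(ℝ, E) κ t) :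
    HasDerivAt (fun s => idChart E G (κ s))
      (mfderiv 𝓘(ℝ, ℝ) 𝓘(ℝ, E) κ t (1 : ℝ) : E) t := by
  have key : ∀ g : G, κ t = g → HasDerivAt (fun s => extChartAt 𝓘(ℝ, E) g (κ s))
      (mfderiv 𝓘(ℝ, ℝ) 𝓘(ℝ, E) κ t (1 : ℝ) : E) t := by
    rintro g rfl
    have h := hκ.hasMFDerivAt.2
    let L : ℝ →L[ℝ] E := mfderiv 𝓘(ℝ, ℝ) 𝓘(ℝ, E) κ t
    have h' : HasFDerivWithinAt (fun s => extChartAt 𝓘(ℝ, E) (κ t) (κ s)) L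
      (Set.range 𝓘(ℝ, ℝ)) t := h
    rw [modelWithCornersSelf_coe, Set.range_id, hasFDerivWithinAt_univ] at h'
    exact h'.hasDerivAt
  exact key 1 h1

/-- The derived representation in the chart at the identity. -/
noncomputable def UnitaryIrrep.derivCLM (E : Type*) [NormedAddCommGroup E] [NormedSpace ℝ E]
    {G : Type*} [TopologicalSpace G] [ChartedSpace E G] [Group G] (π : UnitaryIrrep G) :
    E →L[ℝ] (π.Space →L[ℂ] π.Space) :=
  fderiv ℝ (fun u => π.op ((idChart E G).symm u)) (idPoint E G)

lemma UnitaryIrrep.inner_op_op (π : UnitaryIrrep G) (g : G) (v w : π.Space) :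
    inner ℂ (π.op g v) (π.op g w) = inner ℂ v w :=
  ((ContinuousLinearMap.inner_map_map_iff_adjoint_comp_self (π.op g)).2
    (Unitary.mem_iff.1 (π.toHom g).2).1) v w

lemma UnitaryIrrep.norm_op_apply (π : UnitaryIrrep G) (g : G) (v : π.Space) :
    ‖π.op g v‖ = ‖v‖ := by
  rw [@norm_eq_sqrt_re_inner ℂ, @norm_eq_sqrt_re_inner ℂ _ _ _ _ v, π.inner_op_op]

lemma UnitaryIrrep.norm_op_le_one (π : UnitaryIrrep G) (g : G) : ‖π.op g‖ ≤ 1 :=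
  ContinuousLinearMap.opNorm_le_bound _ zero_le_one fun v => by rw [π.norm_op_apply, one_mul]

lemma UnitaryIrrep.norm_op_mul (π : UnitaryIrrep G) (g : G) (T : π.Space →L[ℂ] π.Space) :
    ‖π.op g * T‖ ≤ ‖T‖ :=
  (norm_mul_le _ _).trans (mul_le_of_le_one_left (norm_nonneg _) (π.norm_op_le_one g))

variable [LieGroup 𝓘(ℝ, E) ∞ G] [FiniteDimensional ℝ E] [T2Space G] [CompactSpace G]

namespace UnitaryIrrep

variable (π : UnitaryIrrep G)

lemma hasFDerivAt_op_idChart_symm :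
    HasFDerivAt (fun u => π.op ((idChart E G).symm u)) (π.derivCLM E) (idPoint E G) :=
  (differentiableAt_comp_idChart_symm_of_continuous π.continuous_op π.op_one
    π.op_mul).hasFDerivAt

lemma deriv_eq_derivCLM (X : GroupLieAlgebra 𝓘(ℝ, E) G) : π.deriv X = π.derivCLM E (X : E) := by
  have h : MDifferentiableAt 𝓘(ℝ, E) 𝓘(ℝ, π.Space →L[ℂ] π.Space) π.op (1 : G) := by
    refine mdifferentiableAt_iff _ _ |>.2 ⟨π.continuous_op.continuousAt, ?_⟩
    have h1 := (π.hasFDerivAt_op_idChart_symm (E := E)).differentiableAt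
    rw [modelWithCornersSelf_coe, Set.range_id, differentiableWithinAt_univ]
    exact h1
  exact congrArg (fun L : E →L[ℝ] (π.Space →L[ℂ] π.Space) => L X) (mfderiv_one_eq_fderiv h)

/-- The relation `π(g h g⁻¹) = π(g) π(h) π(g)⁻¹` differentiated in `h` at the identity. -/
lemma op_mul_derivCLM (g : G) (X : E) :
    π.op g * π.derivCLM E X = π.derivCLM E (lieAd E G g X) * π.op g := by
  have hpt : idChart E G (g * (idChart E G).symm (idPoint E G) * g⁻¹) = idPoint E G := by
    rw [idChart_symm_idPoint, mul_one, mul_inv_cancel]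
  have h0 := π.hasFDerivAt_op_idChart_symm (E := E)
  have h1 := h0
  rw [← hpt] at h1
  have h2 := h1.comp (idPoint E G) (hasFDerivAt_conj (E := E) g)
  have h3 : HasFDerivAt (fun v => π.op g * π.op ((idChart E G).symm v) * π.op g⁻¹) _
      (idPoint E G) := (h0.const_mul (π.op g)).mul_const' (π.op g⁻¹)
  have h4 := h2.congr_of_eventuallyEq
    (f₁ := fun v => π.op g * π.op ((idChart E G).symm v) * π.op g⁻¹) (by
      filter_upwards [eventually_conj_mem_source (E := E) g] with v hv
      simp only [Function.comp]
      rw [(idChart E G).left_inv hv, π.op_mul, π.op_mul])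
  have h5 := congrArg (fun L : E →L[ℝ] (π.Space →L[ℂ] π.Space) => L X * π.op g) (h3.unique h4)
  have h6 : π.op g⁻¹ * π.op g = 1 := by rw [← π.op_mul, inv_mul_cancel, π.op_one]
  simp only [ContinuousLinearMap.comp_apply] at h5
  rw [← h5]
  change _ = (π.op g * π.derivCLM E X) * π.op g⁻¹ * π.op g
  rw [mul_assoc, h6, mul_one]

/-- One more differentiation of `op_mul_derivCLM`, now in `g` at the identity, where `Ad` has the
bracket as derivative. -/
lemma derivCLM_bracket (X Y : GroupLieAlgebra 𝓘(ℝ, E) G) :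
    π.derivCLM E (⁅X, Y⁆ : GroupLieAlgebra 𝓘(ℝ, E) G) =
      π.derivCLM E X * π.derivCLM E Y - π.derivCLM E Y * π.derivCLM E X := by
  rw [← fderiv_lieAd_apply X Y]
  have main : ∀ X Y : E, π.derivCLM E (fderiv ℝ (fun u => lieAd E G ((idChart E G).symm u))
      (idPoint E G) X Y) = π.derivCLM E X * π.derivCLM E Y - π.derivCLM E Y * π.derivCLM E X := by
    intro X Y
    have h0 := π.hasFDerivAt_op_idChart_symm (E := E)
    have h1 := h0.mul_const' (π.derivCLM E Y)
    have hA := (hasFDerivAt_lieAd_idChart_symm (E := E) (G := G)).clm_apply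
      (hasFDerivAt_const (Y : E) (idPoint E G))
    have h2 := ((π.derivCLM E).hasFDerivAt.comp (idPoint E G) hA).mul' h0
    have h3 := h2.congr_of_eventuallyEq
      (f₁ := fun u => π.op ((idChart E G).symm u) * π.derivCLM E Y)
      (Eventually.of_forall fun u => π.op_mul_derivCLM _ Y)
    have h4 := congrArg (fun L : E →L[ℝ] (π.Space →L[ℂ] π.Space) => L X) (h1.unique h3)
    simp only [Function.comp_apply, idChart_symm_idPoint, lieAd_one, π.op_one] at h4
    simp only [ContinuousLinearMap.comp_zero, zero_add, add_apply, smul_apply,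
      ContinuousLinearMap.comp_apply, ContinuousLinearMap.flip_apply,
      ContinuousLinearMap.id_apply, smul_eq_mul, op_smul_eq_mul, mul_one] at h4
    rw [h4]
    abel
  exact main X Y

lemma inner_derivCLM_left (X : E) (v w : π.Space) :
    inner ℂ (π.derivCLM E X v) w = -inner ℂ v (π.derivCLM E X w) := by
  have h0 := π.hasFDerivAt_op_idChart_symm (E := E)
  have ha : ∀ v : π.Space, HasFDerivAt (fun u => π.op ((idChart E G).symm u) v)
      (((ContinuousLinearMap.apply ℂ π.Space v).restrictScalars ℝ).comp (π.derivCLM E))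
      (idPoint E G) := fun v =>
    ((ContinuousLinearMap.apply ℂ π.Space v).restrictScalars ℝ).hasFDerivAt.comp
      (idPoint E G) h0
  have h1 := (ha v).inner ℂ (ha w)
  have h2 : HasFDerivAt (fun u : E => inner ℂ (π.op ((idChart E G).symm u) v)
      (π.op ((idChart E G).symm u) w)) (0 : E →L[ℝ] ℂ) (idPoint E G) := by
    simp only [π.inner_op_op]
    exact hasFDerivAt_const _ _
  have h3 := congrArg (fun L : E →L[ℝ] ℂ => L X) (h1.unique h2)
  have h1' : π.op ((idChart E G).symm (idPoint E G)) = 1 := by rw [idChart_symm_idPoint, π.op_one]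
  rw [h1'] at h3
  simp [fderivInnerCLM_apply] at h3
  linear_combination h3

/-- The derivative of the representation along a curve. -/
lemma hasDerivAt_op_comp {γ : ℝ → G} (hγ : ContMDiff 𝓘(ℝ, ℝ) 𝓘(ℝ, E) 1 γ) (t : ℝ) :
    HasDerivAt (fun s => π.op (γ s))
      (π.op (γ t) * π.derivCLM E (leftVelocity (E := E) γ t : GroupLieAlgebra 𝓘(ℝ, E) G)) t := by
  have : IsTopologicalGroup G := topologicalGroup_of_lieGroup 𝓘(ℝ, E) ∞
  have hL : LieGroup 𝓘(ℝ, E) 1 G := LieGroup.of_le (n := ∞) (by simp)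
  have hκ : MDifferentiableAt 𝓘(ℝ, ℝ) 𝓘(ℝ, E) (fun s => (γ t)⁻¹ * γ s) t :=
    ((contMDiff_const.mul hγ).mdifferentiable (by simp)) t
  have h1 := hasDerivAt_idChart_comp (E := E) (inv_mul_cancel (γ t)) hκ
  have h2 := π.hasFDerivAt_op_idChart_symm (E := E)
  have hpt : idPoint E G = (fun s => idChart E G ((γ t)⁻¹ * γ s)) t := by
    simp only [inv_mul_cancel]
  rw [hpt] at h2
  have h3 := (h2.comp_hasDerivAt t h1).const_mul (π.op (γ t))
  refine h3.congr_of_eventuallyEq ?_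
  have hc : ContinuousAt (fun s => (γ t)⁻¹ * γ s) t :=
    (continuous_const.mul hγ.continuous).continuousAt
  have hmem := hc.eventually_mem (s := (idChart E G).source) (by
    rw [inv_mul_cancel]; exact idChart_source_mem_nhds)
  filter_upwards [hmem] with s hs
  simp only [Function.comp]
  rw [(idChart E G).left_inv hs, ← π.op_mul, mul_inv_cancel_left]

/-- The representation is Lipschitz for the invariant distance. -/
lemma ofReal_norm_op_sub_le (B : LinearMap.BilinForm ℝ (GroupLieAlgebra 𝓘(ℝ, E) G)) {M : ℝ}
    (hM0 : 0 < M) (hM : ∀ X : GroupLieAlgebra 𝓘(ℝ, E) G,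
      ‖π.derivCLM E (X : E)‖ ≤ M * Real.sqrt (B X X)) (g g' : G) :
    ENNReal.ofReal ‖π.op g - π.op g'‖ ≤ ENNReal.ofReal M * lieDist B g g' := by
  unfold lieDist
  have hM1 : ENNReal.ofReal M ≠ 0 := (ENNReal.ofReal_pos.2 hM0).ne'
  simp only [ENNReal.mul_iInf_of_ne hM1 ENNReal.ofReal_ne_top]
  refine le_iInf fun γ => le_iInf fun hγ => le_iInf fun h0 => le_iInf fun h1 => ?_
  subst h0 h1
  -- A curve of infinite length gives nothing to prove; otherwise finite length provides the
  -- integrability for the fundamental theorem of calculus.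
  by_cases htop : ∫⁻ t in Set.Icc (0 : ℝ) 1,
      ENNReal.ofReal (Real.sqrt (B (leftVelocity γ t) (leftVelocity γ t))) = ⊤
  · rw [htop, ENNReal.mul_top hM1]
    exact le_top
  let ψ' : ℝ → π.Space →L[ℂ] π.Space := fun t =>
    π.op (γ t) * π.derivCLM E (leftVelocity (E := E) γ t : GroupLieAlgebra 𝓘(ℝ, E) G)
  have hψ : ∀ t, HasDerivAt (fun s => π.op (γ s)) (ψ' t) t := π.hasDerivAt_op_comp hγ
  -- Measurability is free because `ψ'` is a derivative; continuity of the velocity is not needed.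
  have hmeas : MeasureTheory.AEStronglyMeasurable ψ'
      (MeasureTheory.volume.restrict (Set.Icc (0 : ℝ) 1)) := by
    have h : ψ' = _root_.deriv (fun s => π.op (γ s)) := funext fun t => (hψ t).deriv.symm
    rw [h]
    exact aestronglyMeasurable_deriv _ _
  have hle : ∫⁻ t in Set.Icc (0 : ℝ) 1, ‖ψ' t‖ₑ ≤ ENNReal.ofReal M *
      ∫⁻ t in Set.Icc (0 : ℝ) 1,
        ENNReal.ofReal (Real.sqrt (B (leftVelocity γ t) (leftVelocity γ t))) := by
    rw [← MeasureTheory.lintegral_const_mul' _ _ ENNReal.ofReal_ne_top]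
    refine MeasureTheory.lintegral_mono fun t => ?_
    rw [← ENNReal.ofReal_mul hM0.le, ← ofReal_norm]
    exact ENNReal.ofReal_le_ofReal ((π.norm_op_mul _ _).trans (hM _))
  have hint : MeasureTheory.IntegrableOn ψ' (Set.Icc (0 : ℝ) 1) :=
    ⟨hmeas, hle.trans_lt (ENNReal.mul_lt_top ENNReal.ofReal_lt_top (lt_top_iff_ne_top.2 htop))⟩
  have hftc := intervalIntegral.integral_eq_sub_of_hasDerivAt (a := 0) (b := 1)
    (fun t _ => hψ t) ((intervalIntegrable_iff_integrableOn_Icc_of_le zero_le_one).2 hint)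
  rw [norm_sub_rev, ← hftc, intervalIntegral.integral_of_le zero_le_one,
    ← MeasureTheory.integral_Icc_eq_integral_Ioc, ofReal_norm]
  exact (MeasureTheory.enorm_integral_le_lintegral_enorm _).trans hle

lemma norm_op_sub_le_of_lieDist_le (B : LinearMap.BilinForm ℝ (GroupLieAlgebra 𝓘(ℝ, E) G))
    {M : ℝ} (hM0 : 0 < M) (hM : ∀ X : GroupLieAlgebra 𝓘(ℝ, E) G,
      ‖π.derivCLM E (X : E)‖ ≤ M * Real.sqrt (B X X)) {g g' : G} {d : ℝ} (hd : 0 ≤ d)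
    (h : lieDist B g g' ≤ ENNReal.ofReal d) : ‖π.op g - π.op g'‖ ≤ M * d := by
  have h1 := (π.ofReal_norm_op_sub_le B hM0 hM g g').trans (mul_le_mul_right h _)
  rw [← ENNReal.ofReal_mul hM0.le] at h1
  exact (ENNReal.ofReal_le_ofReal_iff (mul_nonneg hM0.le hd)).1 h1

end UnitaryIrrep

end DerivedRep

/-! ### Representations with a small derivative are trivial -/

/-- A family of subadditive functions on a compact connected group that is bounded by a family of
constants near the identity is bounded by a fixed multiple of these constants. -/
lemma exists_le_nat_mul_of_subadditive {G ι : Type*} [TopologicalSpace G] [Group G]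
    [IsTopologicalGroup G] [CompactSpace G] [ConnectedSpace G] (f : ι → G → ℝ) (a : ι → ℝ)
    (ha : ∀ i, 0 ≤ a i) (hone : ∀ i, f i 1 = 0) (hmul : ∀ i g h, f i (g * h) ≤ f i g + f i h)
    (hinv : ∀ i g, f i g⁻¹ ≤ f i g) (hU : ∀ᶠ g in 𝓝 (1 : G), ∀ i, f i g ≤ a i) :
    ∃ n : ℕ, ∀ g i, f i g ≤ n * a i := by
  let S : ℕ → Set G := fun n => {g | ∀ i, f i g ≤ n * a i}
  have hmono : Monotone S := fun m n hmn g hg i =>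
    (hg i).trans (mul_le_mul_of_nonneg_right (Nat.cast_le.2 hmn) (ha i))
  have hSmul : ∀ m n, ∀ g ∈ S m, ∀ h ∈ S n, g * h ∈ S (m + n) := fun m n g hg h hh i =>
    (hmul i g h).trans ((add_le_add (hg i) (hh i)).trans (by push_cast; rw [add_mul]))
  have h1 : S 1 ∈ 𝓝 (1 : G) := hU.mono fun g hg i => by simpa using hg i
  -- The points with some bound of this kind form a subgroup containing a neighbourhood of the
  -- identity; it is open and closed, hence everything by connectedness.
  let H : Subgroup G :=
    { carrier := ⋃ n, S n
      mul_mem' := by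
        intro a b ha hb
        obtain ⟨m, hm⟩ := Set.mem_iUnion.1 ha
        obtain ⟨n, hn⟩ := Set.mem_iUnion.1 hb
        exact Set.mem_iUnion.2 ⟨m + n, hSmul m n a hm b hn⟩
      one_mem' := Set.mem_iUnion.2 ⟨0, fun i => by simp [hone]⟩
      inv_mem' := by
        intro a ha
        obtain ⟨m, hm⟩ := Set.mem_iUnion.1 ha
        exact Set.mem_iUnion.2 ⟨m, fun i => (hinv i a).trans (hm i)⟩ }
  have hopen : IsOpen (H : Set G) :=
    H.isOpen_of_mem_nhds (g := 1) (mem_of_superset h1 (Set.subset_iUnion S 1))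
  have htop : (H : Set G) = Set.univ :=
    IsClopen.eq_univ ⟨H.isClosed_of_isOpen hopen, hopen⟩ ⟨1, H.one_mem⟩
  -- A translate of `S 1` by a point of `S n` is a neighbourhood inside `S (n + 1)`, and compactness
  -- then makes `n` uniform.
  have hint : ∀ g : G, ∃ n, S n ∈ 𝓝 g := by
    intro g
    have hg : g ∈ (H : Set G) := by rw [htop]; trivial
    obtain ⟨n, hn⟩ := Set.mem_iUnion.1 hg
    refine ⟨n + 1, ?_⟩
    have hc : Tendsto (fun x => g⁻¹ * x) (𝓝 g) (𝓝 1) := by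
      have := Continuous.tendsto (f := fun x : G => g⁻¹ * x) (by fun_prop) g
      rwa [inv_mul_cancel] at this
    filter_upwards [hc h1] with x hx
    have := hSmul n 1 g hn _ hx
    rwa [mul_inv_cancel_left] at this
  choose n hn using hint
  obtain ⟨t, -, ht⟩ := isCompact_univ.elim_nhds_subcover (fun g => S (n g)) fun g _ => hn g
  refine ⟨t.sup n, fun g i => ?_⟩
  obtain ⟨x, hx, hgx⟩ := Set.mem_iUnion₂.1 (ht (Set.mem_univ g))
  exact hmono (Finset.le_sup (f := n) hx) hgx i

section SmallDerivative

variable {E : Type*} [NormedAddCommGroup E] [NormedSpace ℝ E]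
  {G : Type*} [TopologicalSpace G] [ChartedSpace E G] [Group G]

/-- The left division `g⁻¹ h` in the chart at the identity. -/
noncomputable def chartDiv (E G : Type*) [NormedAddCommGroup E] [NormedSpace ℝ E]
    [TopologicalSpace G] [ChartedSpace E G] [Group G] (p : E × E) : E :=
  idChart E G (((idChart E G).symm p.1)⁻¹ * (idChart E G).symm p.2)

/-- With `a = π(g) - 1` one has `2a = (π(g²) - 1) - a²`. If every `‖a‖ ≤ 1 / 2`, then the supremum
`s` of these norms satisfies `s ≤ (2 / 3) s`, so `π` is trivial. -/
lemma UnitaryIrrep.exists_half_lt_norm_op_sub_one {π : UnitaryIrrep G} (hπ : π.Nontrivial) :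
    ∃ g, 1 / 2 < ‖π.op g - 1‖ := by
  by_contra! hall
  have hbdd : BddAbove (Set.range fun g => ‖π.op g - 1‖) :=
    ⟨1 / 2, by rintro _ ⟨g, rfl⟩; exact hall g⟩
  set s := ⨆ g, ‖π.op g - 1‖ with hs
  have hle : ∀ g, ‖π.op g - 1‖ ≤ 2 / 3 * s := by
    intro g
    have e : (2 : ℝ) • (π.op g - 1) =
        (π.op (g * g) - 1) - (π.op g - 1) * (π.op g - 1) := by
      rw [π.op_mul, two_smul ℝ (π.op g - 1), mul_sub, sub_mul, one_mul, mul_one]; abel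
    have h1 : 2 * ‖π.op g - 1‖ ≤ ‖π.op (g * g) - 1‖ + ‖π.op g - 1‖ * ‖π.op g - 1‖ := by
      have h2 := congrArg norm e
      rw [norm_smul, Real.norm_of_nonneg zero_le_two] at h2
      rw [h2]
      exact (norm_sub_le _ _).trans (add_le_add le_rfl (norm_mul_le _ _))
    have h3 : ‖π.op (g * g) - 1‖ ≤ s := le_ciSup hbdd (g * g)
    nlinarith [norm_nonneg (π.op g - 1), hall g]
  have h4 : s ≤ 2 / 3 * s := ciSup_le hle
  obtain ⟨g, hg⟩ := hπ
  have h5 := hle g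
  have h6 : 0 < ‖π.op g - 1‖ := norm_pos_iff.2 (sub_ne_zero.2 hg)
  linarith

lemma UnitaryIrrep.norm_op_mul_sub_one_le (π : UnitaryIrrep G) (g h : G) :
    ‖π.op (g * h) - 1‖ ≤ ‖π.op g - 1‖ + ‖π.op h - 1‖ := by
  have e : π.op (g * h) - 1 = π.op g * (π.op h - 1) + (π.op g - 1) := by
    rw [π.op_mul, mul_sub, mul_one]; abel
  rw [e, add_comm ‖π.op g - 1‖]
  exact (norm_add_le _ _).trans (add_le_add (π.norm_op_mul _ _) le_rfl)

lemma UnitaryIrrep.norm_op_inv_sub_one_le (π : UnitaryIrrep G) (g : G) :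
    ‖π.op g⁻¹ - 1‖ ≤ ‖π.op g - 1‖ := by
  have e : π.op g⁻¹ - 1 = π.op g⁻¹ * (1 - π.op g) := by
    rw [mul_sub, mul_one, ← π.op_mul, inv_mul_cancel, π.op_one]
  rw [e, norm_sub_rev (π.op g)]
  exact π.norm_op_mul _ _

variable [LieGroup 𝓘(ℝ, E) ∞ G]

lemma contDiffAt_chartDiv : ContDiffAt ℝ ∞ (chartDiv E G) (idPoint E G, idPoint E G) := by
  rw [← contMDiffAt_iff_contDiffAt]
  have h1 : ContMDiffAt 𝓘(ℝ, E × E) 𝓘(ℝ, E) ∞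
      (fun p : E × E => (idChart E G).symm p.1) (idPoint E G, idPoint E G) :=
    ContMDiffAt.comp (idPoint E G, idPoint E G) (g := (idChart E G).symm)
      (contMDiffAt_idChart_symm idPoint_mem_target) contDiff_fst.contMDiff.contMDiffAt
  have h2 : ContMDiffAt 𝓘(ℝ, E × E) 𝓘(ℝ, E) ∞
      (fun p : E × E => (idChart E G).symm p.2) (idPoint E G, idPoint E G) :=
    ContMDiffAt.comp (idPoint E G, idPoint E G) (g := (idChart E G).symm)
      (contMDiffAt_idChart_symm idPoint_mem_target) contDiff_snd.contMDiff.contMDiffAt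
  refine ContMDiffAt.comp (idPoint E G, idPoint E G) (g := idChart E G) ?_ (h1.inv.mul h2)
  apply contMDiffAt_idChart
  change ((idChart E G).symm (idPoint E G))⁻¹ * (idChart E G).symm (idPoint E G) ∈ _
  rw [inv_mul_cancel]
  exact mem_extChartAt_source 1

lemma eventually_div_mem_source : ∀ᶠ p in 𝓝 (idPoint E G, idPoint E G),
    ((idChart E G).symm p.1)⁻¹ * (idChart E G).symm p.2 ∈ (idChart E G).source := by
  have : IsTopologicalGroup G := topologicalGroup_of_lieGroup 𝓘(ℝ, E) ∞
  have h1 : ContinuousAt (fun p : E × E => (idChart E G).symm p.1)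
      (idPoint E G, idPoint E G) :=
    ContinuousAt.comp (g := (idChart E G).symm) continuousAt_idChart_symm continuousAt_fst
  have h2 : ContinuousAt (fun p : E × E => (idChart E G).symm p.2)
      (idPoint E G, idPoint E G) :=
    ContinuousAt.comp (g := (idChart E G).symm) continuousAt_idChart_symm continuousAt_snd
  refine (h1.inv.mul h2).eventually_mem ?_
  change _ ∈ 𝓝 (((idChart E G).symm (idPoint E G))⁻¹ * (idChart E G).symm (idPoint E G))
  rw [inv_mul_cancel]
  exact idChart_source_mem_nhds

variable [FiniteDimensional ℝ E] [T2Space G] [CompactSpace G]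

/-- From `π(h) = π(g) π(g⁻¹ h)`, the derivative near the identity is `dπ` composed with the
derivative `Q` of the division map and a unitary factor. As `Q` and the neighbourhood come from `G`
alone, the estimates are uniform in `π`. -/
lemma exists_eventually_hasFDerivAt_op : ∃ K > (0 : ℝ), ∃ Q : E → E →L[ℝ] E,
    ∀ᶠ u in 𝓝 (idPoint E G), ‖Q u‖ ≤ K ∧ ∀ π : UnitaryIrrep G,
      HasFDerivAt (fun v => π.op ((idChart E G).symm v))
        (π.op ((idChart E G).symm u) • (π.derivCLM E ∘L Q u)) u := by
  have hdiag : Tendsto (fun u : E => (u, u)) (𝓝 (idPoint E G)) (𝓝 (idPoint E G, idPoint E G)) :=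
    Continuous.tendsto (f := fun u : E => (u, u)) (by fun_prop) _
  let Q : E → E →L[ℝ] E := fun u => fderiv ℝ (chartDiv E G) (u, u) ∘L ContinuousLinearMap.inr ℝ E E
  have hQ : ContinuousAt Q (idPoint E G) := by
    have h1 : ContinuousAt (fderiv ℝ (chartDiv E G)) (idPoint E G, idPoint E G) :=
      ((contDiffAt_chartDiv.of_le two_le_infty).fderiv_right (m := 1) (by norm_num)).continuousAt
    exact ContinuousAt.clm_comp (ContinuousAt.comp (g := fderiv ℝ (chartDiv E G))
      (f := fun u : E => (u, u)) h1 hdiag) continuousAt_const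
  refine ⟨‖Q (idPoint E G)‖ + 1, by positivity, Q, ?_⟩
  have hd : ∀ᶠ p in 𝓝 (idPoint E G, idPoint E G), DifferentiableAt ℝ (chartDiv E G) p :=
    ((contDiffAt_chartDiv.of_le two_le_infty).eventually (by decide)).mono fun _ h =>
      h.differentiableAt (by norm_num)
  filter_upwards [hQ.norm.eventually_le_const (lt_add_one _), hdiag.eventually hd,
    hdiag.eventually (eventually_div_mem_source (E := E) (G := G)).eventually_nhds] with u h1 h2 h3
  refine ⟨h1, fun π => ?_⟩
  have e1 : HasFDerivAt (fun w => chartDiv E G (u, w)) (Q u) u := fderiv_comp_prodMk_right h2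
  have e2 := π.hasFDerivAt_op_idChart_symm (E := E)
  have hpt : idPoint E G = chartDiv E G (u, u) := by rw [chartDiv, inv_mul_cancel]
  rw [hpt] at e2
  have e3 := (HasFDerivAt.comp (f := fun w => chartDiv E G (u, w)) u e2 e1).const_mul
    (π.op ((idChart E G).symm u))
  refine e3.congr_of_eventuallyEq ?_
  have h4 := (Continuous.tendsto (f := fun w : E => (u, w)) (by fun_prop) u).eventually h3
  filter_upwards [h4] with w hw
  simp only [Function.comp, chartDiv]
  rw [(idChart E G).left_inv hw, ← π.op_mul, mul_inv_cancel_left]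

lemma exists_nhds_norm_op_sub_one_le : ∃ K > (0 : ℝ), ∀ᶠ g in 𝓝 (1 : G),
    ∀ π : UnitaryIrrep G, ‖π.op g - 1‖ ≤ K * ‖π.derivCLM E‖ := by
  obtain ⟨K, hK, Q, hQ⟩ := exists_eventually_hasFDerivAt_op (E := E) (G := G)
  obtain ⟨ε, hε, hball⟩ := Metric.eventually_nhds_iff_ball.1 hQ
  have hev : ∀ᶠ g in 𝓝 (1 : G), idChart E G g ∈ Metric.ball (idPoint E G) ε :=
    (continuousAt_extChartAt (I := 𝓘(ℝ, E)) (1 : G)).eventually_mem (Metric.ball_mem_nhds _ hε)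
  refine ⟨K * ε, by positivity, ?_⟩
  filter_upwards [hev, idChart_source_mem_nhds (E := E) (G := G)] with g hg hgs π
  have hbound : ∀ u ∈ Metric.ball (idPoint E G) ε,
      ‖π.op ((idChart E G).symm u) • (π.derivCLM E ∘L Q u)‖ ≤ ‖π.derivCLM E‖ * K := by
    intro u hu
    refine ContinuousLinearMap.opNorm_le_bound _ (by positivity) fun X => ?_
    refine (π.norm_op_mul _ _).trans ?_
    rw [mul_assoc]
    exact (π.derivCLM E).le_opNorm_of_le ((Q u).le_of_opNorm_le (hball u hu).1 X)
  have h := (convex_ball (idPoint E G) ε).norm_image_sub_le_of_norm_hasFDerivWithin_le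
    (fun u hu => ((hball u hu).2 π).hasFDerivWithinAt) hbound (Metric.mem_ball_self hε) hg
  simp only [(idChart E G).left_inv hgs, idChart_symm_idPoint, π.op_one] at h
  refine h.trans ?_
  have h' : ‖idChart E G g - idPoint E G‖ ≤ ε := (mem_ball_iff_norm.1 hg).le
  calc _ ≤ ‖π.derivCLM E‖ * K * ε := by gcongr
    _ = _ := by ring

/-- The local bound comes from the mean value inequality. It spreads over the connected compact
group because `g ↦ ‖π(g) - 1‖` is subadditive, with a constant independent of `π`. -/
lemma exists_norm_op_sub_one_le [ConnectedSpace G] : ∃ K > (0 : ℝ), ∀ (g : G)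
    (π : UnitaryIrrep G), ‖π.op g - 1‖ ≤ K * ‖π.derivCLM E‖ := by
  have : IsTopologicalGroup G := topologicalGroup_of_lieGroup 𝓘(ℝ, E) ∞
  obtain ⟨K, hK, hU⟩ := exists_nhds_norm_op_sub_one_le (E := E) (G := G)
  obtain ⟨n, hn⟩ := exists_le_nat_mul_of_subadditive (fun (π : UnitaryIrrep G) g => ‖π.op g - 1‖)
    (fun π => K * ‖π.derivCLM E‖) (fun π => by positivity) (fun π => by rw [π.op_one, sub_self,
      norm_zero]) (fun π => π.norm_op_mul_sub_one_le) (fun π => π.norm_op_inv_sub_one_le) hU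
  refine ⟨(n + 1) * K, by positivity, fun g π => (hn g π).trans ?_⟩
  rw [mul_assoc]
  gcongr
  linarith

/-- The derivative of a nontrivial irreducible representation is bounded below. -/
theorem exists_le_norm_derivCLM [ConnectedSpace G] : ∃ c > (0 : ℝ), ∀ π : UnitaryIrrep G,
    π.Nontrivial → c ≤ ‖π.derivCLM E‖ := by
  obtain ⟨K, hK, h⟩ := exists_norm_op_sub_one_le (E := E) (G := G)
  refine ⟨1 / 2 / K, by positivity, fun π hπ => ?_⟩
  obtain ⟨g, hg⟩ := UnitaryIrrep.exists_half_lt_norm_op_sub_one hπ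
  rw [div_le_iff₀' hK]
  exact hg.le.trans (h g π)

end SmallDerivative

/-! ### Positive definite forms on finite-dimensional spaces -/

section PositiveDefinite

variable {V : Type*} [AddCommGroup V] [Module ℝ V]

/-- The inner product structure of a positive definite form. -/
@[reducible] def innerCoreOfBilin (b : LinearMap.BilinForm ℝ V) (hs : ∀ X Y, b X Y = b Y X)
    (hp : ∀ X, X ≠ 0 → 0 < b X X) : InnerProductSpace.Core ℝ V where
  inner X Y := b X Y
  conj_inner_symm X Y := hs Y X
  re_inner_nonneg X := by
    by_cases h : X = 0
    · simp [h]
    · exact (hp X h).le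
  add_left X Y Z := by simp
  smul_left X Y c := by simp
  definite X h := by
    by_contra hX
    exact (hp X hX).ne' h

lemma sum_bilin_smul_eq_of_orthonormal {ι : Type*} [Fintype ι] [DecidableEq ι]
    (b : LinearMap.BilinForm ℝ V) (e : Module.Basis ι ℝ V)
    (he : ∀ i j, b (e i) (e j) = if i = j then 1 else 0) (X : V) :
    ∑ i, b (e i) X • e i = X := by
  conv_rhs => rw [← e.sum_repr X]
  refine Finset.sum_congr rfl fun i _ => congrArg (· • e i) ?_
  have h := congrArg (b (e i)) (e.sum_repr X)
  rw [← h, map_sum]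
  simp only [map_smul, he, smul_eq_mul, mul_ite, mul_one, mul_zero, Finset.sum_ite_eq,
    Finset.mem_univ, if_true]

/-- The trace of a bilinear map is the same for all orthonormal bases. -/
lemma sum_bilin_orthonormal_eq (b : LinearMap.BilinForm ℝ V) (hs : ∀ X Y, b X Y = b Y X)
    {ι : Type*} [Fintype ι] [DecidableEq ι]
    {F : Type*} [AddCommGroup F] [Module ℝ F] (e f : Module.Basis ι ℝ V)
    (he : ∀ i j, b (e i) (e j) = if i = j then 1 else 0)
    (hf : ∀ i j, b (f i) (f j) = if i = j then 1 else 0) (q : V →ₗ[ℝ] V →ₗ[ℝ] F) :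
    ∑ i, q (e i) (e i) = ∑ i, q (f i) (f i) := by
  have h1 : ∀ X Z, q X Z = ∑ j, b (f j) X • q (f j) Z := fun X Z => by
    have h := congrArg (fun W => q W Z) (sum_bilin_smul_eq_of_orthonormal b f hf X)
    simp only [map_sum, map_smul, LinearMap.sum_apply, LinearMap.smul_apply] at h
    exact h.symm
  have h2 : ∀ X Z, q X Z = ∑ j, b (e j) Z • q X (e j) := fun X Z => by
    have h := congrArg (q X) (sum_bilin_smul_eq_of_orthonormal b e he Z)
    simp only [map_sum, map_smul] at h
    exact h.symm
  calc ∑ i, q (e i) (e i) = ∑ i, ∑ j, b (f j) (e i) • q (f j) (e i) :=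
        Finset.sum_congr rfl fun i _ => h1 _ _
    _ = ∑ j, ∑ i, b (e i) (f j) • q (f j) (e i) := by
        rw [Finset.sum_comm]
        exact Finset.sum_congr rfl fun j _ => Finset.sum_congr rfl fun i _ => by rw [hs]
    _ = ∑ j, q (f j) (f j) := Finset.sum_congr rfl fun j _ => (h2 _ _).symm

variable [FiniteDimensional ℝ V] (b : LinearMap.BilinForm ℝ V)

lemma exists_norm_le_mul_sqrt_bilin (hs : ∀ X Y, b X Y = b Y X) (hp : ∀ X, X ≠ 0 → 0 < b X X)
    {F : Type*} [NormedAddCommGroup F] [NormedSpace ℝ F] (f : V →ₗ[ℝ] F) :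
    ∃ C > (0 : ℝ), ∀ X, ‖f X‖ ≤ C * Real.sqrt (b X X) := by
  let core := innerCoreOfBilin b hs hp
  let _ : NormedAddCommGroup V := core.toNormedAddCommGroup
  let _ : InnerProductSpace ℝ V := InnerProductSpace.ofCore core.toCore
  refine ⟨‖LinearMap.toContinuousLinearMap f‖ + 1, by positivity, fun X => ?_⟩
  have hX : ‖X‖ = Real.sqrt (b X X) := @norm_eq_sqrt_re_inner ℝ V _ _ _ X
  rw [← hX]
  refine ((LinearMap.toContinuousLinearMap f).le_opNorm X).trans ?_
  gcongr
  linarith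

lemma exists_orthonormal_basis_bilin (hs : ∀ X Y, b X Y = b Y X)
    (hp : ∀ X, X ≠ 0 → 0 < b X X) :
    ∃ e : Module.Basis (Fin (Module.finrank ℝ V)) ℝ V,
      ∀ i j, b (e i) (e j) = if i = j then 1 else 0 := by
  let core := innerCoreOfBilin b hs hp
  let _ : NormedAddCommGroup V := core.toNormedAddCommGroup
  let _ : InnerProductSpace ℝ V := InnerProductSpace.ofCore core.toCore
  refine ⟨(stdOrthonormalBasis ℝ V).toBasis, fun i j => ?_⟩
  rw [OrthonormalBasis.coe_toBasis]
  exact orthonormal_iff_ite.1 (stdOrthonormalBasis ℝ V).orthonormal i j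

lemma iSup_iInf_eigenspace_eq_top_bilin (hs : ∀ X Y, b X Y = b Y X)
    (hp : ∀ X, X ≠ 0 → 0 < b X X) {ι : Type*} (T : ι → Module.End ℝ V)
    (hT : ∀ i X Y, b (T i X) Y = b X (T i Y)) (hc : ∀ i j, Commute (T i) (T j)) :
    ⨆ χ : ι → ℝ, ⨅ i, Module.End.eigenspace (T i) (χ i) = ⊤ := by
  let core := innerCoreOfBilin b hs hp
  let _ : NormedAddCommGroup V := core.toNormedAddCommGroup
  let _ : InnerProductSpace ℝ V := InnerProductSpace.ofCore core.toCore
  exact LinearMap.IsSymmetric.iSup_iInf_eq_top_of_commute (fun i X Y => hT i X Y)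
    fun i j _ => hc i j

/-- A commuting family of skew operators on a Euclidean space: the common kernel and the real and
imaginary parts of the root vectors span. -/
lemma span_root_eq_top {T : Type*} [AddCommGroup T] [Module ℝ T]
    (hs : ∀ X Y, b X Y = b Y X) (hp : ∀ X, X ≠ 0 → 0 < b X X) (ad : T →ₗ[ℝ] Module.End ℝ V)
    (hc : ∀ H H' X, ad H (ad H' X) = ad H' (ad H X))
    (hskew : ∀ H X Y, b (ad H X) Y = -b X (ad H Y)) :
    Submodule.span ℝ {X : V | (∀ H, ad H X = 0) ∨ ∃ (Y : V) (α : Module.Dual ℝ T), X ≠ 0 ∧ α ≠ 0 ∧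
      ∀ H, ad H X = -(α H • Y) ∧ ad H Y = α H • X} = ⊤ := by
  -- Products of two commuting skew operators are symmetric and commute with one another, so they
  -- are simultaneously diagonalizable over the reals.
  have htop := iSup_iInf_eigenspace_eq_top_bilin b hs hp (fun p : T × T => ad p.1 * ad p.2)
    (fun p X Y => by simp [hskew, hc]) (fun p q => by
      refine LinearMap.ext fun X => ?_
      simp only [Module.End.mul_apply]
      rw [hc p.2, hc p.2 q.2, hc p.1 q.1, hc p.1 q.2])
  rw [eq_top_iff, ← htop]
  refine iSup_le fun χ X hX => Submodule.subset_span ?_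
  have heig : ∀ H H', ad H (ad H' X) = χ (H, H') • X := fun H H' => by
    have := (Submodule.mem_iInf _).1 hX (H, H')
    exact Module.End.mem_eigenspace_iff.1 this
  by_cases h0 : ∀ H, ad H X = 0
  · exact Or.inl h0
  push Not at h0
  obtain ⟨H₁, hH₁⟩ := h0
  right
  have hX0 : X ≠ 0 := fun h => hH₁ (by rw [h, map_zero])
  -- The square of a skew operator is nonpositive, and `H₁` does not annihilate `X`. In the plane of
  -- `X` and `Y` each `H` acts as an infinitesimal rotation, and `Y` is scaled so that `α H₁ = a`.
  have hneg : χ (H₁, H₁) < 0 := by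
    have h1 := hp _ hH₁
    rw [hskew, heig, map_smul, smul_eq_mul] at h1
    nlinarith [hp X hX0]
  set a := Real.sqrt (-χ (H₁, H₁)) with ha
  have ha0 : 0 < a := Real.sqrt_pos.2 (by linarith)
  have ha2 : a * a = -χ (H₁, H₁) := Real.mul_self_sqrt (by linarith)
  let Y := -(a⁻¹ • ad H₁ X)
  -- The value is `-a⁻¹ * χ (H, H₁)`, written through the form `b` so that linearity in `H` is
  -- visible.
  let α : Module.Dual ℝ T := -(a⁻¹ * (b X X)⁻¹) • ((b X) ∘ₗ (LinearMap.applyₗ (ad H₁ X)) ∘ₗ ad)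
  have hα : ∀ H, α H = -(a⁻¹ * χ (H, H₁)) := fun H => by
    have : b X X ≠ 0 := (hp X hX0).ne'
    simp only [α, LinearMap.smul_apply, LinearMap.comp_apply, LinearMap.applyₗ_apply_apply, heig,
      map_smul, smul_eq_mul]
    field_simp
  have hY : ∀ H, ad H Y = α H • X := fun H => by
    rw [hα]
    simp only [Y, map_neg, map_smul, heig, smul_smul, neg_smul]
  have hX' : ∀ H, ad H X = -(α H • Y) := fun H => by
    have h1 : X = a⁻¹ • ad H₁ Y := by
      rw [hY, hα, smul_smul, ← mul_neg, show -χ (H₁, H₁) = a * a from ha2.symm]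
      rw [show a⁻¹ * (a⁻¹ * (a * a)) = 1 by field_simp, one_smul]
    conv_lhs => rw [h1]
    have h2 : ad H (ad H₁ (ad H₁ X)) = χ (H, H₁) • ad H₁ X := by rw [hc, heig, map_smul]
    simp only [hα, Y, map_neg, map_smul, h2]
    module
  refine ⟨Y, α, hX0, fun h => ?_, fun H => ⟨hX' H, hY H⟩⟩
  apply hH₁
  rw [hX' H₁, h, LinearMap.zero_apply, zero_smul, neg_zero]

end PositiveDefinite

/-! ### The invariant inner product and the root decomposition -/

section InvariantForm

variable {E : Type*} [NormedAddCommGroup E] [NormedSpace ℝ E] [FiniteDimensional ℝ E]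

/-- A bilinear form on a finite-dimensional space as a continuous bilinear map. -/
lemma exists_continuous_bilin (B : LinearMap.BilinForm ℝ E) :
    ∃ β : E →L[ℝ] E →L[ℝ] ℝ, ∀ X Y, β X Y = B X Y :=
  ⟨LinearMap.toContinuousLinearMap
    ((LinearMap.toContinuousLinearMap : (E →ₗ[ℝ] ℝ) ≃ₗ[ℝ] E →L[ℝ] ℝ).toLinearMap ∘ₗ B),
    fun _ _ => rfl⟩

variable {G : Type*} [TopologicalSpace G] [ChartedSpace E G] [Group G] [LieGroup 𝓘(ℝ, E) ∞ G]

/-- Averaging over the group makes an inner product invariant under the adjoint action. -/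
theorem exists_invariant_bilin (G : Type*) [TopologicalSpace G] [ChartedSpace E G] [Group G]
    [LieGroup 𝓘(ℝ, E) ∞ G] [CompactSpace G] (B : LinearMap.BilinForm ℝ E)
    (hs : ∀ X Y, B X Y = B Y X) (hp : ∀ X, X ≠ 0 → 0 < B X X) :
    ∃ B' : LinearMap.BilinForm ℝ E, (∀ X Y, B' X Y = B' Y X) ∧ (∀ X, X ≠ 0 → 0 < B' X X) ∧
      ∀ (g : G) X Y, B' (lieAd E G g X) (lieAd E G g Y) = B' X Y := by
  have : IsTopologicalGroup G := topologicalGroup_of_lieGroup 𝓘(ℝ, E) ∞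
  let _ : MeasurableSpace G := borel G
  have : BorelSpace G := ⟨rfl⟩
  let μ : MeasureTheory.Measure G := MeasureTheory.Measure.haar
  obtain ⟨β, hβ⟩ := exists_continuous_bilin B
  -- The inverse `g⁻¹` makes left invariance of Haar measure the relevant one.
  let F : E → E → G → ℝ := fun X Y g => β (lieAd E G g⁻¹ X) (lieAd E G g⁻¹ Y)
  have hA : ∀ X, Continuous fun g : G => lieAd E G g⁻¹ X := fun X =>
    (continuous_lieAd.comp continuous_inv).clm_apply continuous_const
  have hF : ∀ X Y, Continuous (F X Y) := fun X Y =>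
    (β.continuous.comp (hA X)).clm_apply (hA Y)
  have hint : ∀ X Y, MeasureTheory.Integrable (F X Y) μ := fun X Y =>
    (hF X Y).integrable_of_hasCompactSupport (HasCompactSupport.of_compactSpace _)
  let B' : LinearMap.BilinForm ℝ E := LinearMap.mk₂ ℝ (fun X Y => ∫ g, F X Y g ∂μ)
    (fun X X' Y => by
      rw [← MeasureTheory.integral_add (hint _ _) (hint _ _)]
      simp [F])
    (fun c X Y => by
      rw [smul_eq_mul, ← MeasureTheory.integral_const_mul]
      simp [F])
    (fun X Y Y' => by
      rw [← MeasureTheory.integral_add (hint _ _) (hint _ _)]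
      simp [F])
    (fun c X Y => by
      rw [smul_eq_mul, ← MeasureTheory.integral_const_mul]
      simp [F])
  have hnn : ∀ X, 0 ≤ B X X := fun X => by
    by_cases h : X = 0
    · simp [h]
    · exact (hp X h).le
  refine ⟨B', fun X Y => ?_, fun X hX => ?_, fun g X Y => ?_⟩
  · refine MeasureTheory.integral_congr_ae (Eventually.of_forall fun g => ?_)
    simp only [F, hβ]
    exact hs _ _
  · refine (hF X X).integral_pos_of_hasCompactSupport_nonneg_nonzero (x := 1)
      (HasCompactSupport.of_compactSpace _) (fun g => ?_) ?_
    · simp only [F, hβ]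
      exact hnn _
    · simp only [F, hβ, inv_one, lieAd_one, ContinuousLinearMap.id_apply]
      exact (hp X hX).ne'
  · change ∫ h, F (lieAd E G g X) (lieAd E G g Y) h ∂μ = ∫ h, F X Y h ∂μ
    rw [← MeasureTheory.integral_mul_left_eq_self _ g]
    refine MeasureTheory.integral_congr_ae (Eventually.of_forall fun h => ?_)
    have e : ∀ Z, lieAd E G (g * h)⁻¹ (lieAd E G g Z) = lieAd E G h⁻¹ Z := fun Z => by
      rw [← ContinuousLinearMap.comp_apply, ← lieAd_mul, mul_inv_rev, inv_mul_cancel_right]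
    simp only [F, e]

lemma bilin_fderiv_lieAd_skew {B' : LinearMap.BilinForm ℝ E}
    (hinv : ∀ (g : G) X Y, B' (lieAd E G g X) (lieAd E G g Y) = B' X Y) (H X Y : E) :
    B' (fderiv ℝ (fun u => lieAd E G ((idChart E G).symm u)) (idPoint E G) H X) Y =
      -B' X (fderiv ℝ (fun u => lieAd E G ((idChart E G).symm u)) (idPoint E G) H Y) := by
  obtain ⟨β, hβ⟩ := exists_continuous_bilin B'
  have hA : ∀ X : E, HasFDerivAt (fun u => lieAd E G ((idChart E G).symm u) X)
      ((fderiv ℝ (fun u => lieAd E G ((idChart E G).symm u)) (idPoint E G)).flip X)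
      (idPoint E G) := fun X => by
    simpa using (hasFDerivAt_lieAd_idChart_symm (E := E) (G := G)).clm_apply
      (hasFDerivAt_const X (idPoint E G))
  have h1 := (β.hasFDerivAt.comp (idPoint E G) (hA X)).clm_apply (hA Y)
  have h2 : HasFDerivAt (fun u : E => β (lieAd E G ((idChart E G).symm u) X)
      (lieAd E G ((idChart E G).symm u) Y)) (0 : E →L[ℝ] ℝ) (idPoint E G) := by
    simp only [hβ, hinv]
    exact hasFDerivAt_const _ _
  have h3 := congrArg (fun L : E →L[ℝ] ℝ => L H) (h1.unique h2)
  simp only [Function.comp_apply, idChart_symm_idPoint, lieAd_one, add_apply, zero_apply,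
    ContinuousLinearMap.comp_apply, ContinuousLinearMap.flip_apply,
    ContinuousLinearMap.id_apply, hβ] at h3
  linarith

/-- The Lie algebra of a compact Lie group carries an inner product for which the adjoint action is
orthogonal and the brackets are skew. -/
theorem exists_invariant_innerProduct [CompactSpace G]
    (B : LinearMap.BilinForm ℝ (GroupLieAlgebra 𝓘(ℝ, E) G)) (hB : IsInnerProduct B) :
    ∃ B' : LinearMap.BilinForm ℝ (GroupLieAlgebra 𝓘(ℝ, E) G), IsInnerProduct B' ∧
      (∀ (g : G) (X Y : E), (B' : LinearMap.BilinForm ℝ E) (lieAd E G g X) (lieAd E G g Y) =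
        (B' : LinearMap.BilinForm ℝ E) X Y) ∧
      ∀ H X Y : GroupLieAlgebra 𝓘(ℝ, E) G, B' ⁅H, X⁆ Y = -B' X ⁅H, Y⁆ := by
  let B₁ : LinearMap.BilinForm ℝ E := B
  obtain ⟨B', h1, h2, h3⟩ := exists_invariant_bilin G B₁ hB.1 hB.2
  refine ⟨B', ⟨h1, h2⟩, h3, fun H X Y => ?_⟩
  rw [← fderiv_lieAd_apply H X, ← fderiv_lieAd_apply H Y]
  exact bilin_fderiv_lieAd_skew h3 H X Y

/-- The real and imaginary parts of the positive root vectors together with a maximal abelian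
subalgebra span the Lie algebra. -/
theorem span_positive_root_eq_top [CompactSpace G]
    (B : LinearMap.BilinForm ℝ (GroupLieAlgebra 𝓘(ℝ, E) G)) (hB : IsInnerProduct B)
    (𝔱 : Submodule ℝ (GroupLieAlgebra 𝓘(ℝ, E) G)) (h𝔱 : IsMaximalAbelian 𝔱)
    (H₀ : 𝔱) (hH₀ : IsRegularElement 𝔱 H₀) :
    Submodule.span ℝ {X : GroupLieAlgebra 𝓘(ℝ, E) G | X ∈ 𝔱 ∨
      ∃ (Y : GroupLieAlgebra 𝓘(ℝ, E) G) (α : Module.Dual ℝ 𝔱), ⁅X, Y⁆ ∈ 𝔱 ∧ IsRoot 𝔱 α ∧ 0 < α H₀ ∧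
        ∀ H : 𝔱, ⁅(H : GroupLieAlgebra 𝓘(ℝ, E) G), X⁆ = -(α H • Y) ∧
          ⁅(H : GroupLieAlgebra 𝓘(ℝ, E) G), Y⁆ = α H • X} = ⊤ := by
  have : CompleteSpace E := FiniteDimensional.complete ℝ E
  have : FiniteDimensional ℝ (GroupLieAlgebra 𝓘(ℝ, E) G) := inferInstanceAs (FiniteDimensional ℝ E)
  obtain ⟨B', hB', -, hskew⟩ := exists_invariant_innerProduct B hB
  let ad : 𝔱 →ₗ[ℝ] Module.End ℝ (GroupLieAlgebra 𝓘(ℝ, E) G) :=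
    LinearMap.mk₂ ℝ (fun H X => ⁅(H : GroupLieAlgebra 𝓘(ℝ, E) G), X⁆)
      (fun H H' X => add_lie (H : GroupLieAlgebra 𝓘(ℝ, E) G) H' X)
      (fun c H X => smul_lie c (H : GroupLieAlgebra 𝓘(ℝ, E) G) X)
      (fun H X Y => lie_add (H : GroupLieAlgebra 𝓘(ℝ, E) G) X Y)
      (fun c H X => lie_smul c (H : GroupLieAlgebra 𝓘(ℝ, E) G) X)
  have had : ∀ (H : 𝔱) X, ad H X = ⁅(H : GroupLieAlgebra 𝓘(ℝ, E) G), X⁆ := fun H X => rfl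
  have h := span_root_eq_top B' hB'.1 hB'.2 ad (fun H H' X => by
    simp only [had]
    rw [leibniz_lie, h𝔱.1 H H.2 H' H'.2, zero_lie, zero_add]) (fun H X Y => hskew H X Y)
  rw [eq_top_iff, ← h]
  refine Submodule.span_mono ?_
  rintro X (hX | ⟨Y, α, hX0, hα, hXY⟩)
  · exact Or.inl (h𝔱.2 X fun H hH => hX ⟨H, hH⟩)
  right
  simp only [had] at hXY
  -- By the Jacobi identity `⁅X, Y⁆` commutes with `𝔱`, so maximality applies.
  have hbr : ⁅X, Y⁆ ∈ 𝔱 := by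
    refine h𝔱.2 _ fun H hH => ?_
    rw [leibniz_lie, (hXY ⟨H, hH⟩).1, (hXY ⟨H, hH⟩).2, neg_lie, smul_lie, lie_smul, lie_self,
      lie_self, smul_zero, neg_zero, add_zero]
  have hroot : IsRoot 𝔱 α := ⟨hα, X, Y, Or.inl hX0, hXY⟩
  have hXY' : ∀ H : 𝔱, ⁅(H : GroupLieAlgebra 𝓘(ℝ, E) G), X⁆ = -((-α) H • -Y) ∧
      ⁅(H : GroupLieAlgebra 𝓘(ℝ, E) G), -Y⁆ = (-α) H • X := fun H => by
    rw [lie_neg, (hXY H).1, (hXY H).2, LinearMap.neg_apply, neg_smul, neg_smul, smul_neg, neg_neg]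
    exact ⟨rfl, rfl⟩
  -- If the root is negative, complex conjugation, which sends `(Y, α)` to `(-Y, -α)`, makes it
  -- positive without changing `X`.
  rcases lt_or_gt_of_ne (hH₀ α hroot) with hlt | hgt
  · refine ⟨-Y, -α, ?_, ⟨neg_ne_zero.2 hα, X, -Y, Or.inl hX0, hXY'⟩, by simpa using hlt, hXY'⟩
    rw [lie_neg]
    exact 𝔱.neg_mem hbr
  · exact ⟨Y, α, hbr, hroot, hgt, hXY⟩

end InvariantForm

/-! ### Highest weight vectors and the Casimir operator -/

section HighestWeight

variable {E : Type*} [NormedAddCommGroup E] [NormedSpace ℝ E]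
  {G : Type*} [TopologicalSpace G] [ChartedSpace E G] [Group G]

lemma weightNorm_nonneg (B : LinearMap.BilinForm ℝ (GroupLieAlgebra 𝓘(ℝ, E) G))
    (𝔱 : Submodule ℝ (GroupLieAlgebra 𝓘(ℝ, E) G)) (μ : Module.Dual ℝ 𝔱) :
    0 ≤ weightNorm B 𝔱 μ :=
  Real.sSup_nonneg (by rintro _ ⟨X, -, rfl⟩; exact abs_nonneg _)

lemma nonneg_of_mem_closure_positive {𝔱 : Submodule ℝ (GroupLieAlgebra 𝓘(ℝ, E) G)} {H₀ : 𝔱}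
    {μ : Module.Dual ℝ 𝔱}
    (h : μ ∈ AddSubmonoid.closure {α : Module.Dual ℝ 𝔱 | IsRoot 𝔱 α ∧ 0 < α H₀}) : 0 ≤ μ H₀ := by
  induction h using AddSubmonoid.closure_induction with
  | mem α h => exact h.2.le
  | zero => simp
  | add α β _ _ h1 h2 => simpa using add_nonneg h1 h2

variable [FiniteDimensional ℝ E]

lemma abs_le_weightNorm_mul_sqrt {B : LinearMap.BilinForm ℝ (GroupLieAlgebra 𝓘(ℝ, E) G)}
    (hB : IsInnerProduct B) (𝔱 : Submodule ℝ (GroupLieAlgebra 𝓘(ℝ, E) G))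
    (μ : Module.Dual ℝ 𝔱) (X : 𝔱) :
    |μ X| ≤ weightNorm B 𝔱 μ * Real.sqrt (B X X) := by
  have : FiniteDimensional ℝ (GroupLieAlgebra 𝓘(ℝ, E) G) := inferInstanceAs (FiniteDimensional ℝ E)
  let b : LinearMap.BilinForm ℝ 𝔱 := B.compl₁₂ 𝔱.subtype 𝔱.subtype
  have hb : ∀ X Y : 𝔱, b X Y = B X Y := fun _ _ => rfl
  obtain ⟨C, hC, hle⟩ := exists_norm_le_mul_sqrt_bilin b (fun X Y => hB.1 X Y)
    (fun X hX => hB.2 X fun h => hX (Subtype.ext h)) μ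
  have hbdd : BddAbove {c : ℝ | ∃ X : 𝔱, B X X ≤ 1 ∧ c = |μ X|} := by
    refine ⟨C, ?_⟩
    rintro _ ⟨Y, hY, rfl⟩
    refine (hle Y).trans (mul_le_of_le_one_right hC.le ?_)
    rw [hb]
    exact Real.sqrt_le_one.2 hY
  by_cases hX : X = 0
  · simp [hX]
  have hpos : 0 < B X X := hB.2 X fun h => hX (Subtype.ext h)
  set s := Real.sqrt (B X X) with hs
  have hs0 : 0 < s := Real.sqrt_pos.2 hpos
  have hss : s * s = B X X := Real.mul_self_sqrt hpos.le
  have h1 : |μ (s⁻¹ • X)| ≤ weightNorm B 𝔱 μ := by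
    refine le_csSup hbdd ⟨s⁻¹ • X, le_of_eq ?_, rfl⟩
    rw [Submodule.coe_smul, map_smul, map_smul, LinearMap.smul_apply, ← hss, smul_eq_mul,
      smul_eq_mul]
    field_simp
  rw [map_smul, smul_eq_mul, abs_mul, abs_of_pos (inv_pos.2 hs0), inv_mul_le_iff₀ hs0] at h1
  linarith

variable [LieGroup 𝓘(ℝ, E) ∞ G] [T2Space G] [CompactSpace G]

namespace UnitaryIrrep

variable (π : UnitaryIrrep G)

lemma derivCLM_bracket_apply (X Y : GroupLieAlgebra 𝓘(ℝ, E) G) (v : π.Space) :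
    π.deriv ⁅X, Y⁆ v = π.deriv X (π.deriv Y v) - π.deriv Y (π.deriv X v) := by
  rw [π.deriv_eq_derivCLM, π.deriv_eq_derivCLM, π.deriv_eq_derivCLM, π.derivCLM_bracket]
  rfl

lemma inner_deriv_left (X : GroupLieAlgebra 𝓘(ℝ, E) G) (v w : π.Space) :
    inner ℂ (π.deriv X v) w = -inner ℂ v (π.deriv X w) := by
  rw [π.deriv_eq_derivCLM]
  exact π.inner_derivCLM_left _ v w

lemma deriv_smul_apply (c : ℝ) (X : GroupLieAlgebra 𝓘(ℝ, E) G) (v : π.Space) :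
    π.deriv (c • X) v = (c : ℂ) • π.deriv X v := by
  have main : ∀ X : E, π.derivCLM E (c • X) v = (c : ℂ) • π.derivCLM E X v := fun X => by
    rw [map_smul]
    rfl
  rw [π.deriv_eq_derivCLM, π.deriv_eq_derivCLM]
  exact main X

lemma deriv_add_apply (X Y : GroupLieAlgebra 𝓘(ℝ, E) G) (v : π.Space) :
    π.deriv (X + Y) v = π.deriv X v + π.deriv Y v := by
  have main : ∀ X Y : E, π.derivCLM E (X + Y) v = π.derivCLM E X v + π.derivCLM E Y v :=
    fun X Y => by
      rw [map_add]
      rfl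
  rw [π.deriv_eq_derivCLM, π.deriv_eq_derivCLM, π.deriv_eq_derivCLM]
  exact main X Y

variable {π}

/-- A positive root vector annihilates a highest weight vector. -/
lemma deriv_add_I_smul_deriv_eq_zero {𝔱 : Submodule ℝ (GroupLieAlgebra 𝓘(ℝ, E) G)} {H₀ : 𝔱}
    {ℓ α : Module.Dual ℝ 𝔱} (hℓ : ∀ μ, IsWeight 𝔱 π μ →
      ℓ - μ ∈ AddSubmonoid.closure {α : Module.Dual ℝ 𝔱 | IsRoot 𝔱 α ∧ 0 < α H₀})
    {v : π.Space} (hv : ∀ X : 𝔱, π.deriv (X : GroupLieAlgebra 𝓘(ℝ, E) G) v =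
      (Complex.I * (ℓ X : ℂ)) • v) (hα : 0 < α H₀) {X Y : GroupLieAlgebra 𝓘(ℝ, E) G}
    (hXY : ∀ H : 𝔱, ⁅(H : GroupLieAlgebra 𝓘(ℝ, E) G), X⁆ = -(α H • Y) ∧
      ⁅(H : GroupLieAlgebra 𝓘(ℝ, E) G), Y⁆ = α H • X) :
    π.deriv X v + Complex.I • π.deriv Y v = 0 := by
  by_contra hw
  -- A nonzero vector here would have weight `ℓ + α`; then `-α` would be a sum of positive roots,
  -- contradicting `0 < α H₀`.
  have hwt : IsWeight 𝔱 π (ℓ + α) := by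
    refine ⟨_, hw, fun H => ?_⟩
    have e1 := π.derivCLM_bracket_apply (H : GroupLieAlgebra 𝓘(ℝ, E) G) X v
    have e2 := π.derivCLM_bracket_apply (H : GroupLieAlgebra 𝓘(ℝ, E) G) Y v
    rw [(hXY H).1, ← neg_smul, π.deriv_smul_apply, hv, map_smul] at e1
    rw [(hXY H).2, π.deriv_smul_apply, hv, map_smul] at e2
    rw [map_add, map_smul, sub_eq_iff_eq_add.1 e1.symm, sub_eq_iff_eq_add.1 e2.symm,
      LinearMap.add_apply]
    push_cast
    match_scalars
    · linear_combination (-(α H : ℂ)) * Complex.I_mul_I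
    · ring
  have h1 := nonneg_of_mem_closure_positive (hℓ _ hwt)
  simp at h1
  linarith

/-- The action of the real part of a positive root vector on a highest weight vector. -/
lemma norm_deriv_sq_of_root {c : ℝ} {v : π.Space} {X Y : GroupLieAlgebra 𝓘(ℝ, E) G}
    (hv : π.deriv ⁅X, Y⁆ v = (Complex.I * (c : ℂ)) • v)
    (h0 : π.deriv X v + Complex.I • π.deriv Y v = 0) :
    ‖π.deriv X v‖ ^ 2 = - c / 2 * ‖v‖ ^ 2 := by
  rw [π.derivCLM_bracket_apply] at hv
  have hX : π.deriv X v = -(Complex.I • π.deriv Y v) := eq_neg_of_add_eq_zero_left h0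
  have e0 : inner ℂ (π.deriv X v) (π.deriv X v) = ((‖π.deriv X v‖ : ℂ)) ^ 2 :=
    inner_self_eq_norm_sq_to_K _
  have e1 : inner ℂ (π.deriv X v) (π.deriv X v) =
      Complex.I * inner ℂ v (π.deriv X (π.deriv Y v)) := by
    have h := congrArg (inner ℂ (π.deriv X v)) hX
    rw [inner_neg_right, inner_smul_right, π.inner_deriv_left X v (π.deriv Y v)] at h
    rw [h]
    ring
  have e2 : inner ℂ (π.deriv X v) (π.deriv X v) =
      -(Complex.I * inner ℂ v (π.deriv Y (π.deriv X v))) := by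
    have h := congrArg (fun w => inner ℂ w (π.deriv X v)) hX
    simp only [inner_neg_left, inner_smul_left, Complex.conj_I] at h
    rw [π.inner_deriv_left Y v (π.deriv X v)] at h
    rw [h]
    ring
  have e3 : inner ℂ v (π.deriv X (π.deriv Y v)) - inner ℂ v (π.deriv Y (π.deriv X v)) = 
      Complex.I * c * (‖v‖ : ℂ) ^ 2 := by
    rw [← inner_sub_right, hv, inner_smul_right, inner_self_eq_norm_sq_to_K]
    rfl
  -- `e1` and `e2` evaluate the same square by rewriting one factor or the other; their sum is `i`
  -- times the commutator in `e3`.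
  have e4 : (2 : ℂ) * (‖π.deriv X v‖ : ℂ) ^ 2 = -c * (‖v‖ : ℂ) ^ 2 := by
    linear_combination (-2) * e0 + e1 + e2 + Complex.I * e3 + c * ‖v‖ ^ 2 * Complex.I_mul_I
  have e5 : 2 * ‖π.deriv X v‖ ^ 2 = -c * ‖v‖ ^ 2 := by exact_mod_cast e4
  linarith

/-- The Casimir operator of an irreducible representation is a scalar. -/
lemma exists_sum_norm_derivCLM_sq_eq (π : UnitaryIrrep G) {ι : Type*} [Fintype ι] [DecidableEq ι]
    {B' : LinearMap.BilinForm ℝ E} (hs : ∀ X Y, B' X Y = B' Y X)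
    (hinv : ∀ (g : G) X Y, B' (lieAd E G g X) (lieAd E G g Y) = B' X Y) (e : Module.Basis ι ℝ E)
    (he : ∀ i j, B' (e i) (e j) = if i = j then 1 else 0) :
    ∃ z : ℝ, ∀ w : π.Space, ∑ i, ‖π.derivCLM E (e i) w‖ ^ 2 = z * ‖w‖ ^ 2 := by
  let q : E →ₗ[ℝ] E →ₗ[ℝ] (π.Space →L[ℂ] π.Space) :=
    (LinearMap.mul ℝ (π.Space →L[ℂ] π.Space)).compl₁₂ (π.derivCLM E : E →ₗ[ℝ] _)
      (π.derivCLM E : E →ₗ[ℝ] _)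
  let S : π.Space →L[ℂ] π.Space := ∑ i, q (e i) (e i)
  have hcomm : ∀ g, π.op g * S = S * π.op g := by
    intro g
    have hl : ∀ g : G, (lieAd E G g : E →ₗ[ℝ] E) ∘ₗ (lieAd E G g⁻¹ : E →ₗ[ℝ] E) =
        LinearMap.id := fun g => by
      have h := lieAd_mul (E := E) g g⁻¹
      rw [mul_inv_cancel, lieAd_one] at h
      exact LinearMap.ext fun X => (congrArg (fun L : E →L[ℝ] E => L X) h).symm
    let a : E ≃ₗ[ℝ] E := LinearEquiv.ofLinearMap (lieAd E G g : E →ₗ[ℝ] E)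
      (lieAd E G g⁻¹ : E →ₗ[ℝ] E) (hl g) (by simpa using hl g⁻¹)
    have ha : ∀ X, a X = lieAd E G g X := fun _ => rfl
    -- `Ad(g)` carries an orthonormal basis of the invariant form to another one, and the sum does
    -- not depend on the basis.
    have h1 : S = ∑ i, q (a (e i)) (a (e i)) := by
      have := sum_bilin_orthonormal_eq B' hs e (e.map a) he (fun i j => by
        simp only [Module.Basis.map_apply, ha, hinv, he]) q
      simpa only [Module.Basis.map_apply] using this
    conv_rhs => rw [h1]
    rw [Finset.mul_sum, Finset.sum_mul]
    refine Finset.sum_congr rfl fun i _ => ?_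
    change π.op g * (π.derivCLM E (e i) * π.derivCLM E (e i)) =
      π.derivCLM E (lieAd E G g (e i)) * π.derivCLM E (lieAd E G g (e i)) * π.op g
    rw [← mul_assoc, π.op_mul_derivCLM, mul_assoc, π.op_mul_derivCLM, mul_assoc]
  have : Nonempty (Fin π.dim) := ⟨⟨0, π.dim_pos⟩⟩
  obtain ⟨c, hc⟩ := Module.End.exists_eigenvalue (S : π.Space →ₗ[ℂ] π.Space)
  -- Schur's lemma: an eigenspace of an operator commuting with `π` is invariant, hence the whole
  -- space.
  have htop : Module.End.eigenspace (S : π.Space →ₗ[ℂ] π.Space) c = ⊤ := by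
    refine (π.irreducible _ fun g v hv => ?_).resolve_left hc
    rw [Module.End.mem_eigenspace_iff] at hv ⊢
    have h := congrArg (fun L : π.Space →L[ℂ] π.Space => L v) (hcomm g)
    have hv' : S v = c • v := hv
    change S (π.op g v) = c • π.op g v
    rw [← map_smul, ← hv']
    exact h.symm
  refine ⟨-c.re, fun w => ?_⟩
  have hw : S w = c • w := by
    have : w ∈ Module.End.eigenspace (S : π.Space →ₗ[ℂ] π.Space) c := by rw [htop]; trivial
    exact Module.End.mem_eigenspace_iff.1 this
  have h1 : ∀ i, ((‖π.derivCLM E (e i) w‖ : ℂ)) ^ 2 = -inner ℂ w (q (e i) (e i) w) := fun i => by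
    have h := π.inner_derivCLM_left (E := E) (e i) w (π.derivCLM E (e i) w)
    rw [inner_self_eq_norm_sq_to_K] at h
    exact h
  have h2 : (∑ i, ((‖π.derivCLM E (e i) w‖ : ℂ)) ^ 2) = -(c * (‖w‖ : ℂ) ^ 2) := by
    rw [Finset.sum_congr rfl fun i _ => h1 i, Finset.sum_neg_distrib, ← inner_sum]
    have h3 : ∑ i, q (e i) (e i) w = c • w := by
      rw [← hw]
      simp only [S, sum_apply]
    rw [h3, inner_smul_right, inner_self_eq_norm_sq_to_K]
    rfl
  have h4 := congrArg Complex.re h2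
  have h5 : (∑ i, ((‖π.derivCLM E (e i) w‖ : ℂ)) ^ 2) =
      ((∑ i, ‖π.derivCLM E (e i) w‖ ^ 2 : ℝ) : ℂ) := by push_cast; rfl
  have h6 : -(c * (‖w‖ : ℂ) ^ 2) = -(c * ((‖w‖ ^ 2 : ℝ) : ℂ)) := by push_cast; rfl
  rw [h5, h6, Complex.ofReal_re, Complex.neg_re, Complex.re_mul_ofReal] at h4
  rw [h4]
  ring

end UnitaryIrrep

/-- The derived representation on a highest weight vector is controlled by the highest weight. -/
lemma exists_norm_deriv_apply_le {B : LinearMap.BilinForm ℝ (GroupLieAlgebra 𝓘(ℝ, E) G)}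
    (hB : IsInnerProduct B) {𝔱 : Submodule ℝ (GroupLieAlgebra 𝓘(ℝ, E) G)}
    (h𝔱 : IsMaximalAbelian 𝔱) {H₀ : 𝔱} (hH₀ : IsRegularElement 𝔱 H₀)
    (X : GroupLieAlgebra 𝓘(ℝ, E) G) :
    ∃ C ≥ (0 : ℝ), ∀ (π : UnitaryIrrep G) (ℓ : Module.Dual ℝ 𝔱), IsHighestWeight 𝔱 H₀ π ℓ →
      ∀ v : π.Space, (∀ H : 𝔱, π.deriv (H : GroupLieAlgebra 𝓘(ℝ, E) G) v =
        (Complex.I * (ℓ H : ℂ)) • v) →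
      ‖π.deriv X v‖ ≤ C * Real.sqrt (weightNorm B 𝔱 ℓ ^ 2 + weightNorm B 𝔱 ℓ) * ‖v‖ := by
  have hX : X ∈ (⊤ : Submodule ℝ (GroupLieAlgebra 𝓘(ℝ, E) G)) := trivial
  rw [← span_positive_root_eq_top B hB 𝔱 h𝔱 H₀ hH₀] at hX
  induction hX using Submodule.span_induction with
  | mem X hX =>
    rcases hX with hX | ⟨Y, α, hbr, -, hα, hXY⟩
    · refine ⟨Real.sqrt (B X X), Real.sqrt_nonneg _, fun π ℓ _ v hv => ?_⟩
      set W := weightNorm B 𝔱 ℓ with hW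
      have hW0 : 0 ≤ W := weightNorm_nonneg B 𝔱 ℓ
      rw [hv ⟨X, hX⟩, norm_smul, norm_mul, Complex.norm_I, one_mul, Complex.norm_real,
        Real.norm_eq_abs]
      refine mul_le_mul_of_nonneg_right ?_ (norm_nonneg _)
      refine (abs_le_weightNorm_mul_sqrt hB 𝔱 ℓ ⟨X, hX⟩).trans ?_
      rw [mul_comm]
      refine mul_le_mul_of_nonneg_left ?_ (Real.sqrt_nonneg _)
      exact Real.le_sqrt_of_sq_le (by linarith)
    -- The squared norm is linear in `ℓ ⁅X, Y⁆`, hence of first order in `W`; this explains the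
    -- summand `W` under the root and the double root in the constant.
    · refine ⟨Real.sqrt (Real.sqrt (B ⁅X, Y⁆ ⁅X, Y⁆)), Real.sqrt_nonneg _,
        fun π ℓ hℓ v hv => ?_⟩
      set W := weightNorm B 𝔱 ℓ with hW
      have hW0 : 0 ≤ W := weightNorm_nonneg B 𝔱 ℓ
      have h1 := UnitaryIrrep.norm_deriv_sq_of_root (hv ⟨_, hbr⟩)
        (UnitaryIrrep.deriv_add_I_smul_deriv_eq_zero hℓ.2 hv hα hXY)
      have h2 := abs_le_weightNorm_mul_sqrt hB 𝔱 ℓ ⟨_, hbr⟩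
      set s := Real.sqrt (B ⁅X, Y⁆ ⁅X, Y⁆) with hs
      have hs0 : 0 ≤ s := Real.sqrt_nonneg _
      refine le_of_sq_le_sq ?_ (by positivity)
      rw [h1, mul_pow, mul_pow, Real.sq_sqrt hs0, Real.sq_sqrt (by positivity)]
      refine mul_le_mul_of_nonneg_right ?_ (sq_nonneg _)
      have h3 : -ℓ ⟨_, hbr⟩ ≤ W * s := (neg_le_abs _).trans h2
      nlinarith [mul_nonneg hs0 (sq_nonneg W), mul_nonneg hs0 hW0]
  | zero =>
    refine ⟨0, le_rfl, fun π ℓ _ v _ => ?_⟩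
    have h := π.deriv_smul_apply (0 : ℝ) (0 : GroupLieAlgebra 𝓘(ℝ, E) G) v
    rw [smul_zero, Complex.ofReal_zero, zero_smul] at h
    rw [h, norm_zero, zero_mul, zero_mul]
  | add X Y _ _ hX hY =>
    obtain ⟨C, hC, h⟩ := hX
    obtain ⟨C', hC', h'⟩ := hY
    refine ⟨C + C', add_nonneg hC hC', fun π ℓ hℓ v hv => ?_⟩
    rw [π.deriv_add_apply, add_mul, add_mul]
    exact (norm_add_le _ _).trans (add_le_add (h π ℓ hℓ v hv) (h' π ℓ hℓ v hv))
  | smul c X _ hX =>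
    obtain ⟨C, hC, h⟩ := hX
    refine ⟨|c| * C, by positivity, fun π ℓ hℓ v hv => ?_⟩
    rw [π.deriv_smul_apply, norm_smul, Complex.norm_real, Real.norm_eq_abs, mul_assoc, mul_assoc]
    exact mul_le_mul_of_nonneg_left ((h π ℓ hℓ v hv).trans_eq (mul_assoc _ _ _)) (abs_nonneg c)

/-- The derived representation is controlled by the highest weight. -/
theorem exists_norm_derivCLM_le {B : LinearMap.BilinForm ℝ (GroupLieAlgebra 𝓘(ℝ, E) G)}
    (hB : IsInnerProduct B) {𝔱 : Submodule ℝ (GroupLieAlgebra 𝓘(ℝ, E) G)}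
    (h𝔱 : IsMaximalAbelian 𝔱) {H₀ : 𝔱} (hH₀ : IsRegularElement 𝔱 H₀) :
    ∃ C > (0 : ℝ), ∀ (π : UnitaryIrrep G) (ℓ : Module.Dual ℝ 𝔱), IsHighestWeight 𝔱 H₀ π ℓ →
      ‖π.derivCLM E‖ ≤ C * Real.sqrt (weightNorm B 𝔱 ℓ ^ 2 + weightNorm B 𝔱 ℓ) := by
  let B₁ : LinearMap.BilinForm ℝ E := B
  obtain ⟨B', hs, hp, hinv⟩ := exists_invariant_bilin G B₁ hB.1 hB.2
  obtain ⟨e, he⟩ := exists_orthonormal_basis_bilin B' hs hp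
  have hX : ∀ i, ∃ C ≥ (0 : ℝ), ∀ (π : UnitaryIrrep G) (ℓ : Module.Dual ℝ 𝔱),
      IsHighestWeight 𝔱 H₀ π ℓ →
      ∀ v : π.Space, (∀ H : 𝔱, π.deriv (H : GroupLieAlgebra 𝓘(ℝ, E) G) v =
        (Complex.I * (ℓ H : ℂ)) • v) →
      ‖π.derivCLM E (e i) v‖ ≤
        C * Real.sqrt (weightNorm B 𝔱 ℓ ^ 2 + weightNorm B 𝔱 ℓ) * ‖v‖ := fun i => by
    obtain ⟨C, hC, h⟩ := exists_norm_deriv_apply_le hB h𝔱 hH₀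
      (e i : GroupLieAlgebra 𝓘(ℝ, E) G)
    refine ⟨C, hC, fun π ℓ hℓ v hv => ?_⟩
    have h1 : π.derivCLM E (e i) = π.deriv (e i : GroupLieAlgebra 𝓘(ℝ, E) G) :=
      (π.deriv_eq_derivCLM (e i : GroupLieAlgebra 𝓘(ℝ, E) G)).symm
    rw [h1]
    exact h π ℓ hℓ v hv
  choose C hC0 hC using hX
  set K := Fintype.card (Fin (Module.finrank ℝ E)) • ‖e.equivFunL.toContinuousLinearMap‖ with hK
  have hK0 : 0 ≤ K := by positivity
  refine ⟨K * Real.sqrt (∑ i, C i ^ 2) + 1, by positivity, fun π ℓ hℓ => ?_⟩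
  set R := weightNorm B 𝔱 ℓ ^ 2 + weightNorm B 𝔱 ℓ with hR
  have hR0 : 0 ≤ R := add_nonneg (sq_nonneg _) (weightNorm_nonneg B 𝔱 ℓ)
  obtain ⟨v, hv0, hv⟩ := hℓ.1
  obtain ⟨z, hz⟩ := π.exists_sum_norm_derivCLM_sq_eq hs hinv e he
  -- The scalar `z` is bounded by testing it on the highest weight vector; it then controls `dπ(e
  -- i)` on every vector, with no dependence on the dimension of `π`.
  have hzle : z ≤ (∑ i, C i ^ 2) * R := by
    have h1 : z * ‖v‖ ^ 2 ≤ (∑ i, C i ^ 2) * R * ‖v‖ ^ 2 := by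
      rw [← hz v, Finset.sum_mul, Finset.sum_mul]
      refine Finset.sum_le_sum fun i _ => ?_
      have h2 := pow_le_pow_left₀ (norm_nonneg _) (hC i π ℓ hℓ v hv) 2
      rwa [mul_pow, mul_pow, Real.sq_sqrt hR0] at h2
    exact le_of_mul_le_mul_right h1 (pow_pos (norm_pos_iff.2 hv0) 2)
  have hei : ∀ i, ‖π.derivCLM E (e i)‖ ≤ Real.sqrt (∑ i, C i ^ 2) * Real.sqrt R := fun i => by
    refine ContinuousLinearMap.opNorm_le_bound _ (by positivity) fun w => ?_
    refine le_of_sq_le_sq ?_ (by positivity)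
    have h1 : ‖π.derivCLM E (e i) w‖ ^ 2 ≤ z * ‖w‖ ^ 2 := by
      rw [← hz w]
      exact Finset.single_le_sum (f := fun i => ‖π.derivCLM E (e i) w‖ ^ 2)
        (fun i _ => sq_nonneg _) (Finset.mem_univ i)
    rw [mul_pow, mul_pow, Real.sq_sqrt (Finset.sum_nonneg fun i _ => sq_nonneg _),
      Real.sq_sqrt hR0]
    exact h1.trans (mul_le_mul_of_nonneg_right hzle (sq_nonneg _))
  refine (e.opNorm_le (by positivity) hei).trans ?_
  rw [← hK, ← mul_assoc]
  gcongr
  linarith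

end HighestWeight

/-! ### Assembly: bounds on highest weights and the contraction -/

theorem mainTheorem7
    -- a compact connected Lie group, an inner product on its Lie algebra, a maximal abelian
    -- subalgebra and a Weyl chamber
    {E : Type*} [NormedAddCommGroup E] [NormedSpace ℝ E] [FiniteDimensional ℝ E]
    {G : Type*} [TopologicalSpace G] [T2Space G] [CompactSpace G] [ConnectedSpace G]
    [ChartedSpace E G] [Group G] [LieGroup 𝓘(ℝ, E) ∞ G]
    (B : LinearMap.BilinForm ℝ (GroupLieAlgebra 𝓘(ℝ, E) G)) (hB : IsInnerProduct B)
    (𝔱 : Submodule ℝ (GroupLieAlgebra 𝓘(ℝ, E) G)) (h𝔱 : IsMaximalAbelian 𝔱)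
    (H₀ : 𝔱) (hH₀ : IsRegularElement 𝔱 H₀)
    -- an aperiodic subshift of finite type with metric constant `lam`
    {N : ℕ} (A : Matrix (Fin N) (Fin N) ℕ) (hA01 : IsZeroOne A) (hA : IsAperiodic A)
    (lam : ℝ) (hlam0 : 0 < lam) (hlam1 : lam < 1)
    -- the normalized potential, the roof function and the skewing function
    (φ : OneSided A → ℝ) (hφ : MemLip lam φ) (hφ1 : IsNormalizedPotential φ)
    (r : OneSided A → ℝ) (hr : MemLip lam r) (hr0 : ∀ x, 0 < r x)
    (Θ : OneSided A → G) (hΘ : MemLipGroup B lam Θ)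
    -- the Diophantine assumption
    (hD : ∃ (w : TwoSided A) (n₀ p₀ : ℕ), 1 ≤ p₀ ∧
      IsDiophantine B 𝔱 H₀ (chainTwists r Θ w n₀ p₀)) :
    ∃ C₀ > (0 : ℝ), ∀ C₁₅ ≥ C₀, ∃ K₀ ≥ (1 : ℝ), ∀ C₁₈ ≥ K₀,
      ∃ C₂₃ > (0 : ℝ), ∃ C₂₅ > (0 : ℝ),
        ∀ π : UnitaryIrrep G, π.Nontrivial → ∀ ℓ, IsHighestWeight 𝔱 H₀ π ℓ → ∀ b : ℝ,
          1 < frequency B 𝔱 C₁₅ ℓ b ∧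
          ∀ h : OneSided A → π.Space, MemLip lam h →
            MemLip lam ((π.transfer φ r Θ (Complex.I * b))^[
              ⌈C₂₅ * Real.log (frequency B 𝔱 C₁₅ ℓ b)⌉₊] h) ∧
            scaledNorm lam C₁₈ (frequency B 𝔱 C₁₅ ℓ b)
                ((π.transfer φ r Θ (Complex.I * b))^[
                  ⌈C₂₅ * Real.log (frequency B 𝔱 C₁₅ ℓ b)⌉₊] h) ≤
              (1 - frequency B 𝔱 C₁₅ ℓ b ^ (-C₂₃)) *
                scaledNorm lam C₁₈ (frequency B 𝔱 C₁₅ ℓ b) h := by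
  obtain ⟨C, hC, hle⟩ := exists_norm_derivCLM_le hB h𝔱 hH₀
  obtain ⟨c, hc, hlow⟩ := exists_le_norm_derivCLM (E := E) (G := G)
  obtain ⟨K, hΘ⟩ := hΘ
  have : FiniteDimensional ℝ (GroupLieAlgebra 𝓘(ℝ, E) G) := inferInstanceAs (FiniteDimensional ℝ E)
  obtain ⟨D, hD0, hnorm⟩ := exists_norm_le_mul_sqrt_bilin B hB.1 hB.2
    (F := E) (LinearMap.id : E →ₗ[ℝ] E)
  -- If `W < c₀ ≤ 1`, then `W ^ 2 + W < 2 * c₀`, and the upper bound on `‖dπ‖` would fall below the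
  -- lower bound `c`.
  obtain ⟨c₀, hc₀, hc₀1, hc₀2⟩ : ∃ c₀ > (0 : ℝ), c₀ ≤ 1 ∧ C ^ 2 * (2 * c₀) ≤ c ^ 2 := by
    refine ⟨min 1 (c ^ 2 / (2 * C ^ 2)), by positivity, min_le_left _ _, ?_⟩
    calc C ^ 2 * (2 * min 1 (c ^ 2 / (2 * C ^ 2))) ≤ C ^ 2 * (2 * (c ^ 2 / (2 * C ^ 2))) := by
          gcongr
          exact min_le_right _ _
      _ = c ^ 2 := by field_simp
  have hlow' : ∀ π : UnitaryIrrep G, π.Nontrivial → ∀ ℓ, IsHighestWeight 𝔱 H₀ π ℓ →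
      c₀ ≤ weightNorm B 𝔱 ℓ := by
    intro π hπ ℓ hℓ
    have hW0 := weightNorm_nonneg B 𝔱 ℓ
    set W := weightNorm B 𝔱 ℓ with hW
    by_contra! hlt
    have h1 := pow_le_pow_left₀ hc.le ((hlow π hπ).trans (hle π ℓ hℓ)) 2
    rw [mul_pow, Real.sq_sqrt (by positivity)] at h1
    have h2 : W ^ 2 + W < 2 * c₀ := by nlinarith
    have h3 : C ^ 2 * (W ^ 2 + W) < C ^ 2 * (2 * c₀) := by gcongr
    linarith
  refine contraction_of_highestWeight_bounds B 𝔱 H₀ A hA01 hA lam hlam0 hlam1 φ hφ hφ1 r hr Θ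
    (C := C * Real.sqrt (1 + c₀⁻¹) * D * max K 0) (by positivity) hc₀ ?_ hlow' hD
  intro π hπ ℓ hℓ x y
  have hWc := hlow' π hπ ℓ hℓ
  have hdist : 0 ≤ OneSided.dist lam x y := OneSided.dist_nonneg hlam0.le x y
  set W := weightNorm B 𝔱 ℓ with hW
  have hW0 : 0 < W := hc₀.trans_le hWc
  -- The lower bound `W ≥ c₀` absorbs the first power of `W` into its square, so `‖dπ‖` is linear in
  -- the weight.
  have hsq : Real.sqrt (W ^ 2 + W) ≤ Real.sqrt (1 + c₀⁻¹) * W := by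
    refine Real.sqrt_le_iff.2 ⟨by positivity, ?_⟩
    rw [mul_pow, Real.sq_sqrt (by positivity)]
    have h1 : 1 ≤ c₀⁻¹ * W := by rwa [inv_mul_eq_div, one_le_div hc₀]
    nlinarith
  have hder : ∀ X : GroupLieAlgebra 𝓘(ℝ, E) G, ‖π.derivCLM E (X : E)‖ ≤
      C * Real.sqrt (1 + c₀⁻¹) * D * W * Real.sqrt (B X X) := by
    intro X
    refine ((π.derivCLM E).le_of_opNorm_le_of_le ((hle π ℓ hℓ).trans
      (mul_le_mul_of_nonneg_left hsq hC.le)) (hnorm X)).trans_eq ?_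
    ring
  have h := π.norm_op_sub_le_of_lieDist_le B (by positivity) hder
    (d := max K 0 * OneSided.dist lam x y) (by positivity) ((hΘ x y).trans
      (ENNReal.ofReal_le_ofReal (mul_le_mul_of_nonneg_right (le_max_left _ _) hdist)))
  refine h.trans_eq ?_
  ring
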